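/- **Setting.** A thinker is a map $f:\{0,1\}^*\to\{0,1\}$; put $\bar f(x)=[x,f(x)]$, let $f^{\mathrm{e2e},T}(x)$ be the last bit of $\bar f^{\,T}(x)$, and let $f^{\mathrm{CoT},T}(x)=[f^{\mathrm{e2e},1}(x),\dots,f^{\mathrm{e2e},T}(x)]$. For $w\in\mathbb R^d$ let $f_w(z)=\mathbf 1\{\sum_{i=1}^{\min(d,|z|)}w[-i]\,z[-i]\ge 0\}$, where $[-i]$ denotes the $i$-th coordinate from the end, and let $\mathcal F_{d,\mathrm{lin}}=\{f_w: w\in\mathbb R^d\}$ and $\mathcal F_{d,\mathrm{lin}}^{\mathrm{e2e},T}=\{f_w^{\mathrm{e2e},T}: w\in\mathbb R^d\}$. Prompts lie in $\{0,1\}^{\le d}$. **Assumption (local PRGs with polynomial stretch).** For every integer $s>1$ there are a constant $K$ and a predicate $P:\{0,1\}^K\to\{0,1\}$ such that, with $M=N^s$, every probabilistic polynomial-time algorithm $\mathcal A$ satisfies, for all sufficiently large $N$, $$\bigl|\Pr[\mathcal A(G,(P(x_{S_1}),\dots,P(x_{S_M})))=1]-\Pr[\mathcal A(G,y)=1]\bigr|\le\tfrac13,$$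 where $G=(S_1,\dots,S_M)$ consists of independent uniform ordered $K$-tuples of distinct elements of $[N]$, and $x\in\{0,1\}^N$, $y\in\{0,1\}^M$ are uniform and independent of $G$. **Learning.** Fix functions $g(d)\to\infty$ and $\mathsf M_\star(d)\ge 1$, where $\mathsf M_\star$ is bounded by a polynomial in $d$, a failure probability $\delta<1$, and $c>0$. The accuracies considered are $\varepsilon=1/k$ with integers $k\ge3$. An adversary chooses a distribution $D$ on $\{0,1\}^{\le d}$ and thinkers $f_1,\dots,f_\kappa\in\mathcal F_{d,\mathrm{lin}}$ that all satisfy $f_j^{\mathrm{e2e},T}=h_*$ for one $h_*\in\mathcal F_{d,\mathrm{lin}}^{\mathrm{e2e},T}$. The learner is a randomized algorithm. It receives $d$, $1/\varepsilon$, $T$, $\kappa$ and batches of $\mathsf M_\star(d)$ examples $(x,f^{\mathrm{CoT},T}(x))$ each, where the prompts $x\sim D$ are independent, all examples of one batch come from the same thinker $f$, and the partition into batches is known. It learns to error $\varepsilon$ if for every choice of the adversary it outputs, with probability at least $1-\delta$ over the sample and its coins, a hypothesis $\hat h$ with $\Pr_{x\sim D}[\hat h(x)\ne h_*(x)]\le\varepsilon$.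 It is $\mathrm{poly}(d,1/\varepsilon)$-time if training and evaluating $\hat h$ at a prompt take time polynomial in $d$, $1/\varepsilon$ and the number of examples, on every sample of the right format (this number is itself $\mathrm{poly}(d,1/\varepsilon)$ in the statements below). **Theorem.** Assume that local PRGs with polynomial stretch exist. 1. (Uniformly random thinkers.) Let the thinker of each batch be drawn independently and uniformly from $f_1,\dots,f_\kappa$. For every polynomial $p$ there is no $\mathrm{poly}(d,1/\varepsilon)$-time algorithm that, for all $d\ge1$, all $\varepsilon$ and all $1\le T,\kappa\le g(d)$, learns $\mathcal F_{d,\mathrm{lin}}^{\mathrm{e2e},T}$ to error $\varepsilon$ from a total number of examples that is at most $p(d)/\varepsilon^{2-c}$. 2. (A different thinker in each batch.) Let there be $\kappa=\kappa(d,\varepsilon,T)$ batches, the $j$-th one coming from $f_j$. For every polynomial $p$ there is no $\mathrm{poly}(d,1/\varepsilon)$-time algorithm that, for all $d\ge1$, all $\varepsilon$ and all $1\le T\le g(d)$, learns $\mathcal F_{d,\mathrm{lin}}^{\mathrm{e2e},T}$ to error $\varepsilon$ with $\kappa(d,\varepsilon,T)\le p(d)/\varepsilon^{2-c}$. 3.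 (Statistical side of the gap.) In contrast, there is a constant $C$ such that for all $d,T\ge1$ some learning rule, without computational restrictions, learns $\mathcal F_{d,\mathrm{lin}}^{\mathrm{e2e},T}$ over $\{0,1\}^{\le d}$ from $n\ge C\,(d^2+\log(1/\eta))/\varepsilon$ end-to-end labelled examples $(x,h_*(x))$ alone, to error $\varepsilon$ with probability at least $1-\eta$, for all $\varepsilon,\eta\in(0,1)$. -/

import Mathlib

open Filter

namespace CoTGap

/-! ### Machine model: a structured pointer machine on binary trees, with a step count

Programs are WHILE programs over binary trees (the language used by N. Jones for which the
polynomial-time programs decide exactly the languages decided by polynomial-time Turing machines).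
The only operations are building a cell, taking its left or right component, and testing for `nil`;
every evaluated node of an expression and every executed command costs one step. -/

/-- The data of the machine: binary trees. -/
inductive Data : Type
  | nil : Data
  | cons (a b : Data) : Data

/-- Left component. -/
def Data.hd : Data → Data
  | .nil => .nil
  | .cons a _ => a

/-- Right component. -/
def Data.tl : Data → Data
  | .nil => .nil
  | .cons _ b => b

/-- Stores: the contents of the registers `0, 1, 2, …`. -/
abbrev Store : Type := ℕ → Data

/-- Expressions. -/
inductive Exp : Type
  | nil : Exp
  | var (v : ℕ) : Exp
  | cons (a b : Exp) : Exp
  | hd (a : Exp) : Exp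
  | tl (a : Exp) : Exp

/-- Value of an expression in a store. -/
def Exp.eval (s : Store) : Exp → Data
  | .nil => .nil
  | .var v => s v
  | .cons a b => .cons (a.eval s) (b.eval s)
  | .hd a => (a.eval s).hd
  | .tl a => (a.eval s).tl

/-- Number of nodes of an expression, the number of steps that its evaluation takes. -/
def Exp.size : Exp → ℕ
  | .nil => 1
  | .var _ => 1
  | .cons a b => a.size + b.size + 1
  | .hd a => a.size + 1
  | .tl a => a.size + 1

/-- Programs. -/
inductive Prog : Type
  | assign (v : ℕ) (e : Exp) : Prog
  | seq (p q : Prog) : Prog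
  | ite (e : Exp) (p q : Prog) : Prog
  | while (e : Exp) (p : Prog) : Prog

/-- `Exec p s s' n`: started in store `s`, the program `p` halts in store `s'` after exactly
`n` steps. A test succeeds if the expression does not evaluate to `nil`. -/
inductive Exec : Prog → Store → Store → ℕ → Prop
  | assign (s : Store) (v : ℕ) (e : Exp) :
      Exec (.assign v e) s (Function.update s v (e.eval s)) (e.size + 1)
  | seq {p q : Prog} {s s' s'' : Store} {m n : ℕ} :
      Exec p s s' m → Exec q s' s'' n → Exec (.seq p q) s s'' (m + n + 1)
  | ite_true {e : Exp} {p q : Prog} {s s' : Store} {n : ℕ} :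
      e.eval s ≠ .nil → Exec p s s' n → Exec (.ite e p q) s s' (e.size + n + 1)
  | ite_false {e : Exp} {p q : Prog} {s s' : Store} {n : ℕ} :
      e.eval s = .nil → Exec q s s' n → Exec (.ite e p q) s s' (e.size + n + 1)
  | while_true {e : Exp} {p : Prog} {s s' s'' : Store} {m n : ℕ} :
      e.eval s ≠ .nil → Exec p s s' m → Exec (.while e p) s' s'' n →
      Exec (.while e p) s s'' (e.size + m + n + 1)
  | while_false {e : Exp} {p : Prog} {s : Store} :
      e.eval s = .nil → Exec (.while e p) s s (e.size + 1)

/-- The initial store: the input is in register `0`, all other registers are empty. -/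
def initStore (a : Data) : Store := Function.update (fun _ => .nil) 0 a

/-- On input `a` the program `p` halts with output `b` (left in register `0`) within
`t` steps. -/
def HaltsWithin (p : Prog) (a b : Data) (t : ℕ) : Prop :=
  ∃ (s : Store) (n : ℕ), Exec p (initStore a) s n ∧ n ≤ t ∧ s 0 = b

/-- On input `a` the program `p` halts with output `b`. -/
def Outputs (p : Prog) (a b : Data) : Prop := ∃ t : ℕ, HaltsWithin p a b t

/-! ### Encodings of inputs and outputs -/

/-- Lists, as right-nested cells. -/
def encList {α : Type} (enc : α → Data) : List α → Data
  | [] => .nil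
  | a :: l => .cons (enc a) (encList enc l)

/-- Bits. -/
def encBool : Bool → Data
  | false => .nil
  | true => .cons .nil .nil

/-- Natural numbers, in unary. -/
def encNat (n : ℕ) : Data := encList (fun _ => Data.nil) (List.replicate n ())

/-- Bit strings. -/
def encStr : List Bool → Data := encList encBool

/-! ### Finite probability -/

/-- Probability of an event. -/
noncomputable def Pr {α : Type} (p : PMF α) (E : α → Prop) : ℝ :=
  (p.toOuterMeasure {a | E a}).toReal

/-- Independent draws, one from each law in the list. -/
noncomputable def indep {α : Type} : List (PMF α) → PMF (List α)
  | [] => PMF.pure []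
  | p :: ps => p.bind fun a => (indep ps).map fun l => a :: l

/-- `n` independent draws from `p`. -/
noncomputable def iid {α : Type} (p : PMF α) (n : ℕ) : PMF (List α) :=
  indep (List.replicate n p)

/-- `n` fair coin flips. -/
noncomputable def coins (n : ℕ) : PMF (List Bool) := iid (PMF.uniformOfFintype Bool) n

/-! ### Goldreich's local pseudorandom generators -/

/-- A hyperedge: an ordered `K`-tuple of distinct vertices of `{0, …, N-1}`. -/
abbrev Hyperedge (K N : ℕ) : Type := Fin K ↪ Fin N

/-- The output `(P(x_{S_1}), …, P(x_{S_M}))` of the generator given by the predicate `P` and the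
hypergraph `G = (S_1, …, S_M)`. -/
def goldreich {K N : ℕ} (P : (Fin K → Bool) → Bool) (G : List (Hyperedge K N))
    (x : Fin N → Bool) : List Bool :=
  G.map fun S => P fun i => x (S i)

/-- The input `(1^N, G, y, r)` of a distinguisher; `r` are its random coins. -/
def encChallenge {K N : ℕ} (G : List (Hyperedge K N)) (y r : List Bool) : Data :=
  .cons (encNat N) (.cons
    (encList (fun S : Hyperedge K N => encList (fun v : Fin N => encNat v) (List.ofFn S)) G)
    (.cons (encStr y) (encStr r)))

/-- The law of (hypergraph, generator output on a uniform seed, coins). -/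
noncomputable def pseudoLaw {K N : ℕ} [Nonempty (Hyperedge K N)] (P : (Fin K → Bool) → Bool)
    (M R : ℕ) : PMF (List (Hyperedge K N) × List Bool × List Bool) :=
  (iid (PMF.uniformOfFintype (Hyperedge K N)) M).bind fun G =>
    (PMF.uniformOfFintype (Fin N → Bool)).bind fun x =>
      (coins R).map fun r => (G, goldreich P G x, r)

/-- The law of (hypergraph, uniform string, coins). -/
noncomputable def uniformLaw (K N : ℕ) [Nonempty (Hyperedge K N)] (M R : ℕ) :
    PMF (List (Hyperedge K N) × List Bool × List Bool) :=
  (iid (PMF.uniformOfFintype (Hyperedge K N)) M).bind fun G =>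
    (coins M).bind fun y =>
      (coins R).map fun r => (G, y, r)

/-- `A` is a probabilistic polynomial-time distinguisher for hypergraphs with `N ^ s` hyperedges of
size `K`: with `ρ(N)` coins it always halts within `τ(N)` steps and outputs a bit. -/
def IsPPTDistinguisher (K s : ℕ) (A : Prog) (ρ τ : Polynomial ℕ) : Prop :=
  ∀ (N : ℕ) (G : List (Hyperedge K N)) (y r : List Bool),
    G.length = N ^ s → y.length = N ^ s → r.length = ρ.eval N →
    ∃ b : Bool, HaltsWithin A (encChallenge G y r) (encBool b) (τ.eval N)

/-- The generators given by the predicate `P` with `N` seed bits and `N ^ s` output bits are an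
`η`-pseudorandom generator: every probabilistic polynomial-time distinguisher has advantage at
most `η` for all large `N`. -/
def IsPRG {K : ℕ} (P : (Fin K → Bool) → Bool) (s : ℕ) (η : ℝ) : Prop :=
  ∀ (A : Prog) (ρ τ : Polynomial ℕ), IsPPTDistinguisher K s A ρ τ →
    ∀ᶠ N in atTop, ∀ _ : Nonempty (Hyperedge K N),
      |Pr (pseudoLaw (N := N) P (N ^ s) (ρ.eval N))
          (fun c => Outputs A (encChallenge c.1 c.2.1 c.2.2) (encBool true))
        - Pr (uniformLaw K N (N ^ s) (ρ.eval N))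
          (fun c => Outputs A (encChallenge c.1 c.2.1 c.2.2) (encBool true))| ≤ η

/-- Local pseudorandom generators with polynomial stretch exist: for every constant exponent
`s > 1` there are a constant locality `K` and a predicate `P` on `K` bits whose generators with
stretch `N ↦ N ^ s` are a `1/3`-pseudorandom generator. -/
def LocalPRGExists : Prop :=
  ∀ s : ℕ, 1 < s → ∃ (K : ℕ) (P : (Fin K → Bool) → Bool), IsPRG P s (1 / 3)

/-! ### Autoregressive linear thresholds -/

/-- A thinker (sequence-to-next-token generator). -/
abbrev Thinker : Type := List Bool → Bool

/-- Apply and append. -/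
def extend (f : Thinker) (z : List Bool) : List Bool := z ++ [f z]

/-- End-to-end map after `T` steps: the last bit after `T` applications of `extend f`
(the default value plays no role for `T ≥ 1`). -/
def e2e (f : Thinker) (T : ℕ) (x : List Bool) : Bool := ((extend f)^[T] x).getLastD false

/-- The chain of thought `[e2e f 1 x, …, e2e f T x]`. -/
def cot (f : Thinker) (T : ℕ) (x : List Bool) : List Bool :=
  (List.range T).map fun t => e2e f (t + 1) x

/-- The linear threshold `z ↦ 1{∑_{i=1}^{min(d,|z|)} w[-i] z[-i] ≥ 0}` of window size `d`. Here `i`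
is counted from `0`, `Fin.rev i` is the corresponding index from the end of `w`, and positions
beyond the beginning of `z` contribute `0`. -/
noncomputable def linThinker {d : ℕ} (w : Fin d → ℝ) : Thinker := fun z =>
  open Classical in
  decide (0 ≤ ∑ i : Fin d, if z.reverse.getD i false then w i.rev else 0)

/-! ### Learning from batches of chains of thought -/

/-- A prompt with its chain of thought. -/
abbrev Example : Type := List Bool × List Bool

/-- A sample as the learner sees it: the list of its batches, so that the partition of the
examples into batches is known. -/
abbrev BatchedSample : Type := List (List Example)

/-- One batch: `M` independent prompts from `D`, with chains of thought of the thinker `f`. -/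
noncomputable def batchLaw (D : PMF (List Bool)) (f : Thinker) (T M : ℕ) : PMF (List Example) :=
  iid (D.map fun x => (x, cot f T x)) M

/-- `q` batches; the thinker of each batch is drawn uniformly and independently from `f`. -/
noncomputable def randomThinkersLaw (D : PMF (List Bool)) {κ : ℕ} [NeZero κ]
    (f : Fin κ → Thinker) (T M q : ℕ) : PMF BatchedSample :=
  iid ((PMF.uniformOfFintype (Fin κ)).bind fun j => batchLaw D (f j) T M) q

/-- `κ` batches; the `j`-th batch comes from the `j`-th thinker. -/
noncomputable def distinctThinkersLaw (D : PMF (List Bool)) {κ : ℕ}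
    (f : Fin κ → Thinker) (T M : ℕ) : PMF BatchedSample :=
  indep (List.ofFn fun j => batchLaw D (f j) T M)

/-- A randomized learning algorithm: `train` maps a sample and random coins to a representation
of a hypothesis, and `predict` evaluates that representation at a prompt. For window size `d` and
accuracy `1 / k`, the number of coins is `coinBound (d + k)`; `timeBound` bounds the running
time. -/
structure Learner where
  train : Prog
  predict : Prog
  coinBound : Polynomial ℕ
  timeBound : Polynomial ℕ

/-- The input of `train`: window size `d`, inverse accuracy `k = 1/ε`, thinking length `T`, number
`κ` of thinkers, the sample and the random coins. -/
def encTrainInput (d k T κ : ℕ) (S : BatchedSample) (r : List Bool) : Data :=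
  .cons (encNat d) (.cons (encNat k) (.cons (encNat T) (.cons (encNat κ) (.cons
    (encList (encList fun e : Example => Data.cons (encStr e.1) (encStr e.2)) S)
    (encStr r)))))

/-- The input of `predict`: a hypothesis and a prompt. -/
def encPredictInput (hyp : Data) (x : List Bool) : Data := .cons hyp (encStr x)

/-- The learner runs in time polynomial in `d`, `k = 1/ε` and the number of examples. This covers
both producing a hypothesis and evaluating it at a prompt. The relation `adm d T κ q` restricts the
thinking lengths and numbers of thinkers to be considered when there are `q` batches. -/
def Learner.RunsInPolyTime (L : Learner) (adm : ℕ → ℕ → ℕ → ℕ → Prop) : Prop :=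
  ∀ (d k T κ : ℕ) (S : BatchedSample) (r : List Bool),
    1 ≤ d → 3 ≤ k → adm d T κ S.length →
    (∀ B ∈ S, B ≠ [] ∧ ∀ e ∈ B, e.1.length ≤ d ∧ e.2.length = T) →
    r.length = L.coinBound.eval (d + k) →
    ∃ hyp : Data,
      HaltsWithin L.train (encTrainInput d k T κ S r) hyp
        (L.timeBound.eval (d + k + S.flatten.length)) ∧
      ∀ x : List Bool, x.length ≤ d → ∃ b : Bool,
        HaltsWithin L.predict (encPredictInput hyp x) (encBool b)
          (L.timeBound.eval (d + k + S.flatten.length))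

/-- When the sample is drawn from `law`, the learner returns, with probability at least `1 - δ`
over the sample and its coins, a hypothesis that disagrees with `h` with probability at most
`ε = 1 / k` under `D`. -/
def Learner.SucceedsOn (L : Learner) (d k T κ : ℕ) (δ : ℝ) (D : PMF (List Bool))
    (h : List Bool → Bool) (law : PMF BatchedSample) : Prop :=
  1 - δ ≤ Pr (law.bind fun S => (coins (L.coinBound.eval (d + k))).map fun r => (S, r))
    (fun c => ∃ hyp : Data, Outputs L.train (encTrainInput d k T κ c.1 c.2) hyp ∧
      Pr D (fun x => ¬ Outputs L.predict (encPredictInput hyp x) (encBool (h x))) ≤ 1 / (k : ℝ))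

/-- `D` is a distribution on the domain `{0,1}^{≤ d}`. -/
def SupportedOn (d : ℕ) (D : PMF (List Bool)) : Prop := ∀ x ∈ D.support, x.length ≤ d

/-- Polynomial-time learning of the end-to-end class of linear thresholds, with failure
probability `δ`, from `q d k T κ` batches of size `M d` with uniformly random thinkers, for all
thinking lengths and numbers of thinkers up to `g d`. -/
def Learner.LearnsFromRandomThinkers (L : Learner) (g : ℕ → ℝ) (M : ℕ → ℕ) (δ : ℝ)
    (q : ℕ → ℕ → ℕ → ℕ → ℕ) : Prop :=
  L.RunsInPolyTime (fun d T κ _ => 1 ≤ T ∧ (T : ℝ) ≤ g d ∧ 1 ≤ κ ∧ (κ : ℝ) ≤ g d) ∧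
  ∀ (d k T κ : ℕ) [NeZero κ], 1 ≤ d → 3 ≤ k → 1 ≤ T → (T : ℝ) ≤ g d → (κ : ℝ) ≤ g d →
    ∀ (D : PMF (List Bool)) (h : List Bool → Bool) (w : Fin κ → Fin d → ℝ),
      SupportedOn d D → (∀ j, e2e (linThinker (w j)) T = h) →
      L.SucceedsOn d k T κ δ D h
        (randomThinkersLaw D (fun j => linThinker (w j)) T (M d) (q d k T κ))

/-- Polynomial-time learning of the end-to-end class of linear thresholds, with failure
probability `δ`, from `κ d k T` thinkers, each of which provides one batch of size `M d`, for all
thinking lengths up to `g d`. -/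
def Learner.LearnsFromDistinctThinkers (L : Learner) (g : ℕ → ℝ) (M : ℕ → ℕ) (δ : ℝ)
    (κ : ℕ → ℕ → ℕ → ℕ) : Prop :=
  L.RunsInPolyTime (fun d T κ' q => 1 ≤ T ∧ (T : ℝ) ≤ g d ∧ κ' = q) ∧
  ∀ (d k T : ℕ), 1 ≤ d → 3 ≤ k → 1 ≤ T → (T : ℝ) ≤ g d →
    ∀ (D : PMF (List Bool)) (h : List Bool → Bool) (w₀ : Fin d → ℝ)
      (w : Fin (κ d k T) → Fin d → ℝ),
      SupportedOn d D → e2e (linThinker w₀) T = h → (∀ j, e2e (linThinker (w j)) T = h) →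
      L.SucceedsOn d k T (κ d k T) δ D h
        (distinctThinkersLaw D (fun j => linThinker (w j)) T (M d))

/-- Without computational restrictions, and from end-to-end labels alone, the end-to-end class of
linear thresholds of window size `d` and thinking length `T` is learnable over `{0,1}^{≤ d}` with
sample complexity `m ε δ`. -/
def LearnableFromLabels (d T : ℕ) (m : ℝ → ℝ → ℝ) : Prop :=
  ∃ A : List (List Bool × Bool) → List Bool → Bool,
    ∀ (ε δ : ℝ), 0 < ε → ε < 1 → 0 < δ → δ < 1 → ∀ n : ℕ, m ε δ ≤ n →
      ∀ (D : PMF (List Bool)) (w : Fin d → ℝ), SupportedOn d D →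
        1 - δ ≤ Pr ((iid D n).map fun xs => xs.map fun x => (x, e2e (linThinker w) T x))
          (fun S => Pr D (fun x => A S x ≠ e2e (linThinker w) T x) ≤ ε)

end CoTGap

/-! Hardness (parts 1 and 2). A learner is turned into a distinguisher for Goldreich's generator
with predicate `P` on `K` bits and secret seed `x`. Put `n = 2 ^ K`. For each seed there are linear
thresholds `f_v`, `v ∈ Fin n`, which evaluate `P(x_S)` on a prompt encoding a hyperedge `S`: they
test one after the other, in `n` consecutive steps, the `n` possible values of `x_S`, in an order
rotated by `v`. The chain of thought is then zero except for a single one at location `a + v`, where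
`a` is the index of `x_S`, and for the answer. The answer, and in fact the end-to-end map on every
string, does not depend on `v` (`final_independent`). For uniform `v` the location is uniform, so
one informative example reveals only the label and can be simulated without the seed: take the given
label and a random location. Two informative examples of one batch would reveal the difference of
their assignments.

The prompt distribution is therefore mostly a blank prompt with a constant chain of thought; a
hyperedge appears with probability `2 ^ (-b)`, where `2 ^ b` is about `N ^ e`. A batch of `M`
examples has two informative ones with probability at most `(M 2 ^ (-b)) ^ 2`
(`Ex_iid_not_agree_le`). Otherwise the simulation of the batch is exact (`Ex_batchLaw_le`), so with
`q` batches the learner loses success probability at most `q (M 2 ^ (-b)) ^ 2`. With `k = 4 N ^ (e +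
1)` and `q ≤ p(d) k ^ (2 - c)` this is `O(1 / N)` once `(e + 1) c` exceeds the relevant degrees
(`collision_bound`). Error `1 / k` overall means error at most `1 / (2 N)` on hyperedges, so a good
hypothesis predicts `N` fresh labels with probability at least `1 / 2`. On truly random labels any
hypothesis does this with probability at most `2 ^ (-N)`. Repeating the trial `N` times, for all
small values of the unknown parameters, gives advantage at least `1 / 2 > 1 / 3`
(`Reduction.not_isPRG`). Part 2 reduces to random thinkers by averaging over the adversary's choices
(`le_Ex_iid_bind`).

The thinking length `4 n + 1` is constant in `N`, hence eventually below `g`. The stretch has to be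
chosen before `K` and `P` are known, so the exponent of the number of items used must not depend on
`K`; this is why `Growth` tracks exponents.

Statistical side (part 3). The end-to-end map is determined by the set of accepted windows.
Homogeneous halfspaces have VC dimension at most `d`, so the Sauer–Shelah lemma leaves at most `(2 ^
d + 1) ^ d` such sets, independently of `T`, and the union bound for a consistent hypothesis
suffices. -/

namespace CoTGap

/-! ### Running programs -/

/-- A number above all registers that an expression reads. -/
def Exp.bound : Exp → ℕ
  | .nil => 0
  | .var v => v + 1
  | .cons a b => max a.bound b.bound
  | .hd a => a.bound
  | .tl a => a.bound

/-- A number above all registers that a program uses. -/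
def Prog.bound : Prog → ℕ
  | .assign v e => max (v + 1) e.bound
  | .seq p q => max p.bound q.bound
  | .ite e p q => max e.bound (max p.bound q.bound)
  | .while e p => max e.bound p.bound

theorem Exp.eval_congr {B : ℕ} {s s' : Store} (h : ∀ v < B, s v = s' v) :
    ∀ e : Exp, e.bound ≤ B → e.eval s = e.eval s'
  | .nil, _ => rfl
  | .var v, hb => h v hb
  | .cons a b, hb => by
      simp only [Exp.bound, max_le_iff] at hb
      simp only [Exp.eval, Exp.eval_congr h a hb.1, Exp.eval_congr h b hb.2]
  | .hd a, hb => by simp only [Exp.eval, Exp.eval_congr h a hb]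
  | .tl a, hb => by simp only [Exp.eval, Exp.eval_congr h a hb]

/-- The store that agrees with `s` below `B` and with `u` from `B` on. -/
def splice (B : ℕ) (s u : Store) : Store := fun v => if v < B then s v else u v

theorem splice_update {B v : ℕ} (hv : v < B) (s u : Store) (a : Data) :
    splice B (Function.update s v a) u = Function.update (splice B s u) v a := by
  funext x
  by_cases hx : x = v
  · subst hx; simp [splice, hv]
  · simp [splice, Function.update_of_ne hx]

theorem eval_splice {B : ℕ} {e : Exp} (he : e.bound ≤ B) (s u : Store) :
    e.eval (splice B s u) = e.eval s :=
  Exp.eval_congr (fun v hv => by simp [splice, hv]) e he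

/-- A program neither reads nor writes registers from its bound on. These registers can therefore
hold the data of a caller. -/
theorem Exec.splice {p : Prog} {s s' : Store} {n : ℕ} (h : Exec p s s' n) {B : ℕ} (u : Store)
    (hB : p.bound ≤ B) : Exec p (splice B s u) (splice B s' u) n := by
  induction h with
  | assign s v e =>
    simp only [Prog.bound, max_le_iff] at hB
    rw [splice_update (by omega), ← eval_splice hB.2 s u]
    exact Exec.assign _ _ _
  | seq _ _ ih₁ ih₂ =>
    simp only [Prog.bound, max_le_iff] at hB
    exact Exec.seq (ih₁ hB.1) (ih₂ hB.2)
  | ite_true h _ ih =>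
    simp only [Prog.bound, max_le_iff] at hB
    exact Exec.ite_true (by rwa [eval_splice hB.1]) (ih hB.2.1)
  | ite_false h _ ih =>
    simp only [Prog.bound, max_le_iff] at hB
    exact Exec.ite_false (by rwa [eval_splice hB.1]) (ih hB.2.2)
  | while_true h _ _ ih₁ ih₂ =>
    have hB' := hB
    simp only [Prog.bound, max_le_iff] at hB
    exact Exec.while_true (by rwa [eval_splice hB.1]) (ih₁ hB.2) (ih₂ hB')
  | while_false h =>
    simp only [Prog.bound, max_le_iff] at hB
    exact Exec.while_false (by rwa [eval_splice hB.1])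

theorem Exec.deterministic {p : Prog} {s s₁ s₂ : Store} {m n : ℕ} (h₁ : Exec p s s₁ m)
    (h₂ : Exec p s s₂ n) : s₁ = s₂ := by
  induction h₁ generalizing s₂ n with
  | assign s v e => cases h₂; rfl
  | seq _ _ ih₁ ih₂ =>
    cases h₂ with
    | seq a b => cases ih₁ a; exact ih₂ b
  | ite_true h _ ih =>
    cases h₂ with
    | ite_true _ a => exact ih a
    | ite_false h' _ => exact absurd h' h
  | ite_false h _ ih =>
    cases h₂ with
    | ite_true h' _ => exact absurd h h'
    | ite_false _ a => exact ih a
  | while_true h _ _ ih₁ ih₂ =>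
    cases h₂ with
    | while_true _ a b => cases ih₁ a; exact ih₂ b
    | while_false h' => exact absurd h' h
  | while_false h =>
    cases h₂ with
    | while_true h' _ _ => exact absurd h h'
    | while_false _ => rfl

theorem HaltsWithin.outputs {p : Prog} {a b : Data} {t : ℕ} (h : HaltsWithin p a b t) :
    Outputs p a b := ⟨t, h⟩

theorem Outputs.unique {p : Prog} {a b c : Data} (h₁ : Outputs p a b) (h₂ : Outputs p a c) :
    b = c := by
  obtain ⟨_, s₁, _, e₁, _, rfl⟩ := h₁
  obtain ⟨_, s₂, _, e₂, _, rfl⟩ := h₂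
  rw [e₁.deterministic e₂]

theorem HaltsWithin.mono {p : Prog} {a b : Data} {t t' : ℕ} (h : HaltsWithin p a b t)
    (ht : t ≤ t') : HaltsWithin p a b t' := by
  obtain ⟨s, n, e, hn, hb⟩ := h
  exact ⟨s, n, e, hn.trans ht, hb⟩

/-- `p` leads from `s` to `s'` within `t` steps. -/
def Runs (p : Prog) (s s' : Store) (t : ℕ) : Prop := ∃ n ≤ t, Exec p s s' n

theorem Runs.assign (s : Store) (v : ℕ) (e : Exp) :
    Runs (.assign v e) s (Function.update s v (e.eval s)) (e.size + 1) :=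
  ⟨_, le_rfl, .assign s v e⟩

theorem Runs.seq {p q : Prog} {s s' s'' : Store} {m n : ℕ} (h₁ : Runs p s s' m)
    (h₂ : Runs q s' s'' n) : Runs (.seq p q) s s'' (m + n + 1) := by
  obtain ⟨a, ha, e₁⟩ := h₁
  obtain ⟨b, hb, e₂⟩ := h₂
  exact ⟨_, by omega, .seq e₁ e₂⟩

theorem Runs.mono {p : Prog} {s s' : Store} {t t' : ℕ} (h : Runs p s s' t) (ht : t ≤ t') :
    Runs p s s' t' := by
  obtain ⟨n, hn, e⟩ := h
  exact ⟨n, hn.trans ht, e⟩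

theorem Runs.ite {e : Exp} {p q : Prog} {s s' : Store} {n : ℕ}
    (h₁ : e.eval s ≠ .nil → Runs p s s' n) (h₂ : e.eval s = .nil → Runs q s s' n) :
    Runs (.ite e p q) s s' (e.size + n + 1) := by
  by_cases he : e.eval s = .nil
  · obtain ⟨m, hm, h⟩ := h₂ he
    exact ⟨_, by omega, .ite_false he h⟩
  · obtain ⟨m, hm, h⟩ := h₁ he
    exact ⟨_, by omega, .ite_true he h⟩

/-- Empty the registers `1, …, R`. -/
def clear : ℕ → Prog
  | 0 => .assign 1 .nil
  | R + 1 => .seq (clear R) (.assign (R + 1) .nil)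

theorem runs_clear (s : Store) (R : ℕ) :
    Runs (clear (R + 1)) s (fun v => if 1 ≤ v ∧ v ≤ R + 1 then .nil else s v) (3 * R + 5) := by
  induction R with
  | zero =>
    have h := (Runs.assign s 1 .nil).seq (Runs.assign (Function.update s 1 .nil) 1 .nil)
    have : (fun v => if 1 ≤ v ∧ v ≤ 0 + 1 then .nil else s v) =
        Function.update (Function.update s 1 .nil) 1 .nil := by
      funext v
      by_cases hv : v = 1
      · subst hv; simp
      · have : ¬ (1 ≤ v ∧ v ≤ 1) := by omega
        simp [hv, this]
    rw [this]
    exact h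
  | succ R ih =>
    have h := ih.seq (Runs.assign _ (R + 2) .nil)
    have : (fun v => if 1 ≤ v ∧ v ≤ R + 1 + 1 then .nil else s v) =
        Function.update (fun v => if 1 ≤ v ∧ v ≤ R + 1 then .nil else s v) (R + 2) .nil := by
      funext v
      by_cases hv : v = R + 2
      · subst hv; simp
      · have : (1 ≤ v ∧ v ≤ R + 1 + 1) ↔ (1 ≤ v ∧ v ≤ R + 1) := by omega
        simp [Function.update_of_ne hv, this]
    rw [this]
    exact Runs.mono h (by simp [Exp.size]; omega)

/-- Run `p` as a subroutine, with input from register `x` and output into register `y`; the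
registers `1, …, R + 1` are scratch space that is left empty. -/
def call (p : Prog) (R x y : ℕ) : Prog :=
  .seq (.assign 0 (.var x)) (.seq (.seq p (clear (R + 1))) (.assign y (.var 0)))

/-- With clean scratch registers, the part of the store that `p` can see is exactly `initStore a`.
Cleaning up afterwards makes further calls possible, and the data of the caller lives above `R + 1`.
-/
theorem runs_call {p : Prog} {a b : Data} {t R x y : ℕ} (h : HaltsWithin p a b t)
    (hR : p.bound ≤ R + 2) (s : Store) (hx : s x = a)
    (hs : ∀ v, 1 ≤ v → v ≤ R + 1 → s v = .nil) :
    Runs (call p R x y) s (Function.update (Function.update s 0 b) y b) (t + (3 * R + 12)) := by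
  obtain ⟨s', n, e, hn, rfl⟩ := h
  have e' := e.splice s hR
  have hin : splice (R + 2) (initStore a) s = Function.update s 0 ((Exp.var x).eval s) := by
    funext v
    by_cases hv : v = 0
    · subst hv; simp [splice, initStore, hx, Exp.eval]
    · by_cases hv' : v < R + 2
      · simp [splice, initStore, hv, hv', hs v (by omega) (by omega)]
      · simp [splice, hv', hv]
  have hout : (fun v => if 1 ≤ v ∧ v ≤ R + 1 then .nil else splice (R + 2) s' s v) =
      Function.update s 0 (s' 0) := by
    funext v
    by_cases hv : v = 0
    · subst hv; simp [splice]
    · by_cases hv' : v < R + 2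
      · have : 1 ≤ v ∧ v ≤ R + 1 := by omega
        simp [this, hv, hs v this.1 this.2]
      · have : ¬ (1 ≤ v ∧ v ≤ R + 1) := by omega
        simp [splice, this, hv, hv']
  rw [hin] at e'
  have h₁ := Runs.seq ⟨n, hn, e'⟩ (runs_clear _ R)
  rw [hout] at h₁
  have h₂ := (Runs.assign s 0 (.var x)).seq (h₁.seq (Runs.assign _ y (.var 0)))
  simp only [Exp.eval, Exp.size, Function.update_self] at h₂
  exact h₂.mono (by omega)

/-! ### Polynomial-time functions on encoded data -/

/-- `f` is computed by a program, in polynomial time on the inputs `a` with `D N a`; the time is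
measured by `N`. -/
def PolyFun {α β : Type} (D : ℕ → α → Prop) (eA : α → Data) (eB : β → Data) (f : α → β) : Prop :=
  ∃ (p : Prog) (τ : Polynomial ℕ), ∀ N a, D N a → HaltsWithin p (eA a) (eB (f a)) (τ.eval N)

/-- Pairs. -/
def encPair {α β : Type} (eA : α → Data) (eB : β → Data) (x : α × β) : Data :=
  .cons (eA x.1) (eB x.2)

section combinators

variable {α β γ δ : Type} {D : ℕ → α → Prop} {eA : α → Data} {eB : β → Data} {eC : γ → Data}
  {eD : δ → Data}

theorem PolyFun.congr {f g : α → β} (hf : PolyFun D eA eB f) (h : ∀ N a, D N a → f a = g a) :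
    PolyFun D eA eB g := by
  obtain ⟨p, τ, hp⟩ := hf
  exact ⟨p, τ, fun N a ha => h N a ha ▸ hp N a ha⟩

theorem PolyFun.mono {D' : ℕ → α → Prop} {f : α → β} (hf : PolyFun D' eA eB f)
    (h : ∀ N a, D N a → D' N a) : PolyFun D eA eB f := by
  obtain ⟨p, τ, hp⟩ := hf
  exact ⟨p, τ, fun N a ha => hp N a (h N a ha)⟩

theorem PolyFun.recode {f : α → β} {g : α → γ} (hf : PolyFun D eA eB f)
    (h : ∀ N a, D N a → eB (f a) = eC (g a)) : PolyFun D eA eC g := by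
  obtain ⟨p, τ, hp⟩ := hf
  exact ⟨p, τ, fun N a ha => h N a ha ▸ hp N a ha⟩

theorem PolyFun.id : PolyFun D eA eA fun a => a :=
  ⟨.assign 0 (.var 0), 2, fun N a _ => ⟨_, _, .assign _ _ _, by simp [Exp.size], by
    simp [Exp.eval, initStore]⟩⟩

theorem PolyFun.post {f : α → β} {g : α → γ} (hf : PolyFun D eA eB f) (e : Exp)
    (he : ∀ N a, D N a → ∀ s : Store, s 0 = eB (f a) → e.eval s = eC (g a)) :
    PolyFun D eA eC g := by
  obtain ⟨p, τ, hp⟩ := hf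
  refine ⟨.seq p (.assign 0 e), τ + Polynomial.C (e.size + 2), fun N a ha => ?_⟩
  obtain ⟨s, n, e₁, hn, hs⟩ := hp N a ha
  refine ⟨_, _, .seq e₁ (.assign _ _ _), ?_, ?_⟩
  · simp only [Polynomial.eval_add, Polynomial.eval_C]; omega
  · simp [he N a ha s hs]

theorem initStore_pos {a : Data} {v : ℕ} (hv : 1 ≤ v) : initStore a v = .nil := by
  simp [initStore, show v ≠ 0 by omega]

/-- Time is measured by the external parameter `N` and not by the size of the input, so the two
polynomials simply add up and no bound on the size of `f a` is needed. -/
theorem PolyFun.comp {D' : ℕ → β → Prop} {f : α → β} {g : β → γ} (hg : PolyFun D' eB eC g)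
    (hf : PolyFun D eA eB f) (h : ∀ N a, D N a → D' N (f a)) :
    PolyFun D eA eC fun a => g (f a) := by
  obtain ⟨p, τ, hp⟩ := hf
  obtain ⟨q, σ, hq⟩ := hg
  set R := max p.bound q.bound
  refine ⟨.seq (call p R 0 0) (call q R 0 0), τ + σ + Polynomial.C (2 * (3 * R + 12) + 1),
    fun N a ha => ?_⟩
  obtain ⟨n, hn, e⟩ := (runs_call (y := 0) (hp N a ha)
    (le_trans (le_max_left _ _) (Nat.le_add_right R 2)) (initStore (eA a)) (x := 0)
    (by simp [initStore]) (fun v h1 _ => initStore_pos h1)).seq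
    (runs_call (y := 0) (x := 0) (hq N (f a) (h N a ha)) (R := R)
    (le_trans (le_max_right _ _) (Nat.le_add_right _ _)) _ (by simp)
    (fun v h1 _ => by simp [initStore_pos h1, show v ≠ 0 by omega]))
  refine ⟨_, n, e, ?_, by simp⟩
  simp only [Polynomial.eval_add, Polynomial.eval_C]; omega

theorem PolyFun.pair {f : α → β} {g : α → γ} (hf : PolyFun D eA eB f) (hg : PolyFun D eA eC g) :
    PolyFun D eA (encPair eB eC) fun a => (f a, g a) := by
  obtain ⟨p, τ, hp⟩ := hf
  obtain ⟨q, σ, hq⟩ := hg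
  set R := max p.bound q.bound
  refine ⟨.seq (.assign (R + 2) (.var 0)) (.seq (call p R (R + 2) (R + 3))
    (.seq (call q R (R + 2) (R + 4)) (.assign 0 (.cons (.var (R + 3)) (.var (R + 4)))))),
    τ + σ + Polynomial.C (2 * (3 * R + 12) + 20), fun N a ha => ?_⟩
  obtain ⟨n, hn, e⟩ := (Runs.assign (initStore (eA a)) (R + 2) (.var 0)).seq
    ((runs_call (hp N a ha) (R := R) (x := R + 2) (y := R + 3)
      (le_trans (le_max_left _ _) (Nat.le_add_right _ _)) _ (by simp [initStore, Exp.eval])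
      (fun v h1 h2 => by simp [initStore_pos h1, show v ≠ R + 2 by omega])).seq
    ((runs_call (hq N a ha) (R := R) (x := R + 2) (y := R + 4)
      (le_trans (le_max_right _ _) (Nat.le_add_right _ _)) _ (by simp [initStore, Exp.eval])
      (fun v h1 h2 => by simp [initStore_pos h1, show v ≠ 0 by omega, show v ≠ R + 2 by omega,
        show v ≠ R + 3 by omega])).seq
    (Runs.assign _ 0 (.cons (.var (R + 3)) (.var (R + 4))))))
  refine ⟨_, n, e, ?_, by simp [Exp.eval, encPair]⟩
  simp only [Polynomial.eval_add, Polynomial.eval_C]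
  simp only [Exp.size] at hn
  omega

theorem PolyFun.fst {f : α → β × γ} (hf : PolyFun D eA (encPair eB eC) f) :
    PolyFun D eA eB fun a => (f a).1 :=
  hf.post (.hd (.var 0)) fun N a _ s hs => by simp [Exp.eval, hs, encPair, Data.hd]

theorem PolyFun.snd {f : α → β × γ} (hf : PolyFun D eA (encPair eB eC) f) :
    PolyFun D eA eC fun a => (f a).2 :=
  hf.post (.tl (.var 0)) fun N a _ s hs => by simp [Exp.eval, hs, encPair, Data.tl]

/-- Each branch has to be computable only where the test selects it. This is what later allows
guards in front of calls to a learner that halts only on admissible inputs. -/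
theorem PolyFun.ite {c : α → Bool} {f g : α → β} (hc : PolyFun D eA encBool c)
    (hf : PolyFun (fun N a => D N a ∧ c a = true) eA eB f)
    (hg : PolyFun (fun N a => D N a ∧ c a = false) eA eB g) :
    PolyFun D eA eB fun a => if c a then f a else g a := by
  obtain ⟨r, ρ, hr⟩ := hc
  obtain ⟨p, τ, hp⟩ := hf
  obtain ⟨q, σ, hq⟩ := hg
  obtain ⟨R, hR⟩ : ∃ R, R = max r.bound (max p.bound q.bound) := ⟨_, rfl⟩
  refine ⟨.seq (.assign (R + 2) (.var 0)) (.seq (call r R (R + 2) (R + 3))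
    (.ite (.var (R + 3)) (call p R (R + 2) (R + 4)) (call q R (R + 2) (R + 4)))),
    ρ + τ + σ + Polynomial.C (2 * (3 * R + 12) + 20), fun N a ha => ?_⟩
  have h₁ := runs_call (hr N a ha) (R := R) (x := R + 2) (y := R + 3) (by omega)
    (Function.update (initStore (eA a)) (R + 2) ((Exp.var 0).eval (initStore (eA a))))
    (by simp [initStore, Exp.eval])
    (fun v h1 h2 => by simp [initStore_pos h1, show v ≠ R + 2 by omega])
  generalize hst : Function.update (Function.update (Function.update (initStore (eA a)) (R + 2)
    ((Exp.var 0).eval (initStore (eA a)))) 0 (encBool (c a))) (R + 3) (encBool (c a)) = st at h₁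
  have hst2 : st (R + 2) = eA a := by simp [← hst, initStore, Exp.eval]
  have hst3 : st (R + 3) = encBool (c a) := by simp [← hst]
  have hstc : ∀ v, 1 ≤ v → v ≤ R + 1 → st v = .nil := fun v h1 h2 => by
    simp [← hst, initStore_pos h1, show v ≠ 0 by omega, show v ≠ R + 2 by omega,
      show v ≠ R + 3 by omega]
  have h₂ : Runs (.ite (.var (R + 3)) (call p R (R + 2) (R + 4)) (call q R (R + 2) (R + 4))) st
      (Function.update (Function.update st 0 (eB (if c a then f a else g a))) (R + 4)
        (eB (if c a then f a else g a))) (1 + (τ.eval N + σ.eval N + (3 * R + 12)) + 1) := by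
    refine Runs.ite (e := .var (R + 3)) (n := τ.eval N + σ.eval N + (3 * R + 12)) (fun h => ?_)
      (fun h => ?_)
    · have hca : c a = true := by
        cases hca : c a with
        | true => rfl
        | false => simp [Exp.eval, hst3, hca, encBool] at h
      simp only [hca, if_true]
      exact (runs_call (hp N a ⟨ha, hca⟩) (by omega) st hst2 hstc).mono (by omega)
    · have hca : c a = false := by
        cases hca : c a with
        | true => simp [Exp.eval, hst3, hca, encBool] at h
        | false => rfl
      simp only [hca, if_false, Bool.false_eq_true]
      exact (runs_call (hq N a ⟨ha, hca⟩) (by omega) st hst2 hstc).mono (by omega)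
  obtain ⟨n, hn, e⟩ := (Runs.assign (initStore (eA a)) (R + 2) (.var 0)).seq (h₁.seq h₂)
  refine ⟨_, n, e, ?_, by simp⟩
  simp only [Exp.size] at hn
  simp only [Polynomial.eval_add, Polynomial.eval_C]
  omega

/-- The cost of a step depends on `N` alone, so the total cost is the length of the list times this
cost. The invariant `I` restricts the accumulators on which the step has to be computable. -/
theorem PolyFun.foldl {b₀ : α → β} {l : α → List γ} {step : α → β → γ → β}
    (hb : PolyFun D eA eB b₀) (hl : PolyFun D eA (encList eC) l) (I : ℕ → α → β → Prop)
    (hstep : PolyFun (fun N x => D N x.1 ∧ I N x.1 x.2.1 ∧ x.2.2 ∈ l x.1)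
      (encPair eA (encPair eB eC)) eB (fun x : α × β × γ => step x.1 x.2.1 x.2.2))
    (ℓ : Polynomial ℕ) (hlen : ∀ N a, D N a → (l a).length ≤ ℓ.eval N)
    (hI₀ : ∀ N a, D N a → I N a (b₀ a))
    (hI : ∀ N a b c, D N a → I N a b → c ∈ l a → I N a (step a b c)) :
    PolyFun D eA eB fun a => (l a).foldl (step a) (b₀ a) := by
  obtain ⟨p, τ, hp⟩ := hb
  obtain ⟨q, σ, hq⟩ := hl
  obtain ⟨r, ρ, hr⟩ := hstep
  obtain ⟨R, hR⟩ : ∃ R, R = max r.bound (max p.bound q.bound) := ⟨_, rfl⟩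
  set body : Prog := .seq (.assign (R + 5) (.cons (.var (R + 2))
    (.cons (.var (R + 4)) (.hd (.var (R + 3))))))
    (.seq (call r R (R + 5) (R + 4)) (.assign (R + 3) (.tl (.var (R + 3))))) with hbody
  -- Register `R + 2` holds the input, `R + 3` the rest of the list, `R + 4` the accumulator, and `R
  -- + 5` passes the argument to the step.
  have loop : ∀ N a, D N a → ∀ (m : List γ) (b : β) (s : Store), I N a b → (∀ c ∈ m, c ∈ l a) →
      (∀ v, 1 ≤ v → v ≤ R + 1 → s v = .nil) → s (R + 2) = eA a → s (R + 3) = encList eC m →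
      s (R + 4) = eB b → ∃ s', Runs (.while (.var (R + 3)) body) s s'
        (m.length * (ρ.eval N + (3 * R + 12) + 20) + 2) ∧
        s' (R + 4) = eB (m.foldl (step a) b) := by
    intro N a ha m
    induction m with
    | nil =>
      intro b s _ _ _ _ h3 h4
      exact ⟨s, ⟨_, by simp [Exp.size], .while_false (by simpa [Exp.eval, encList] using h3)⟩, h4⟩
    | cons c m ih =>
      intro b s hIb hm hs h2 h3 h4
      have h₁ := (Runs.assign s (R + 5) (.cons (.var (R + 2))
        (.cons (.var (R + 4)) (.hd (.var (R + 3)))))).seq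
        ((runs_call (hr N (a, b, c) ⟨ha, hIb, hm c (by simp)⟩) (R := R) (x := R + 5) (y := R + 4)
          (by omega) _ (by simp [Exp.eval, h2, h3, h4, encPair, encList, Data.hd])
          (fun v h1 h2 => by simp [hs v h1 h2, show v ≠ R + 5 by omega])).seq
        (Runs.assign _ (R + 3) (.tl (.var (R + 3)))))
      obtain ⟨st, ⟨n₁, hn₁, e₁⟩, hst, hst2, hst3, hst4⟩ : ∃ st, Runs body s st
          (ρ.eval N + (3 * R + 12) + 17) ∧ (∀ v, 1 ≤ v → v ≤ R + 1 → st v = .nil) ∧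
          st (R + 2) = eA a ∧ st (R + 3) = encList eC m ∧ st (R + 4) = eB (step a b c) :=
        ⟨_, h₁.mono (by simp only [Exp.size]; omega),
          fun v h1 h2 => by
            simp [hs v h1 h2, show v ≠ 0 by omega, show v ≠ R + 3 by omega,
              show v ≠ R + 4 by omega, show v ≠ R + 5 by omega],
          by simp [h2], by simp [Exp.eval, h3, encList, Data.tl], by simp⟩
      obtain ⟨s', ⟨n₂, hn₂, e₂⟩, h'⟩ := ih (step a b c) st (hI N a b c ha hIb (hm c (by simp)))
        (fun x hx => hm x (by simp [hx])) hst hst2 hst3 hst4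
      refine ⟨s', ⟨_, ?_, .while_true ?_ e₁ e₂⟩, h'⟩
      · simp only [List.length_cons, Nat.add_mul, Exp.size]
        omega
      · simp [Exp.eval, h3, encList]
  refine ⟨.seq (.assign (R + 2) (.var 0)) (.seq (call p R (R + 2) (R + 4))
    (.seq (call q R (R + 2) (R + 3)) (.seq (.while (.var (R + 3)) body)
    (.assign 0 (.var (R + 4)))))),
    τ + σ + ℓ * (ρ + Polynomial.C ((3 * R + 12) + 20)) + Polynomial.C (2 * (3 * R + 12) + 20),
    fun N a ha => ?_⟩
  have h₁ := Runs.assign (initStore (eA a)) (R + 2) (.var 0)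
  have h₂ := runs_call (hp N a ha) (R := R) (x := R + 2) (y := R + 4) (by omega)
    (Function.update (initStore (eA a)) (R + 2) ((Exp.var 0).eval (initStore (eA a))))
    (by simp [initStore, Exp.eval])
    (fun v h1 h2 => by simp [initStore_pos h1, show v ≠ R + 2 by omega])
  have h₃ := runs_call (hq N a ha) (R := R) (x := R + 2) (y := R + 3) (by omega)
    (Function.update (Function.update (Function.update (initStore (eA a)) (R + 2)
      ((Exp.var 0).eval (initStore (eA a)))) 0 (eB (b₀ a))) (R + 4) (eB (b₀ a)))
    (by simp [initStore, Exp.eval])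
    (fun v h1 h2 => by simp [initStore_pos h1, show v ≠ 0 by omega, show v ≠ R + 2 by omega,
      show v ≠ R + 4 by omega])
  obtain ⟨s', h₄, h'⟩ := loop N a ha (l a) (b₀ a)
    (Function.update (Function.update (Function.update (Function.update (Function.update
      (initStore (eA a)) (R + 2) ((Exp.var 0).eval (initStore (eA a)))) 0 (eB (b₀ a))) (R + 4)
      (eB (b₀ a))) 0 (encList eC (l a))) (R + 3) (encList eC (l a)))
    (hI₀ N a ha) (fun c hc => hc)
    (fun v h1 h2 => by simp [initStore_pos h1, show v ≠ 0 by omega, show v ≠ R + 2 by omega,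
      show v ≠ R + 3 by omega, show v ≠ R + 4 by omega])
    (by simp [initStore, Exp.eval]) (by simp) (by simp)
  obtain ⟨n, hn, e⟩ := h₁.seq (h₂.seq (h₃.seq (h₄.seq (Runs.assign s' 0 (.var (R + 4))))))
  refine ⟨_, n, e, ?_, by simp [Exp.eval, h']⟩
  have hle : (l a).length * (ρ.eval N + (3 * R + 12) + 20) ≤
      ℓ.eval N * (ρ.eval N + (3 * R + 12) + 20) := Nat.mul_le_mul_right _ (hlen N a ha)
  simp only [Exp.size] at hn
  simp only [Polynomial.eval_add, Polynomial.eval_mul, Polynomial.eval_C, ← Nat.add_assoc]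
  simp only [← Nat.add_assoc] at hn hle
  omega

end combinators

/-- The quantity `n` is bounded by a polynomial in `N` on the inputs with `D N a`. -/
def PolyBdd {α : Type} (D : ℕ → α → Prop) (n : α → ℕ) : Prop :=
  ∃ ℓ : Polynomial ℕ, ∀ N a, D N a → n a ≤ ℓ.eval N

/-- An expression without variables for a given tree. -/
def quote : Data → Exp
  | .nil => .nil
  | .cons a b => .cons (quote a) (quote b)

theorem eval_quote (s : Store) : ∀ a : Data, (quote a).eval s = a
  | .nil => rfl
  | .cons a b => by simp only [quote, Exp.eval, eval_quote s a, eval_quote s b]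

/-! ### Booleans and lists as polynomial-time data -/

section lists

variable {α β γ δ : Type} {D : ℕ → α → Prop} {eA : α → Data} {eB : β → Data} {eC : γ → Data}
  {eD : δ → Data}

theorem PolyBdd.mono {m n : α → ℕ} (hn : PolyBdd D n) (h : ∀ N a, D N a → m a ≤ n a) :
    PolyBdd D m := by
  obtain ⟨ℓ, hℓ⟩ := hn
  exact ⟨ℓ, fun N a ha => (h N a ha).trans (hℓ N a ha)⟩

theorem PolyBdd.imp {D' : ℕ → α → Prop} {n : α → ℕ} (hn : PolyBdd D' n)
    (h : ∀ N a, D N a → D' N a) : PolyBdd D n := by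
  obtain ⟨ℓ, hℓ⟩ := hn
  exact ⟨ℓ, fun N a ha => hℓ N a (h N a ha)⟩

theorem PolyBdd.comp {D' : ℕ → β → Prop} {n : β → ℕ} (hn : PolyBdd D' n) (f : α → β)
    (h : ∀ N a, D N a → D' N (f a)) : PolyBdd D fun a => n (f a) := by
  obtain ⟨ℓ, hℓ⟩ := hn
  exact ⟨ℓ, fun N a ha => hℓ N _ (h N a ha)⟩

theorem PolyBdd.const (c : ℕ) : PolyBdd D fun _ => c :=
  ⟨Polynomial.C c, fun N a _ => by simp⟩

theorem PolyBdd.add {m n : α → ℕ} (hm : PolyBdd D m) (hn : PolyBdd D n) :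
    PolyBdd D fun a => m a + n a := by
  obtain ⟨ℓ, hℓ⟩ := hm
  obtain ⟨ℓ', hℓ'⟩ := hn
  exact ⟨ℓ + ℓ', fun N a ha => by
    rw [Polynomial.eval_add]; exact Nat.add_le_add (hℓ N a ha) (hℓ' N a ha)⟩

theorem PolyBdd.mul {m n : α → ℕ} (hm : PolyBdd D m) (hn : PolyBdd D n) :
    PolyBdd D fun a => m a * n a := by
  obtain ⟨ℓ, hℓ⟩ := hm
  obtain ⟨ℓ', hℓ'⟩ := hn
  exact ⟨ℓ * ℓ', fun N a ha => by
    rw [Polynomial.eval_mul]; exact Nat.mul_le_mul (hℓ N a ha) (hℓ' N a ha)⟩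

theorem PolyBdd.pow {m : α → ℕ} (hm : PolyBdd D m) (j : ℕ) : PolyBdd D fun a => m a ^ j := by
  induction j with
  | zero => exact PolyBdd.const 1
  | succ j ih => simpa only [pow_succ] using ih.mul hm

theorem PolyBdd.eval {m : α → ℕ} (hm : PolyBdd D m) (p : Polynomial ℕ) :
    PolyBdd D fun a => p.eval (m a) := by
  induction p using Polynomial.induction_on' with
  | add p q hp hq => simpa only [Polynomial.eval_add] using hp.add hq
  | monomial j c => simpa only [Polynomial.eval_monomial] using (PolyBdd.const c).mul (hm.pow j)

theorem PolyFun.const (b : β) : PolyFun D eA eB fun _ => b :=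
  PolyFun.post (PolyFun.id (eA := eA)) (quote (eB b)) fun _ _ _ s _ => eval_quote s _

theorem PolyFun.cons {f : α → β} {l : α → List β} (hf : PolyFun D eA eB f)
    (hl : PolyFun D eA (encList eB) l) : PolyFun D eA (encList eB) fun a => f a :: l a :=
  (hf.pair hl).recode fun _ _ _ => rfl

theorem PolyFun.tail {l : α → List β} (hl : PolyFun D eA (encList eB) l) :
    PolyFun D eA (encList eB) fun a => (l a).tail :=
  hl.post (.tl (.var 0)) fun N a _ s hs => by
    cases h : l a <;> simp [Exp.eval, hs, h, encList, Data.tl]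

theorem PolyFun.headD {l : α → List β} {b : β} (hl : PolyFun D eA (encList eB) l)
    (h : ∀ N a, D N a → l a = [] → eB b = .nil) :
    PolyFun D eA eB fun a => (l a).headD b :=
  hl.post (.hd (.var 0)) fun N a ha s hs => by
    cases h' : l a with
    | nil => simp [Exp.eval, hs, h', encList, Data.hd, h N a ha h']
    | cons x m => simp [Exp.eval, hs, h', encList, Data.hd]

theorem PolyFun.test {f : α → β} {c : α → Bool} (hf : PolyFun D eA eB f)
    (h : ∀ N a, D N a → (eB (f a) = .nil ↔ c a = false)) : PolyFun D eA encBool c := by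
  obtain ⟨p, τ, hp⟩ := hf
  refine ⟨.seq p (.ite (.var 0) (.assign 0 (.cons .nil .nil)) (.assign 0 .nil)),
    τ + 8, fun N a ha => ?_⟩
  obtain ⟨s, n, e₁, hn, hs⟩ := hp N a ha
  have e8 : (8 : Polynomial ℕ).eval N = 8 := by
    rw [← Polynomial.C_ofNat, Polynomial.eval_C]
  cases hc : c a with
  | true =>
    have : s 0 ≠ .nil := fun h0 => by simp [(h N a ha).1 (hs ▸ h0)] at hc
    refine ⟨_, _, .seq e₁ (.ite_true (by simpa [Exp.eval] using this) (.assign _ _ _)), ?_, ?_⟩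
    · simp only [Polynomial.eval_add, Exp.size, e8]; omega
    · simp [Exp.eval, encBool]
  | false =>
    have : s 0 = .nil := by rw [hs]; exact (h N a ha).2 hc
    refine ⟨_, _, .seq e₁ (.ite_false (by simpa [Exp.eval] using this) (.assign _ _ _)), ?_, ?_⟩
    · simp only [Polynomial.eval_add, Exp.size, e8]; omega
    · simp [Exp.eval, encBool]

theorem PolyFun.or {c d : α → Bool} (hc : PolyFun D eA encBool c) (hd : PolyFun D eA encBool d) :
    PolyFun D eA encBool fun a => c a || d a :=
  (PolyFun.ite hc (PolyFun.const true) (hd.mono fun _ _ h => h.1)).congr fun N a _ => by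
    cases c a <;> simp

theorem PolyFun.not {c : α → Bool} (hc : PolyFun D eA encBool c) :
    PolyFun D eA encBool fun a => !c a :=
  (PolyFun.ite hc (PolyFun.const false) (PolyFun.const true)).congr fun N a _ => by
    cases c a <;> simp

theorem PolyFun.beq {c d : α → Bool} (hc : PolyFun D eA encBool c) (hd : PolyFun D eA encBool d) :
    PolyFun D eA encBool fun a => c a == d a :=
  (PolyFun.ite hc (hd.mono fun _ _ h => h.1) (hd.not.mono fun _ _ h => h.1)).congr
    fun N a _ => by cases c a <;> cases d a <;> simp

/-- The first component of a pair, as a polynomial-time function. -/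
theorem PolyFun.left {D : ℕ → α × β → Prop} : PolyFun D (encPair eA eB) eA fun x => x.1 :=
  PolyFun.id.fst

/-- The second component of a pair, as a polynomial-time function. -/
theorem PolyFun.right {D : ℕ → α × β → Prop} : PolyFun D (encPair eA eB) eB fun x => x.2 :=
  PolyFun.id.snd

/-- Weakening of the context. -/
theorem PolyFun.lift {D' : ℕ → α × γ → Prop} {f : α → β} (hf : PolyFun D eA eB f)
    (h : ∀ N x, D' N x → D N x.1) : PolyFun D' (encPair eA eC) eB fun x => f x.1 :=
  hf.comp PolyFun.left h

theorem PolyFun.foldl_simple {b₀ : α → β} {l : α → List γ} {step : α → β → γ → β}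
    (hb : PolyFun D eA eB b₀) (hl : PolyFun D eA (encList eC) l)
    (hlen : PolyBdd D fun a => (l a).length)
    (hstep : PolyFun (fun N x => D N x.1 ∧ x.2.2 ∈ l x.1)
      (encPair eA (encPair eB eC)) eB (fun x : α × β × γ => step x.1 x.2.1 x.2.2)) :
    PolyFun D eA eB fun a => (l a).foldl (step a) (b₀ a) := by
  obtain ⟨ℓ, hℓ⟩ := hlen
  exact PolyFun.foldl hb hl (fun _ _ _ => True) (hstep.mono fun _ _ h => ⟨h.1, h.2.2⟩) ℓ hℓ
    (fun _ _ _ => trivial) fun _ _ _ _ _ _ _ => trivial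

theorem PolyFun.reverse {l : α → List β} (hl : PolyFun D eA (encList eB) l)
    (hlen : PolyBdd D fun a => (l a).length) :
    PolyFun D eA (encList eB) fun a => (l a).reverse := by
  refine (PolyFun.foldl_simple (b₀ := fun _ => []) (step := fun _ m c => c :: m)
    (PolyFun.const []) hl hlen (PolyFun.cons (PolyFun.right.snd) (PolyFun.right.fst))).congr
    fun N a _ => ?_
  rw [← List.foldr_reverse, List.foldr_cons_eq_append, List.map_id', List.append_nil]

theorem PolyFun.append {l m : α → List β} (hl : PolyFun D eA (encList eB) l)
    (hm : PolyFun D eA (encList eB) m) (hlen : PolyBdd D fun a => (l a).length) :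
    PolyFun D eA (encList eB) fun a => l a ++ m a := by
  refine (PolyFun.foldl_simple (b₀ := m) (l := fun a => (l a).reverse)
    (step := fun _ m c => c :: m) hm (hl.reverse hlen) (by simpa using hlen)
    (PolyFun.cons (PolyFun.right.snd) (PolyFun.right.fst))).congr fun N a _ => ?_
  rw [← List.foldr_reverse, List.reverse_reverse, List.foldr_cons_eq_append, List.map_id']

theorem PolyFun.map {l : α → List γ} {f : α → γ → β} (hl : PolyFun D eA (encList eC) l)
    (hlen : PolyBdd D fun a => (l a).length)
    (hf : PolyFun (fun N x => D N x.1 ∧ x.2 ∈ l x.1) (encPair eA eC) eB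
      (fun x : α × γ => f x.1 x.2)) :
    PolyFun D eA (encList eB) fun a => (l a).map (f a) := by
  refine (PolyFun.foldl_simple (b₀ := fun _ => []) (l := fun a => (l a).reverse)
    (step := fun a m c => f a c :: m) (PolyFun.const []) (hl.reverse hlen) (by simpa using hlen)
    (PolyFun.cons (hf.comp (PolyFun.pair PolyFun.left PolyFun.right.snd)
      fun N x hx => ⟨hx.1, by simpa using hx.2⟩) (PolyFun.right.fst))).congr fun N a _ => ?_
  rw [← List.foldr_reverse, List.reverse_reverse, List.foldr_cons_eq_append, List.append_nil]

theorem PolyFun.any {l : α → List γ} {f : α → γ → Bool} (hl : PolyFun D eA (encList eC) l)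
    (hlen : PolyBdd D fun a => (l a).length)
    (hf : PolyFun (fun N x => D N x.1 ∧ x.2 ∈ l x.1) (encPair eA eC) encBool
      (fun x : α × γ => f x.1 x.2)) :
    PolyFun D eA encBool fun a => (l a).any (f a) := by
  refine (PolyFun.foldl_simple (b₀ := fun _ => false)
    (step := fun a b c => b || f a c) (PolyFun.const _) hl hlen
    (PolyFun.or PolyFun.right.fst (hf.comp (PolyFun.pair PolyFun.left PolyFun.right.snd)
      fun N x hx => hx))).congr fun N a _ => ?_
  have : ∀ (m : List γ) (b : Bool), m.foldl (fun b c => b || f a c) b = (b || m.any (f a)) := by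
    intro m
    induction m with
    | nil => simp
    | cons c m ih => intro b; simp [ih, Bool.or_assoc]
  simp [this]

theorem PolyFun.all {l : α → List γ} {f : α → γ → Bool} (hl : PolyFun D eA (encList eC) l)
    (hlen : PolyBdd D fun a => (l a).length)
    (hf : PolyFun (fun N x => D N x.1 ∧ x.2 ∈ l x.1) (encPair eA eC) encBool
      (fun x : α × γ => f x.1 x.2)) :
    PolyFun D eA encBool fun a => (l a).all (f a) :=
  (PolyFun.any hl hlen (f := fun a c => !f a c) hf.not).not.congr fun N a _ => by
    rw [List.all_eq_not_any_not]

/-- Fold over the first list; the state consists of the reversed output and the unread part of the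
second list. -/
theorem PolyFun.zip {l : α → List β} {m : α → List γ} (hl : PolyFun D eA (encList eB) l)
    (hm : PolyFun D eA (encList eC) m) (hlen : PolyBdd D fun a => (l a).length) :
    PolyFun D eA (encList (encPair eB eC)) fun a => (l a).zip (m a) := by
  have key : ∀ (x : List β) (acc : List (β × γ)) (y : List γ),
      x.foldl (fun (s : List (β × γ) × List γ) b => match s.2 with
        | [] => (s.1, [])
        | c :: y => ((b, c) :: s.1, y)) (acc, y) = ((x.zip y).reverse ++ acc, y.drop x.length) := by
    intro x
    induction x with
    | nil => simp
    | cons b x ih =>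
      intro acc y
      cases y with
      | nil => simp [ih]
      | cons c y => simp [ih]
  have h : PolyFun D eA (encPair (encList (encPair eB eC)) (encList eC)) fun a =>
      (l a).foldl (fun (s : List (β × γ) × List γ) b => match s.2 with
        | [] => (s.1, [])
        | c :: y => ((b, c) :: s.1, y)) ([], m a) := by
    refine PolyFun.foldl_simple (b₀ := fun a => ([], m a))
      (step := fun _ s b => match s.2 with
        | [] => (s.1, [])
        | c :: y => ((b, c) :: s.1, y)) (PolyFun.pair (PolyFun.const []) hm) hl hlen ?_
    refine (PolyFun.ite (c := fun x : α × (List (β × γ) × List γ) × β => !x.2.1.2.isEmpty)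
      (PolyFun.right.fst.snd.test fun N x _ => ?_)
      (f := fun x => match x.2.1.2 with
        | [] => (x.2.1.1, [])
        | c :: y => ((x.2.2, c) :: x.2.1.1, y))
      (g := fun x => (x.2.1.1, []))
      ((PolyFun.id (eA := encPair eA (encPair (encPair (encList (encPair eB eC)) (encList eC))
        eB))).post (.cons (.cons (.cons (.tl (.tl (.var 0))) (.hd (.tl (.hd (.tl (.var 0))))))
        (.hd (.hd (.tl (.var 0))))) (.tl (.tl (.hd (.tl (.var 0)))))) ?_)
      (PolyFun.pair PolyFun.right.fst.fst (PolyFun.const []))).congr ?_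
    · cases x.2.1.2 <;> simp [encList]
    · rintro N ⟨a, ⟨s₁, s₂⟩, b⟩ ⟨_, hx⟩ s hs
      cases s₂ with
      | nil => simp at hx
      | cons c y => simp [Exp.eval, hs, encPair, encList, Data.hd, Data.tl]
    · rintro N ⟨a, ⟨s₁, s₂⟩, b⟩ _
      cases s₂ <;> simp
  refine (h.fst.reverse ?_).congr fun N a _ => ?_
  · refine hlen.mono fun N a _ => ?_
    rw [key]; simp
  · rw [key]; simp

/-! ### Natural numbers in unary -/

theorem encNat_succ (n : ℕ) : encNat (n + 1) = .cons .nil (encNat n) := rfl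

theorem PolyFun.units {n : α → ℕ} (hn : PolyFun D eA encNat n) :
    PolyFun D eA (encList fun _ : Unit => Data.nil) fun a => List.replicate (n a) () :=
  hn.recode fun _ _ _ => rfl

theorem PolyFun.iterate {b₀ : α → β} {n : α → ℕ} {step : α → β → β}
    (hb : PolyFun D eA eB b₀) (hn : PolyFun D eA encNat n) (hlen : PolyBdd D n)
    (I : ℕ → α → β → Prop)
    (hstep : PolyFun (fun N x => D N x.1 ∧ I N x.1 x.2) (encPair eA eB) eB
      (fun x : α × β => step x.1 x.2))
    (hI₀ : ∀ N a, D N a → I N a (b₀ a))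
    (hI : ∀ N a b, D N a → I N a b → I N a (step a b)) :
    PolyFun D eA eB fun a => (step a)^[n a] (b₀ a) := by
  obtain ⟨ℓ, hℓ⟩ := hlen
  refine (PolyFun.foldl (step := fun a b _ => step a b) hb hn.units I
    (hstep.comp (PolyFun.pair PolyFun.left PolyFun.right.fst) fun N x hx => ⟨hx.1, hx.2.1⟩) ℓ
    (fun N a ha => by simpa using hℓ N a ha) hI₀ fun N a b _ ha hb _ => hI N a b ha hb).congr
    fun N a _ => ?_
  generalize n a = k
  generalize b₀ a = b
  induction k generalizing b with
  | zero => rfl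
  | succ k ih => rw [List.replicate_succ, List.foldl_cons, ih, Function.iterate_succ_apply]

theorem PolyFun.succ {n : α → ℕ} (hn : PolyFun D eA encNat n) :
    PolyFun D eA encNat fun a => n a + 1 :=
  hn.post (.cons .nil (.var 0)) fun N a _ s hs => by simp [Exp.eval, hs, encNat_succ]

theorem PolyFun.pred {n : α → ℕ} (hn : PolyFun D eA encNat n) :
    PolyFun D eA encNat fun a => n a - 1 :=
  hn.post (.tl (.var 0)) fun N a _ s hs => by
    cases h : n a with
    | zero => rw [h] at hs; simp only [Exp.eval, hs]; rfl
    | succ k => rw [h] at hs; simp [Exp.eval, hs, encNat_succ, Data.tl]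

theorem PolyFun.pos {n : α → ℕ} (hn : PolyFun D eA encNat n) :
    PolyFun D eA encBool fun a => decide (0 < n a) :=
  hn.test fun N a _ => by
    cases h : n a with
    | zero => simp [encNat, encList]
    | succ k => simp [encNat_succ]

theorem PolyFun.add {m n : α → ℕ} (hm : PolyFun D eA encNat m) (hn : PolyFun D eA encNat n)
    (hb : PolyBdd D n) : PolyFun D eA encNat fun a => m a + n a :=
  (PolyFun.iterate (step := fun _ b => b + 1) hm hn hb (fun _ _ _ => True) PolyFun.right.succ
    (fun _ _ _ => trivial) fun _ _ _ _ _ => trivial).congr fun N a _ => by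
      simp

theorem PolyFun.sub {m n : α → ℕ} (hm : PolyFun D eA encNat m) (hn : PolyFun D eA encNat n)
    (hb : PolyBdd D n) : PolyFun D eA encNat fun a => m a - n a :=
  (PolyFun.iterate (step := fun _ b => b - 1) hm hn hb (fun _ _ _ => True) PolyFun.right.pred
    (fun _ _ _ => trivial) fun _ _ _ _ _ => trivial).congr fun N a _ => by
      generalize n a = k
      induction k with
      | zero => rfl
      | succ k ih => rw [Function.iterate_succ_apply', ih]; omega

theorem PolyFun.mul {m n : α → ℕ} (hm : PolyFun D eA encNat m) (hn : PolyFun D eA encNat n)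
    (hbm : PolyBdd D m) (hbn : PolyBdd D n) : PolyFun D eA encNat fun a => m a * n a :=
  (PolyFun.iterate (b₀ := fun _ => 0) (step := fun a b => b + m a) (PolyFun.const 0) hn hbn
    (fun _ _ _ => True) (PolyFun.add PolyFun.right (hm.lift fun _ _ h => h.1)
      (hbm.comp _ fun _ _ h => h.1))
    (fun _ _ _ => trivial) fun _ _ _ _ _ => trivial).congr fun N a _ => by
      generalize n a = k
      induction k with
      | zero => rfl
      | succ k ih => rw [Function.iterate_succ_apply', ih]; ring

theorem PolyFun.pow {m : α → ℕ} (hm : PolyFun D eA encNat m) (hbm : PolyBdd D m) (j : ℕ) :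
    PolyFun D eA encNat fun a => m a ^ j := by
  induction j with
  | zero => exact PolyFun.const 1
  | succ j ih => simpa only [pow_succ] using ih.mul hm (hbm.pow j) hbm

theorem PolyFun.eval {m : α → ℕ} (hm : PolyFun D eA encNat m) (hbm : PolyBdd D m)
    (p : Polynomial ℕ) : PolyFun D eA encNat fun a => p.eval (m a) := by
  induction p using Polynomial.induction_on' with
  | add p q hp hq => simpa only [Polynomial.eval_add] using hp.add hq (hbm.eval q)
  | monomial j c =>
    simpa only [Polynomial.eval_monomial] using
      PolyFun.mul (PolyFun.const c) (hm.pow hbm j) (PolyBdd.const c) (hbm.pow j)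

theorem PolyFun.range {n : α → ℕ} (hn : PolyFun D eA encNat n) (hb : PolyBdd D n) :
    PolyFun D eA (encList encNat) fun a => List.range (n a) := by
  have key : ∀ k, (fun s : List ℕ × ℕ => (s.2 :: s.1, s.2 + 1))^[k] ([], 0) =
      ((List.range k).reverse, k) := by
    intro k
    induction k with
    | zero => rfl
    | succ k ih => rw [Function.iterate_succ_apply', ih, List.range_succ]; simp
  have h := PolyFun.iterate (b₀ := fun _ => (([] : List ℕ), 0))
    (step := fun _ s => (s.2 :: s.1, s.2 + 1)) (PolyFun.const _) hn hb
    (fun _ _ _ => True) (PolyFun.pair (PolyFun.cons PolyFun.right.snd PolyFun.right.fst)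
      PolyFun.right.snd.succ) (fun _ _ _ => trivial) fun _ _ _ _ _ => trivial
  refine (h.fst.reverse (hb.mono fun N a _ => ?_)).congr fun N a _ => ?_
  · rw [key]; simp
  · rw [key]; simp

theorem PolyFun.replicate {n : α → ℕ} {b : α → β} (hn : PolyFun D eA encNat n) (hb : PolyBdd D n)
    (hf : PolyFun D eA eB b) : PolyFun D eA (encList eB) fun a => List.replicate (n a) (b a) :=
  (PolyFun.map (f := fun a _ => b a) hn.units (by simpa using hb)
    (hf.lift fun _ _ h => h.1)).congr fun N a _ => by simp

theorem PolyFun.drop {n : α → ℕ} {l : α → List β} (hn : PolyFun D eA encNat n) (hb : PolyBdd D n)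
    (hl : PolyFun D eA (encList eB) l) : PolyFun D eA (encList eB) fun a => (l a).drop (n a) :=
  (PolyFun.iterate (step := fun _ m => m.tail) hl hn hb
    (fun _ _ _ => True) PolyFun.right.tail
    (fun _ _ _ => trivial) fun _ _ _ _ _ => trivial).congr fun N a _ => by
      generalize n a = k
      induction k with
      | zero => rfl
      | succ k ih => rw [Function.iterate_succ_apply', ih, List.tail_drop]

theorem PolyFun.take {n : α → ℕ} {l : α → List β} (hn : PolyFun D eA encNat n) (hb : PolyBdd D n)
    (hl : PolyFun D eA (encList eB) l) : PolyFun D eA (encList eB) fun a => (l a).take (n a) := by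
  refine (((PolyFun.zip hn.units hl (by simpa using hb)).map (f := fun _ x => x.2)
    (hb.mono fun N a _ => by simp) PolyFun.right.snd)).congr fun N a _ => ?_
  generalize n a = k
  generalize l a = m
  induction m generalizing k with
  | nil => simp
  | cons x m ih =>
    cases k with
    | zero => simp
    | succ k =>
      have := ih k
      simp only [List.replicate_succ, List.zip_cons_cons, List.map_cons, List.take_succ_cons,
        List.cons.injEq, true_and]
      exact this

/-- The first `n` consecutive blocks of length `c`. -/
def chunks {β : Type} (c : ℕ) : ℕ → List β → List (List β)
  | 0, _ => []
  | n + 1, l => l.take c :: chunks c n (l.drop c)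

theorem length_chunks {β : Type} (c : ℕ) : ∀ (n : ℕ) (l : List β), (chunks c n l).length = n
  | 0, _ => rfl
  | n + 1, l => by rw [chunks, List.length_cons, length_chunks]

theorem PolyFun.chunks {c n : α → ℕ} {l : α → List β} (hc : PolyFun D eA encNat c)
    (hcb : PolyBdd D c) (hn : PolyFun D eA encNat n) (hb : PolyBdd D n)
    (hl : PolyFun D eA (encList eB) l) :
    PolyFun D eA (encList (encList eB)) fun a => chunks (c a) (n a) (l a) := by
  have key : ∀ (c k : ℕ) (acc : List (List β)) (m : List β),
      (fun s : List (List β) × List β => (s.2.take c :: s.1, s.2.drop c))^[k] (acc, m) =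
      ((CoTGap.chunks c k m).reverse ++ acc, m.drop (k * c)) := by
    intro c k
    induction k with
    | zero => intro acc m; simp [CoTGap.chunks]
    | succ k ih =>
      intro acc m
      rw [Function.iterate_succ_apply, ih]
      simp [CoTGap.chunks, Nat.succ_mul, Nat.add_comm]
  have h := PolyFun.iterate (b₀ := fun a => (([] : List (List β)), l a))
    (step := fun a s => (s.2.take (c a) :: s.1, s.2.drop (c a)))
    (PolyFun.pair (PolyFun.const []) hl) hn hb (fun _ _ _ => True)
    (PolyFun.pair (PolyFun.cons (PolyFun.take (hc.lift fun _ _ h => h.1)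
      (hcb.comp _ fun _ _ h => h.1) PolyFun.right.snd) PolyFun.right.fst)
      (PolyFun.drop (hc.lift fun _ _ h => h.1) (hcb.comp _ fun _ _ h => h.1) PolyFun.right.snd))
    (fun _ _ _ => trivial) fun _ _ _ _ _ => trivial
  refine (h.fst.reverse (hb.mono fun N a _ => ?_)).congr fun N a _ => ?_
  · rw [key]; simp [length_chunks]
  · rw [key]; simp

/-- Every function of a bit string of constant length is given by a table. -/
theorem PolyFun.table (K : ℕ) (F : List Bool → β) {l : α → List Bool}
    (hl : PolyFun D eA (encList encBool) l) (hK : ∀ N a, D N a → (l a).length = K) :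
    PolyFun D eA eB fun a => F (l a) := by
  induction K generalizing F l D with
  | zero =>
    refine (PolyFun.const (F [])).congr fun N a ha => ?_
    rw [List.length_eq_zero_iff.1 (hK N a ha)]
  | succ K ih =>
    refine (PolyFun.ite (hl.headD (b := false) fun _ _ _ _ => rfl)
      (ih (fun m => F (true :: m)) (hl.tail.mono fun _ _ h => h.1)
        fun N a ha => by simp [hK N a ha.1])
      (ih (fun m => F (false :: m)) (hl.tail.mono fun _ _ h => h.1)
        fun N a ha => by simp [hK N a ha.1])).congr fun N a ha => ?_
    cases h : l a with
    | nil => have := hK N a ha; simp [h] at this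
    | cons b m => cases b <;> simp

end lists

/-! ### Autoregression, read from the end of the string -/

/-- The bit produced at time `t`. -/
def emit (f : Thinker) (x : List Bool) (t : ℕ) : Bool := f ((extend f)^[t] x)

theorem e2e_succ (f : Thinker) (t : ℕ) (x : List Bool) : e2e f (t + 1) x = emit f x t := by
  simp [e2e, emit, Function.iterate_succ_apply', extend]

theorem reverse_iterate_extend (f : Thinker) (x : List Bool) (t q : ℕ) :
    ((extend f)^[t] x).reverse.getD q false =
      if q < t then emit f x (t - 1 - q) else x.reverse.getD (q - t) false := by
  induction t generalizing q with
  | zero => simp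
  | succ t ih =>
    rw [Function.iterate_succ_apply', extend, List.reverse_append]
    cases q with
    | zero => simp [emit]
    | succ q =>
      have := ih q
      simp only [List.reverse_cons, List.reverse_nil, List.nil_append, List.cons_append,
        List.getD_cons_succ, Nat.add_lt_add_iff_right]
      rw [this, show t + 1 - 1 - (q + 1) = t - 1 - q by omega,
        show q + 1 - (t + 1) = q - t by omega]

/-- The bit that is seen at time `t` at position `q` from the end. -/
def tape (ζ β : ℕ → Bool) (t q : ℕ) : Bool := if q < t then β (t - 1 - q) else ζ (q - t)

/-- The bits `β` are produced from the prompt `ζ` by the weights `w` with window size `d`; the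
positions of prompts and weights are counted from the end. -/
def Autoregressive (d : ℕ) (w : ℕ → ℤ) (ζ β : ℕ → Bool) : Prop :=
  ∀ t, β t = decide (0 ≤ ∑ q ∈ Finset.range d,
    if tape ζ β t q = true then w q else 0)

/-- Weights in the format of `linThinker`. -/
def weightVector (d : ℕ) (w : ℕ → ℤ) (i : Fin d) : ℝ := w i.rev

/-- Translates the thinker into a statement about integer sums and bit sequences indexed from the
end, so that the analysis of the weights needs neither lists nor reals. -/
theorem autoregressive_linThinker (d : ℕ) (w : ℕ → ℤ) (x : List Bool) :
    Autoregressive d w (fun p => x.reverse.getD p false)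
      (emit (linThinker (weightVector d w)) x) := by
  intro t
  conv_lhs => rw [emit, linThinker]
  rw [decide_eq_decide, ← Int.cast_nonneg_iff (R := ℝ), Int.cast_sum, Finset.sum_range]
  apply Eq.to_iff
  congr 1
  refine Finset.sum_congr rfl fun i _ => ?_
  rw [reverse_iterate_extend]
  simp [weightVector, tape]

/-! ### Dominated sums -/

/-- The index `q₀` is counted once with `f` and once more in the sum of the bounds `u`; this only
weakens the hypothesis since `0 ≤ u q₀`. -/
theorem sum_neg_of_dominated {d q₀ : ℕ} {f u : ℕ → ℤ} (hq : q₀ < d) (hu : ∀ q < d, f q ≤ u q)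
    (hu₀ : 0 ≤ u q₀) (h : f q₀ + ∑ q ∈ Finset.range d, u q < 0) :
    ∑ q ∈ Finset.range d, f q < 0 := by
  have hm : q₀ ∈ Finset.range d := Finset.mem_range.2 hq
  rw [← Finset.add_sum_erase _ _ hm] at h ⊢
  have : ∑ q ∈ (Finset.range d).erase q₀, f q ≤ ∑ q ∈ (Finset.range d).erase q₀, u q :=
    Finset.sum_le_sum fun q hq => hu q (Finset.mem_range.1 (Finset.mem_of_mem_erase hq))
  omega

theorem sum_nonneg_of_dominating {d q₀ : ℕ} {f : ℕ → ℤ} {H : ℤ} (hq : q₀ < d) (hH : 0 ≤ H)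
    (hu : ∀ q < d, -H ≤ f q) (h : d * H ≤ f q₀) : 0 ≤ ∑ q ∈ Finset.range d, f q := by
  have hm : q₀ ∈ Finset.range d := Finset.mem_range.2 hq
  rw [← Finset.add_sum_erase _ _ hm]
  have : ∑ q ∈ (Finset.range d).erase q₀, (-H) ≤ ∑ q ∈ (Finset.range d).erase q₀, f q :=
    Finset.sum_le_sum fun q hq => hu q (Finset.mem_range.1 (Finset.mem_of_mem_erase hq))
  rw [Finset.sum_const, Finset.card_erase_of_mem hm, Finset.card_range, nsmul_eq_mul] at this
  have h2 : ((d - 1 : ℕ) : ℤ) * H ≤ d * H :=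
    mul_le_mul_of_nonneg_right (by omega) hH
  have h3 : ((d - 1 : ℕ) : ℤ) * -H = -(((d - 1 : ℕ) : ℤ) * H) := by ring
  omega

/-! ### A family of thinkers with the same end-to-end map

The phases of the computation are: `2n` silent steps, `n` steps for the terms of a disjunctive
normal form in an order that is rotated by `v`, `n` silent steps, and the output. -/

set_option linter.unusedSectionVars false

section family

variable (n : ℕ) [NeZero n] (B L d : ℕ) (mis : Fin n → ℕ → Bool) (rej : Fin n → Bool)

/-- The sum of the moderate positive weights. -/
def posTotal : ℤ := n * (L * (L + 1)) + L

/-- The term that the thinker `v` evaluates in step `2n + k`. -/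
def termAt (v : Fin n) (k : ℕ) : Fin n := Fin.ofNat n k - v

/-- The weight of the thinker `v` at position `q` from the end. -/
def weight (v : Fin n) (q : ℕ) : ℤ :=
  if q < n then 0
  else if q < 2 * n then (if rej (termAt n v (2 * n - 1 - q)) then -1 else 0)
  else if q < 3 * n then L * (L + 1)
  else if q < 4 * n - 1 then 0
  else if q < 4 * n then -(d * (d * (posTotal n L + 1)) + posTotal n L + 1)
  else if q = 4 * n then L
  else if q < 9 * n then -(posTotal n L + 1)
  else if q < 9 * n + 5 * n * B then
    (if (q - 9 * n) % (5 * n) = 4 * n then -1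
    else if 2 * n ≤ (q - 9 * n) % (5 * n) ∧ (q - 9 * n) % (5 * n) < 3 * n ∧
      mis (termAt n v ((q - 9 * n) % (5 * n) - 2 * n)) ((q - 9 * n) / (5 * n)) = true then -(L + 2)
    else -(L + 1))
  else if q < d - 8 * n then -(L + 1)
  else if q < d - 4 * n then -(posTotal n L + 1)
  else d * (posTotal n L + 1)

variable {n B L d mis rej}

theorem posTotal_nonneg : 0 ≤ posTotal n L := by
  unfold posTotal; positivity

theorem posTotal_ge (hL : 1 ≤ L) : (L : ℤ) + 1 ≤ posTotal n L := by
  have h1 : (1 : ℤ) ≤ n := by exact_mod_cast Nat.one_le_iff_ne_zero.2 (NeZero.ne n)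
  have h2 : (1 : ℤ) ≤ L := by exact_mod_cast hL
  unfold posTotal
  nlinarith [mul_nonneg (sub_nonneg.2 h1) (show (0 : ℤ) ≤ L * (L + 1) by positivity)]

/-- While the terms are being evaluated, the answers of the earlier terms lie at positions below
`n`. Weight zero keeps them from interfering. The `n` silent steps that follow push all answers to
positions in `[n, 2n)`, where they are counted. -/
theorem weight_zero {v : Fin n} {q : ℕ} (h : q < n) : weight n B L d mis rej v q = 0 := by
  simp [weight, h]

/-- At the output time `4n`, position `2n - 1 - k` shows the bit of time `2n + k`, that is, the
answer of the `k`-th term. -/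
theorem weight_term {v : Fin n} {k : ℕ} (h : k < n) :
    weight n B L d mis rej v (2 * n - 1 - k) = if rej (termAt n v k) then -1 else 0 := by
  unfold weight
  rw [if_neg (by omega), if_pos (by omega), show 2 * n - 1 - (2 * n - 1 - k) = k by omega]

/-- The marker at prompt position `0` is seen here exactly during the term phase. Its weight pays
for `L` lit slots at the price `L + 1` each, so a single mismatch tips the balance. -/
theorem weight_marker {v : Fin n} {q : ℕ} (h : 2 * n ≤ q) (h' : q < 3 * n) :
    weight n B L d mis rej v q = L * (L + 1) := by
  unfold weight
  rw [if_neg (by omega), if_neg (by omega), if_pos (by omega)]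

theorem weight_gap {v : Fin n} {q : ℕ} (h : 3 * n ≤ q) (h' : q < 4 * n - 1) :
    weight n B L d mis rej v q = 0 := by
  unfold weight
  rw [if_neg (by omega), if_neg (by omega), if_neg (by omega), if_pos (by omega)]

/-- Larger in absolute value than `d` weights of the top zone plus all moderate positive weights.
The position shows the first emitted bit at the output time, so emitting a one at time `0` forces
the output to be false. -/
theorem weight_kill {v : Fin n} :
    weight n B L d mis rej v (4 * n - 1) = -(d * (d * (posTotal n L + 1)) + posTotal n L + 1) := by
  have := NeZero.pos n
  unfold weight
  rw [if_neg (by omega), if_neg (by omega), if_neg (by omega), if_neg (by omega),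
    if_pos (by omega)]

/-- The marker reaches this position at the output time and there pays for `L` lit slots at the
price `1` each. -/
theorem weight_final {v : Fin n} : weight n B L d mis rej v (4 * n) = L := by
  have := NeZero.pos n
  unfold weight
  rw [if_neg (by omega), if_neg (by omega), if_neg (by omega), if_neg (by omega),
    if_neg (by omega), if_pos (by omega)]

theorem weight_low {v : Fin n} {q : ℕ} (h : 4 * n < q) (h' : q < 9 * n) :
    weight n B L d mis rej v q = -(posTotal n L + 1) := by
  have := NeZero.pos n
  unfold weight
  rw [if_neg (by omega), if_neg (by omega), if_neg (by omega), if_neg (by omega),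
    if_neg (by omega), if_neg (by omega), if_pos (by omega)]

/-- The bit of slot `m` is at offset `t` of its block at time `t`. Blocks have length `5n` and the
last relevant time is `4n`, so no slot enters the block of another one, and weights can depend on
both the slot and the time. -/
theorem weight_slot {v : Fin n} {m t : ℕ} (hm : m < B) (ht : t < 5 * n) :
    weight n B L d mis rej v (9 * n + 5 * n * m + t) =
      if t = 4 * n then (-1 : ℤ)
      else if 2 * n ≤ t ∧ t < 3 * n ∧ mis (termAt n v (t - 2 * n)) m = true then -(L + 2)
      else -(L + 1) := by
  have := NeZero.pos n
  have h1 : 5 * n * m + 5 * n ≤ 5 * n * B := by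
    rw [← Nat.mul_succ]; exact Nat.mul_le_mul_left _ hm
  have h2 : 9 * n + 5 * n * m + t - 9 * n = t + 5 * n * m := by omega
  have h3 : (t + 5 * n * m) % (5 * n) = t := by
    rw [Nat.add_mul_mod_self_left, Nat.mod_eq_of_lt ht]
  have h4 : (t + 5 * n * m) / (5 * n) = m := by
    rw [Nat.add_mul_div_left _ _ (by omega), Nat.div_eq_of_lt ht, zero_add]
  unfold weight
  rw [if_neg (by omega), if_neg (by omega), if_neg (by omega), if_neg (by omega),
    if_neg (by omega), if_neg (by omega), if_neg (by omega), if_pos (by omega), h2, h3, h4]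

theorem weight_high {v : Fin n} {q : ℕ} (hd : 21 * n + 5 * n * B ≤ d)
    (h : d - 8 * n ≤ q) (h' : q < d - 4 * n) :
    weight n B L d mis rej v q = -(posTotal n L + 1) := by
  have := NeZero.pos n
  unfold weight
  rw [if_neg (by omega), if_neg (by omega), if_neg (by omega), if_neg (by omega),
    if_neg (by omega), if_neg (by omega), if_neg (by omega), if_neg (by omega),
    if_neg (by omega), if_pos (by omega)]

/-- One bit in this zone outweighs up to `d` weights of size `posTotal n L + 1`, hence all negative
weights except the one at `4n - 1`. -/
theorem weight_top {v : Fin n} {q : ℕ} (hd : 21 * n + 5 * n * B ≤ d) (h : d - 4 * n ≤ q) :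
    weight n B L d mis rej v q = d * (posTotal n L + 1) := by
  have := NeZero.pos n
  unfold weight
  rw [if_neg (by omega), if_neg (by omega), if_neg (by omega), if_neg (by omega),
    if_neg (by omega), if_neg (by omega), if_neg (by omega), if_neg (by omega),
    if_neg (by omega), if_neg (by omega)]

theorem weight_rest {v : Fin n} {q : ℕ} (h : 9 * n + 5 * n * B ≤ q) (h' : q < d - 8 * n) :
    weight n B L d mis rej v q = -(L + 1) := by
  have := NeZero.pos n
  unfold weight
  rw [if_neg (by omega), if_neg (by omega), if_neg (by omega), if_neg (by omega),
    if_neg (by omega), if_neg (by omega), if_neg (by omega), if_neg (by omega),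
    if_pos (by omega)]

variable (n B d) in
theorem position_cases (q : ℕ) : q < n ∨ (∃ k < n, q = 2 * n - 1 - k) ∨
    (2 * n ≤ q ∧ q < 3 * n) ∨ (3 * n ≤ q ∧ q < 4 * n - 1) ∨ q = 4 * n - 1 ∨ q = 4 * n ∨
    (4 * n < q ∧ q < 9 * n) ∨ (∃ m < B, ∃ t < 5 * n, q = 9 * n + 5 * n * m + t) ∨
    (9 * n + 5 * n * B ≤ q ∧ q < d - 8 * n) ∨ (d - 8 * n ≤ q ∧ q < d - 4 * n) ∨
    d - 4 * n ≤ q := by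
  have h0 := NeZero.pos n
  by_cases h1 : q < n
  · exact .inl h1
  refine .inr ?_
  by_cases h2 : q < 2 * n
  · exact .inl ⟨2 * n - 1 - q, by omega, by omega⟩
  refine .inr ?_
  by_cases h3 : q < 9 * n
  · omega
  by_cases h4 : q < 9 * n + 5 * n * B
  · have h5 : (q - 9 * n) / (5 * n) < B :=
      (Nat.div_lt_iff_lt_mul (by omega)).2 (by rw [Nat.mul_comm B]; omega)
    have h6 := Nat.mod_lt (q - 9 * n) (show 0 < 5 * n by omega)
    have h7 := Nat.div_add_mod (q - 9 * n) (5 * n)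
    refine .inr (.inr (.inr (.inr (.inr (.inl ⟨_, h5, _, h6, by omega⟩)))))
  · omega

theorem weight_slot_le {v : Fin n} {m t : ℕ} (hm : m < B) (ht : t < 5 * n) :
    weight n B L d mis rej v (9 * n + 5 * n * m + t) ≤ -1 := by
  rw [weight_slot hm ht]
  split_ifs <;> omega

theorem weight_slot_ge {v : Fin n} {m t : ℕ} (hm : m < B) (ht : t < 5 * n) :
    -(L + 2 : ℤ) ≤ weight n B L d mis rej v (9 * n + 5 * n * m + t) := by
  rw [weight_slot hm ht]
  split_ifs <;> omega

theorem weight_middle_lt {v : Fin n} {q : ℕ} (hd : 21 * n + 5 * n * B ≤ d) 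
    (h : 4 * n < q) (h' : q < d - 4 * n) : weight n B L d mis rej v q ≤ -1 := by
  have h3 := posTotal_nonneg (n := n) (L := L)
  rcases position_cases n B d q with h | ⟨k, hk, rfl⟩ | h | h | h | h | h | ⟨m, hm, t, ht, rfl⟩ |
    h | h | h
  any_goals omega
  · rw [weight_low h.1 h.2]; omega
  · exact weight_slot_le hm ht
  · rw [weight_rest h.1 h.2]; omega
  · rw [weight_high hd h.1 h.2]; omega

theorem weight_middle_garbage {v : Fin n} {p : ℕ} 
    (h : 5 * n ≤ p) (h' : p < d - 12 * n) (hp : ∀ m < B, p ≠ 9 * n + 5 * n * m) :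
    weight n B L d mis rej v (p + 4 * n) ≤ -(L + 1) := by
  have := NeZero.pos n
  rcases position_cases n B d (p + 4 * n) with h | ⟨k, hk, h⟩ | h | h | h | h | h |
    ⟨m, hm, t, ht, h⟩ | h | h | h
  any_goals omega
  · rw [h, weight_slot hm ht, if_neg (by have := hp m hm; omega)]
    split_ifs <;> omega
  · rw [weight_rest h.1 h.2]

theorem neg_le_weight {v : Fin n} {q : ℕ} (hd : 21 * n + 5 * n * B ≤ d) (hL : 1 ≤ L)
    (h : q ≠ 4 * n - 1) : -(posTotal n L + 1) ≤ weight n B L d mis rej v q := by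
  have h3 := posTotal_ge (n := n) hL
  have h5 : (0 : ℤ) ≤ d * (posTotal n L + 1) := mul_nonneg (by positivity) (by linarith)
  have h6 : (0 : ℤ) ≤ (L : ℤ) * (L + 1) := by positivity
  rcases position_cases n B d q with h | ⟨k, hk, rfl⟩ | h | h | h | rfl | h |
    ⟨m, hm, t, ht, rfl⟩ | h | h | h
  · rw [weight_zero h]; omega
  · rw [weight_term hk]; split_ifs <;> omega
  · rw [weight_marker h.1 h.2]; omega
  · rw [weight_gap h.1 h.2]; omega
  · omega
  · rw [weight_final]; omega
  · rw [weight_low h.1 h.2]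
  · have := weight_slot_ge (L := L) (d := d) (mis := mis) (rej := rej) (v := v) hm ht; omega
  · rw [weight_rest h.1 h.2]; omega
  · rw [weight_high hd h.1 h.2]
  · rw [weight_top hd h]; omega

/-- An upper bound for the moderate positive weights. -/
def posWeight (n L q : ℕ) : ℤ :=
  (if 2 * n ≤ q ∧ q < 3 * n then (L : ℤ) * (L + 1) else 0) + if q = 4 * n then (L : ℤ) else 0

theorem posWeight_nonneg (q : ℕ) : 0 ≤ posWeight n L q := by
  unfold posWeight
  split_ifs <;> positivity

theorem sum_posWeight_le : ∑ q ∈ Finset.range d, posWeight n L q ≤ posTotal n L := by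
  unfold posWeight posTotal
  rw [Finset.sum_add_distrib]
  refine add_le_add ?_ ?_
  · rw [← Finset.sum_filter, Finset.sum_const, nsmul_eq_mul]
    refine mul_le_mul_of_nonneg_right ?_ (by positivity)
    have : ((Finset.range d).filter fun q => 2 * n ≤ q ∧ q < 3 * n) ⊆ Finset.Ico (2 * n) (3 * n) :=
      fun q hq => Finset.mem_Ico.2 (Finset.mem_filter.1 hq).2
    have := Finset.card_le_card this
    rw [Nat.card_Ico] at this
    have h : 3 * n - 2 * n = n := by omega
    rw [h] at this
    exact_mod_cast this
  · rw [Finset.sum_ite_eq' (Finset.range d)]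
    split_ifs
    · exact le_rfl
    · positivity

theorem le_posWeight_marker {q : ℕ} (h : 2 * n ≤ q) (h' : q < 3 * n) :
    (L : ℤ) * (L + 1) ≤ posWeight n L q := by
  unfold posWeight
  rw [if_pos ⟨h, h'⟩, if_neg (by omega), add_zero]

theorem le_posWeight_final : (L : ℤ) ≤ posWeight n L (4 * n) := by
  have := NeZero.pos n
  unfold posWeight
  rw [if_neg (by omega), if_pos rfl, zero_add]

theorem weight_le_posWeight {v : Fin n} {q : ℕ} (hd : 21 * n + 5 * n * B ≤ d)
    (hq : q < d - 4 * n) : weight n B L d mis rej v q ≤ posWeight n L q := by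
  have h3 := posTotal_nonneg (n := n) (L := L)
  have h5 : (0 : ℤ) ≤ d * (d * (posTotal n L + 1)) :=
    mul_nonneg (by positivity) (mul_nonneg (by positivity) (by linarith))
  have h6 := posWeight_nonneg (n := n) (L := L) q
  rcases position_cases n B d q with h | ⟨k, hk, rfl⟩ | h | h | rfl | rfl | h |
    ⟨m, hm, t, ht, rfl⟩ | h | h | h
  · rwa [weight_zero h]
  · rw [weight_term hk]; split_ifs <;> omega
  · rw [weight_marker h.1 h.2]; exact le_posWeight_marker h.1 h.2
  · rwa [weight_gap h.1 h.2]
  · rw [weight_kill]; omega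
  · rw [weight_final]; exact le_posWeight_final
  · rw [weight_low h.1 h.2]; omega
  · have := weight_slot_le (L := L) (d := d) (mis := mis) (rej := rej) (v := v) hm ht; omega
  · rw [weight_rest h.1 h.2]; omega
  · rw [weight_high hd h.1 h.2]; omega
  · omega

theorem weight_le_posWeight_add {v : Fin n} {q : ℕ} (hd : 21 * n + 5 * n * B ≤ d) :
    weight n B L d mis rej v q ≤ posWeight n L q + d * (posTotal n L + 1) := by
  have h3 := posTotal_nonneg (n := n) (L := L)
  have h5 : (0 : ℤ) ≤ d * (posTotal n L + 1) := mul_nonneg (by positivity) (by linarith)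
  have h6 := posWeight_nonneg (n := n) (L := L) q
  by_cases hq : q < d - 4 * n
  · have := weight_le_posWeight (L := L) (mis := mis) (rej := rej) (v := v) hd hq
    omega
  · rw [weight_top hd (by omega)]; omega

end family

/-! ### Effect of misplaced prompt bits on the first and the last emitted bit -/

section family

variable {n : ℕ} [NeZero n] {B L d : ℕ} {mis : Fin n → ℕ → Bool} {rej : Fin n → Bool} {v : Fin n}
  {ζ β : ℕ → Bool}

theorem Autoregressive.eq_false {w : ℕ → ℤ} (h : Autoregressive d w ζ β) {t : ℕ}
    (hs : ∑ q ∈ Finset.range d, (if tape ζ β t q = true then w q else 0) < 0) : β t = false := by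
  rw [h t, decide_eq_false_iff_not]
  omega

theorem Autoregressive.eq_true {w : ℕ → ℤ} (h : Autoregressive d w ζ β) {t : ℕ}
    (hs : 0 ≤ ∑ q ∈ Finset.range d, (if tape ζ β t q = true then w q else 0)) : β t = true := by
  rw [h t, decide_eq_true_iff]
  exact hs

variable (h : Autoregressive d (weight n B L d mis rej v) ζ β) (hd : 21 * n + 5 * n * B ≤ d)
  (hL : 1 ≤ L)

include h hd hL

/-- The weight at `4n - 1` dominates everything else, even if all of the top zone is lit. -/
theorem first_eq_false_of_kill (hζ : ζ (4 * n - 1) = true) : β 0 = false := by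
  have h0 := NeZero.pos n
  refine h.eq_false (sum_neg_of_dominated (q₀ := 4 * n - 1)
    (u := fun q => posWeight n L q + d * (posTotal n L + 1)) (by omega) (fun q _ => ?_) ?_ ?_)
  · split_ifs
    · exact weight_le_posWeight_add hd
    · have := posTotal_nonneg (n := n) (L := L)
      have := posWeight_nonneg (n := n) (L := L) q
      positivity
  · have := posTotal_nonneg (n := n) (L := L)
    have := posWeight_nonneg (n := n) (L := L) (4 * n - 1)
    positivity
  · have h1 := sum_posWeight_le (n := n) (L := L) (d := d)
    rw [if_pos (by simpa [tape] using hζ), weight_kill, Finset.sum_add_distrib, Finset.sum_const,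
      Finset.card_range, nsmul_eq_mul]
    omega

/-- With position `4n - 1` dark, a bit in the top zone dominates all remaining negative weights. -/
theorem first_eq_true_of_top (hζ : ζ (4 * n - 1) = false) {p : ℕ} (hp : d - 4 * n ≤ p)
    (hpd : p < d) (hζp : ζ p = true) : β 0 = true := by
  have h1 := posTotal_nonneg (n := n) (L := L)
  refine h.eq_true (sum_nonneg_of_dominating (q₀ := p) (H := posTotal n L + 1) hpd (by omega)
    (fun q _ => ?_) ?_)
  · split_ifs with hq
    · refine neg_le_weight hd hL fun hq' => ?_
      simp [tape, hq', hζ] at hq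
    · omega
  · rw [if_pos (by simpa [tape] using hζp), weight_top hd hp]

/-- When the top zone is dark, all visible positive weights sum to at most `posTotal n L`. -/
theorem eq_false_of_dominated {t p : ℕ} (htop : ∀ q, d - 4 * n ≤ q → q < d → tape ζ β t q = false)
    (hp : p < d) (hζp : tape ζ β t p = true)
    (hw : weight n B L d mis rej v p = -(posTotal n L + 1)) : β t = false := by
  refine h.eq_false (sum_neg_of_dominated (q₀ := p) (u := posWeight n L) hp (fun q hq => ?_)
    (posWeight_nonneg p) ?_)
  · split_ifs with hq'
    · refine weight_le_posWeight hd (by_contra fun hc => ?_)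
      simp [htop q (by omega) hq] at hq'
    · exact posWeight_nonneg q
  · have h1 := sum_posWeight_le (n := n) (L := L) (d := d)
    rw [if_pos hζp, hw]
    omega

theorem final_eq_false_of_first (h₀ : β 0 = true) : β (4 * n) = false := by
  have h0 := NeZero.pos n
  refine h.eq_false (sum_neg_of_dominated (q₀ := 4 * n - 1)
    (u := fun q => posWeight n L q + d * (posTotal n L + 1)) (by omega) (fun q _ => ?_) ?_ ?_)
  · split_ifs
    · exact weight_le_posWeight_add hd
    · have := posTotal_nonneg (n := n) (L := L)
      have := posWeight_nonneg (n := n) (L := L) q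
      positivity
  · have := posTotal_nonneg (n := n) (L := L)
    have := posWeight_nonneg (n := n) (L := L) (4 * n - 1)
    positivity
  · have h1 := sum_posWeight_le (n := n) (L := L) (d := d)
    have h2 : tape ζ β (4 * n) (4 * n - 1) = true := by
      rw [tape, if_pos (by omega), Nat.sub_self, h₀]
    rw [if_pos h2, weight_kill, Finset.sum_add_distrib, Finset.sum_const,
      Finset.card_range, nsmul_eq_mul]
    omega

/-- In `4n` steps the bit at `p` has moved into the top zone, and position `4n - 1` shows the dark
first emitted bit. -/
theorem final_eq_true_of_high (h₀ : β 0 = false) {p : ℕ} (hp : d - 8 * n ≤ p)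
    (hpd : p < d - 4 * n) (hζp : ζ p = true) : β (4 * n) = true := by
  have h0 := NeZero.pos n
  have h1 := posTotal_nonneg (n := n) (L := L)
  refine h.eq_true (sum_nonneg_of_dominating (q₀ := p + 4 * n) (H := posTotal n L + 1) (by omega)
    (by omega) (fun q _ => ?_) ?_)
  · split_ifs with hq
    · refine neg_le_weight hd hL fun hq' => ?_
      rw [hq', tape, if_pos (by omega), Nat.sub_self, h₀] at hq
      exact absurd hq (by simp)
    · omega
  · rw [if_pos, weight_top hd (by omega)]
    rw [tape, if_neg (by omega), Nat.add_sub_cancel, hζp]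

/-- In `4n` steps both intervals move into zones of weight `-(posTotal n L + 1)`, while `hX` keeps
the top zone dark. -/
theorem final_eq_false_of_low (hX : ∀ p, d - 8 * n ≤ p → p < d - 4 * n → ζ p = false) {p : ℕ}
    (hp : 1 ≤ p ∧ p < 5 * n ∨ d - 12 * n ≤ p ∧ p < d - 8 * n) (hζp : ζ p = true) :
    β (4 * n) = false := by
  have h0 := NeZero.pos n
  refine eq_false_of_dominated h hd hL (p := p + 4 * n) (fun q hq hq' => ?_) (by omega) ?_ ?_
  · rw [tape, if_neg (by omega)]
    exact hX _ (by omega) (by omega)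
  · rw [tape, if_neg (by omega), Nat.add_sub_cancel, hζp]
  · rcases hp with hp | hp
    · exact weight_low (by omega) (by omega)
    · exact weight_high hd (by omega) (by omega)

/-- By induction on time, no emitted bit is lit yet. The marker meets only weights that are at most
zero before time `2n`, and the bit at `p` contributes a negative weight throughout. -/
theorem early_eq_false (hζ : ∀ p < d, ζ p = true → p = 0 ∨ (5 * n ≤ p ∧ p < d - 12 * n))
    {p : ℕ} (hp : 5 * n ≤ p) (hpd : p < d - 12 * n) (hζp : ζ p = true) :
    ∀ t < 2 * n, β t = false := by
  have h0 := NeZero.pos n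
  intro t
  induction t using Nat.strong_induction_on with
  | _ t ih =>
    intro ht
    refine h.eq_false (sum_neg_of_dominated (q₀ := p + t) (u := fun _ => 0) (by omega)
      (fun q hq => ?_) le_rfl ?_)
    · split_ifs with hb
      · unfold tape at hb
        split_ifs at hb with hqt
        · rw [ih _ (by omega) (by omega)] at hb
          exact absurd hb (by simp)
        · rcases hζ _ (by omega) hb with h1 | h1
          · have hq2 : q < 2 * n := by omega
            rcases lt_or_ge q n with hq3 | hq3
            · rw [weight_zero hq3]
            · have := weight_term (B := B) (L := L) (d := d) (mis := mis) (rej := rej) (v := v)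
                (k := 2 * n - 1 - q) (by omega)
              rw [show 2 * n - 1 - (2 * n - 1 - q) = q by omega] at this
              rw [this]; split_ifs <;> omega
          · have := weight_middle_lt (L := L) (mis := mis) (rej := rej) (v := v) hd
              (q := q) (by omega) (by omega)
            omega
      · exact le_rfl
    · have h1 : tape ζ β t (p + t) = true := by
        rw [tape, if_neg (by omega), Nat.add_sub_cancel, hζp]
      have := weight_middle_lt (L := L) (mis := mis) (rej := rej) (v := v) hd
              (q := p + t) (by omega) (by omega)
      simp only [h1, if_true, Finset.sum_const_zero]
      omega

theorem weight_nonpos_of_lt {q : ℕ} (hq : q < 2 * n ∨ 3 * n ≤ q ∧ q < 4 * n) :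
    weight n B L d mis rej v q ≤ 0 := by
  have h3 := posTotal_nonneg (n := n) (L := L)
  have h5 : (0 : ℤ) ≤ d * (d * (posTotal n L + 1)) :=
    mul_nonneg (by positivity) (mul_nonneg (by positivity) (by linarith))
  rcases position_cases n B d q with h | ⟨k, hk, rfl⟩ | h | h | rfl | rfl | h |
    ⟨m, hm, t, ht, rfl⟩ | h | h | h
  any_goals omega
  · rw [weight_zero h]
  · rw [weight_term hk]; split_ifs <;> omega
  · rw [weight_gap h.1 h.2]
  · rw [weight_kill]; omega

/-- A bit outside the slots costs at least `L + 1` at the output time. The only positive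
contribution that can be visible is `L`, from the marker: the zone of weight `L * (L + 1)` shows
early silent bits. -/
theorem final_eq_false_of_garbage
    (hζ : ∀ p < d - 4 * n, ζ p = true → p = 0 ∨ (5 * n ≤ p ∧ p < d - 12 * n))
    (he : ∀ t < 2 * n, β t = false) {p : ℕ} (hp : 5 * n ≤ p) (hpd : p < d - 12 * n)
    (hζp : ζ p = true) (hg : ∀ m < B, p ≠ 9 * n + 5 * n * m) : β (4 * n) = false := by
  have h0 := NeZero.pos n
  refine h.eq_false (sum_neg_of_dominated (q₀ := p + 4 * n)
    (u := fun q => if q = 4 * n then (L : ℤ) else 0) (by omega) (fun q hq => ?_)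
    (by split_ifs <;> omega) ?_)
  · by_cases hb : tape ζ β (4 * n) q = true
    · rw [if_pos hb]
      unfold tape at hb
      split_ifs at hb with hqt
      · rw [if_neg (by omega)]
        by_cases hq2 : 2 * n ≤ q
        · rw [he _ (by omega)] at hb
          exact absurd hb (by simp)
        · exact weight_nonpos_of_lt h hd hL (by omega)
      · rcases hζ _ (by omega) hb with h1 | h1
        · have hq4 : q = 4 * n := by omega
          rw [if_pos hq4, hq4, weight_final]
        · have := weight_middle_lt (L := L) (mis := mis) (rej := rej) (v := v) hd
              (q := q) (by omega) (by omega)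
          rw [if_neg (by omega)]
          omega
    · rw [if_neg hb]
      split_ifs <;> omega
  · have h1 : tape ζ β (4 * n) (p + 4 * n) = true := by
      rw [tape, if_neg (by omega), Nat.add_sub_cancel, hζp]
    have := weight_middle_garbage (L := L) (mis := mis) (rej := rej) (v := v) hp hpd hg
    rw [if_pos h1, Finset.sum_ite_eq' (Finset.range d), if_pos (Finset.mem_range.2 (by omega))]
    omega

/-- An empty sum, or a sum with only the marker at weight zero, counts as nonnegative. Prompts
without slot bits are thus handled by the suppressed output and not by the output formula. -/
theorem first_eq_true_of_empty (hζ : ∀ p < d, ζ p = true → p = 0) : β 0 = true := by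
  have h0 := NeZero.pos n
  refine h.eq_true (Finset.sum_nonneg fun q hq => ?_)
  split_ifs with hb
  · simp only [tape, Nat.not_lt_zero, if_false, Nat.sub_zero] at hb
    rw [hζ q (Finset.mem_range.1 hq) hb, weight_zero h0]
  · exact le_rfl

end family

/-! ### Prompts in the right format -/

section format

variable (n : ℕ) [NeZero n] (B L : ℕ) (mis : Fin n → ℕ → Bool) (rej : Fin n → Bool)

/-- Prompts whose visible bits are the marker at position `0` and bits at the slots. -/
def WellPlaced (d : ℕ) (ζ : ℕ → Bool) : Prop :=
  ∀ p < d, ζ p = true → p = 0 ∨ ∃ m < B, p = 9 * n + 5 * n * m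

/-- The value of a term on a prompt. -/
def termValue (ζ : ℕ → Bool) (a : Fin n) : Bool :=
  decide (0 ≤ (if ζ 0 then (L : ℤ) * (L + 1) else 0) +
    ∑ m ∈ Finset.range B, if ζ (9 * n + 5 * n * m) then
      (if mis a m then -(L + 2) else -(L + 1) : ℤ) else 0)

/-- The output on a prompt. -/
def outputValue (ζ : ℕ → Bool) : Bool :=
  decide (0 ≤ (if ζ 0 then (L : ℤ) else 0) +
    (∑ m ∈ Finset.range B, if ζ (9 * n + 5 * n * m) then (-1 : ℤ) else 0) +
    ∑ a, if termValue n B L mis ζ a && rej a then (-1 : ℤ) else 0)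

variable {n B L mis rej} {d : ℕ} {v : Fin n} {ζ β : ℕ → Bool}

theorem sum_promptPart (hd : 21 * n + 5 * n * B ≤ d) (hζ : WellPlaced n B d ζ) (w : ℕ → ℤ) {t : ℕ}
    (ht : t ≤ 4 * n) :
    ∑ q ∈ Finset.range d, (if q < t then 0 else if ζ (q - t) = true then w q else 0) =
      (if ζ 0 then w t else 0) +
        ∑ m ∈ Finset.range B, if ζ (9 * n + 5 * n * m) then w (9 * n + 5 * n * m + t) else 0 := by
  have h0 := NeZero.pos n
  have hmul : ∀ m < B, 5 * n * m + 5 * n ≤ 5 * n * B := fun m hm => by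
    rw [← Nat.mul_succ]; exact Nat.mul_le_mul_left _ hm
  have hinj : Set.InjOn (fun m => 9 * n + 5 * n * m + t) (Finset.range B : Set ℕ) := by
    intro a _ b _ hab
    have : 5 * n * a = 5 * n * b := by simp only at hab; omega
    exact Nat.eq_of_mul_eq_mul_left (by omega) this
  have hsub : insert t ((Finset.range B).image fun m => 9 * n + 5 * n * m + t) ⊆
      Finset.range d := by
    intro q hq
    rw [Finset.mem_insert, Finset.mem_image] at hq
    rw [Finset.mem_range]
    rcases hq with rfl | ⟨m, hm, rfl⟩
    · omega
    · have := hmul m (Finset.mem_range.1 hm); omega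
  rw [← Finset.sum_subset hsub, Finset.sum_insert, Finset.sum_image hinj]
  · congr 1
    · simp
    · refine Finset.sum_congr rfl fun m _ => ?_
      rw [if_neg (by omega), Nat.add_sub_cancel]
  · intro hq
    obtain ⟨m, _, hm⟩ := Finset.mem_image.1 hq
    omega
  · intro q hq hq'
    split_ifs with h1 h2
    · rfl
    · exfalso
      apply hq'
      rw [Finset.mem_insert, Finset.mem_image]
      have := Finset.mem_range.1 hq
      rcases hζ _ (by omega) h2 with h3 | ⟨m, hm, h3⟩
      · exact .inl (by omega)
      · exact .inr ⟨m, Finset.mem_range.2 hm, by omega⟩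
    · rfl

variable (h : Autoregressive d (weight n B L d mis rej v) ζ β) (hd : 21 * n + 5 * n * B ≤ d)
  (hL : 1 ≤ L) (hζ : WellPlaced n B d ζ) {m₀ : ℕ} (hm₀ : m₀ < B)
  (hζm : ζ (9 * n + 5 * n * m₀) = true)

include hd hζ in
theorem WellPlaced.bounds : ∀ p < d, ζ p = true → p = 0 ∨ (5 * n ≤ p ∧ p < d - 12 * n) := by
  have h0 := NeZero.pos n
  intro p hp hζp
  rcases hζ p hp hζp with h1 | ⟨m, hm, h1⟩
  · exact .inl h1
  · have : 5 * n * m + 5 * n ≤ 5 * n * B := by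
      rw [← Nat.mul_succ]; exact Nat.mul_le_mul_left _ hm
    omega

include h hd hL hζ hm₀ hζm

theorem WellPlaced.early : ∀ t < 2 * n, β t = false := by
  have h0 := NeZero.pos n
  have : 5 * n * m₀ + 5 * n ≤ 5 * n * B := by
    rw [← Nat.mul_succ]; exact Nat.mul_le_mul_left _ hm₀
  exact early_eq_false h hd hL (hζ.bounds hd) (p := 9 * n + 5 * n * m₀) (by omega) (by omega) hζm

/-- Positions below `n` have weight zero, and the other positions occupied by emitted bits show
early silent steps. Only the marker and the slots remain. -/
theorem WellPlaced.term {k : ℕ} (hk : k < n) :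
    β (2 * n + k) = termValue n B L mis ζ (termAt n v k) := by
  have he := WellPlaced.early h hd hL hζ hm₀ hζm
  rw [h, termValue, decide_eq_decide]
  have h1 : ∀ q ∈ Finset.range d, (if tape ζ β (2 * n + k) q = true then
      weight n B L d mis rej v q else 0) = if q < 2 * n + k then 0 else
        if ζ (q - (2 * n + k)) = true then weight n B L d mis rej v q else 0 := by
    intro q _
    unfold tape
    by_cases hq : q < 2 * n + k
    · rw [if_pos hq, if_pos hq]
      by_cases hqn : q < n
      · rw [weight_zero hqn, ite_self]
      · rw [he _ (by omega), if_neg (by simp)]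
    · rw [if_neg hq, if_neg hq]
  rw [Finset.sum_congr rfl h1, sum_promptPart hd hζ _ (by omega),
    weight_marker (by omega) (by omega)]
  apply Eq.to_iff
  congr 2
  refine Finset.sum_congr rfl fun m hm => ?_
  have hw := weight_slot (L := L) (d := d) (mis := mis) (rej := rej) (v := v)
    (Finset.mem_range.1 hm) (t := 2 * n + k) (by omega)
  rw [if_neg (by omega)] at hw
  rw [hw]
  simp [show 2 * n + k < 3 * n by omega]

/-- The zone of weight `L * (L + 1)` now shows the silent early bits and the marker has moved past
it, so the lit slot makes the sum negative. -/
theorem WellPlaced.gap {t : ℕ} (ht : 3 * n ≤ t) (ht' : t < 4 * n) : β t = false := by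
  have h0 := NeZero.pos n
  have he := WellPlaced.early h hd hL hζ hm₀ hζm
  have hm : 5 * n * m₀ + 5 * n ≤ 5 * n * B := by
    rw [← Nat.mul_succ]; exact Nat.mul_le_mul_left _ hm₀
  refine h.eq_false (sum_neg_of_dominated (q₀ := 9 * n + 5 * n * m₀ + t) (u := fun _ => 0)
    (by omega) (fun q hq => ?_) le_rfl ?_)
  · split_ifs with hb
    · unfold tape at hb
      split_ifs at hb with hqt
      · by_cases hq2 : 2 * n ≤ q ∧ q < 3 * n
        · rw [he _ (by omega)] at hb
          exact absurd hb (by simp)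
        · exact weight_nonpos_of_lt h hd hL (by omega)
      · rcases hζ.bounds hd _ (by omega) hb with h1 | h1
        · exact weight_nonpos_of_lt h hd hL (by omega)
        · have := weight_middle_lt (L := L) (mis := mis) (rej := rej) (v := v) hd
              (q := q) (by omega) (by omega)
          omega
    · exact le_rfl
  · have h1 : tape ζ β t (9 * n + 5 * n * m₀ + t) = true := by
      rw [tape, if_neg (by omega), Nat.add_sub_cancel, hζm]
    have := weight_slot_le (L := L) (d := d) (mis := mis) (rej := rej) (v := v) hm₀
      (t := t) (by omega)
    simp only [h1, if_true, Finset.sum_const_zero]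
    omega

/-- The prompt contributes through the marker and the slots, with weights free of `v`. The emitted
bits contribute the number of satisfied rejecting terms, which is a sum over all terms in whatever
order they were evaluated. -/
theorem WellPlaced.output : β (4 * n) = outputValue n B L mis rej ζ := by
  have h0 := NeZero.pos n
  have he := WellPlaced.early h hd hL hζ hm₀ hζm
  rw [h, outputValue, decide_eq_decide]
  set w := weight n B L d mis rej v with hw
  have h1 : ∀ q ∈ Finset.range d, (if tape ζ β (4 * n) q = true then w q else 0) =
      (if q < 4 * n then 0 else if ζ (q - 4 * n) = true then w q else 0) +
      if n ≤ q ∧ q < 2 * n ∧ β (4 * n - 1 - q) = true then w q else 0 := by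
    intro q _
    unfold tape
    by_cases hq : q < 4 * n
    · rw [if_pos hq, if_pos hq, zero_add]
      by_cases hqn : q < n
      · rw [hw, weight_zero hqn, ite_self, ite_self]
      · by_cases hq2 : q < 2 * n
        · simp [show n ≤ q by omega, hq2]
        · rw [he _ (by omega), if_neg (by simp), if_neg (by omega)]
    · rw [if_neg hq, if_neg hq,
        if_neg (show ¬ (n ≤ q ∧ q < 2 * n ∧ β (4 * n - 1 - q) = true) from fun hc => by omega),
        add_zero]
  have h2 : ∑ q ∈ Finset.range d, (if n ≤ q ∧ q < 2 * n ∧ β (4 * n - 1 - q) = true then w q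
      else 0) = ∑ a, if termValue n B L mis ζ a && rej a then (-1 : ℤ) else 0 := by
    have h3 : ∑ q ∈ Finset.range d, (if n ≤ q ∧ q < 2 * n ∧ β (4 * n - 1 - q) = true then w q
        else 0) = ∑ k ∈ Finset.range n, if termValue n B L mis ζ (termAt n v k) &&
          rej (termAt n v k) then (-1 : ℤ) else 0 := by
      have hinj : Set.InjOn (fun k => 2 * n - 1 - k) (Finset.range n : Set ℕ) := by
        intro a ha b hb hab
        simp only [Finset.coe_range, Set.mem_Iio] at ha hb hab
        omega
      rw [← Finset.sum_subset (s₁ := (Finset.range n).image fun k => 2 * n - 1 - k),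
        Finset.sum_image hinj]
      · refine Finset.sum_congr rfl fun k hk => ?_
        have hk' := Finset.mem_range.1 hk
        rw [hw, weight_term hk', show 4 * n - 1 - (2 * n - 1 - k) = 2 * n + k by omega,
          WellPlaced.term h hd hL hζ hm₀ hζm hk']
        simp only [show n ≤ 2 * n - 1 - k by omega, show 2 * n - 1 - k < 2 * n by omega, true_and]
        cases termValue n B L mis ζ (termAt n v k) <;> simp
      · intro q hq
        obtain ⟨k, hk, rfl⟩ := Finset.mem_image.1 hq
        have := Finset.mem_range.1 hk
        exact Finset.mem_range.2 (by omega)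
      · intro q _ hq
        rw [if_neg]
        rintro ⟨h5, h6, _⟩
        exact hq (Finset.mem_image.2 ⟨2 * n - 1 - q, Finset.mem_range.2 (by omega), by omega⟩)
    rw [h3, Finset.sum_range]
    -- The rotation disappears here: `k ↦ k - v` permutes the terms.
    refine (Fintype.sum_equiv (Equiv.subRight v) _ _ fun k => ?_)
    simp [termAt]
  rw [Finset.sum_congr rfl h1, Finset.sum_add_distrib, sum_promptPart hd hζ _ le_rfl, h2, hw,
    weight_final]
  apply Eq.to_iff
  congr 3
  refine Finset.sum_congr rfl fun m hm => ?_
  rw [weight_slot (Finset.mem_range.1 hm) (by omega), if_pos rfl]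

omit h hζ hm₀ hζm in
/-- The end-to-end map does not depend on the rotation. -/
theorem final_independent (ζ : ℕ → Bool) : ∃ b, ∀ (v : Fin n) (β : ℕ → Bool),
    Autoregressive d (weight n B L d mis rej v) ζ β → β (4 * n) = b := by
  have h0 := NeZero.pos n
  -- Misplaced bits are treated in an order such that each one decides the output by domination,
  -- whatever the rest of the prompt. A bit at `4n - 1` comes first, since it controls the first
  -- emitted bit; the top zone comes next, since it would outweigh the zones considered afterwards.
  by_cases hk : ζ (4 * n - 1) = true
  · by_cases hX : ∃ p, d - 8 * n ≤ p ∧ p < d - 4 * n ∧ ζ p = true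
    · obtain ⟨p, hp, hpd, hp'⟩ := hX
      exact ⟨true, fun v β h =>
        final_eq_true_of_high h hd hL (first_eq_false_of_kill h hd hL hk) hp hpd hp'⟩
    · refine ⟨false, fun v β h => final_eq_false_of_low h hd hL (fun p hp hp' => ?_)
        (p := 4 * n - 1) (by omega) hk⟩
      by_contra hc
      exact hX ⟨p, hp, hp', by simpa using hc⟩
  have hk' : ζ (4 * n - 1) = false := by simpa using hk
  by_cases hT : ∃ p, d - 4 * n ≤ p ∧ p < d ∧ ζ p = true
  · obtain ⟨p, hp, hpd, hp'⟩ := hT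
    exact ⟨false, fun v β h =>
      final_eq_false_of_first h hd hL (first_eq_true_of_top h hd hL hk' hp hpd hp')⟩
  have hT' : ∀ p, d - 4 * n ≤ p → p < d → ζ p = false := fun p hp hp' => by
    by_contra hc
    exact hT ⟨p, hp, hp', by simpa using hc⟩
  by_cases hX : ∃ p, d - 8 * n ≤ p ∧ p < d - 4 * n ∧ ζ p = true
  · obtain ⟨p, hp, hpd, hp'⟩ := hX
    refine ⟨true, fun v β h => final_eq_true_of_high h hd hL
      (eq_false_of_dominated h hd hL (p := p) (fun q hq hq' => ?_) (by omega) ?_ ?_) hp hpd hp'⟩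
    · simpa [tape] using hT' q hq hq'
    · simpa [tape] using hp'
    · exact weight_high hd hp hpd
  have hX' : ∀ p, d - 8 * n ≤ p → p < d - 4 * n → ζ p = false := fun p hp hp' => by
    by_contra hc
    exact hX ⟨p, hp, hp', by simpa using hc⟩
  by_cases hY : ∃ p, (1 ≤ p ∧ p < 5 * n ∨ d - 12 * n ≤ p ∧ p < d - 8 * n) ∧ ζ p = true
  · obtain ⟨p, hp, hp'⟩ := hY
    exact ⟨false, fun v β h => final_eq_false_of_low h hd hL hX' hp hp'⟩
  have hζ : ∀ p < d, ζ p = true → p = 0 ∨ (5 * n ≤ p ∧ p < d - 12 * n) := by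
    intro p hp hζp
    by_contra hc
    by_cases h1 : d - 4 * n ≤ p
    · simp [hT' p h1 hp] at hζp
    by_cases h2 : d - 8 * n ≤ p
    · simp [hX' p h2 (by omega)] at hζp
    exact hY ⟨p, by omega, hζp⟩
  by_cases hG : ∃ p, 5 * n ≤ p ∧ p < d - 12 * n ∧ ζ p = true ∧ ∀ m < B, p ≠ 9 * n + 5 * n * m
  · obtain ⟨p, hp, hpd, hp', hg⟩ := hG
    exact ⟨false, fun v β h => final_eq_false_of_garbage h hd hL
      (fun p hp => hζ p (by omega)) (early_eq_false h hd hL hζ hp hpd hp') hp hpd hp' hg⟩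
  have hW : WellPlaced n B d ζ := by
    intro p hp hζp
    rcases hζ p hp hζp with h1 | h1
    · exact .inl h1
    · refine .inr ?_
      by_contra hc
      push Not at hc
      exact hG ⟨p, h1.1, h1.2, hζp, hc⟩
  -- Well placed prompts with a lit slot run through all phases. Those without one emit a one at
  -- time `0`, which suppresses the output.
  by_cases hU : ∃ m < B, ζ (9 * n + 5 * n * m) = true
  · obtain ⟨m, hm, hm'⟩ := hU
    exact ⟨_, fun v β h => WellPlaced.output h hd hL hW hm hm'⟩
  · refine ⟨false, fun v β h => final_eq_false_of_first h hd hL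
      (first_eq_true_of_empty h hd hL fun p hp hζp => ?_)⟩
    rcases hW p hp hζp with h1 | ⟨m, hm, rfl⟩
    · exact h1
    · exact absurd ⟨m, hm, hζp⟩ hU

end format

/-! ### The encoding of hyperedges as prompts -/

theorem getD_flatMap_const {α β : Type} (l : List α) (f : α → List β) (c : ℕ) (b : β)
    (hf : ∀ a ∈ l, (f a).length = c) (i r : ℕ) (hr : r < c) :
    (l.flatMap f).getD (c * i + r) b = ((l.map fun a => (f a).getD r b).getD i b) := by
  induction l generalizing i with
  | nil => simp
  | cons a l ih =>
    rw [List.flatMap_cons]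
    have ha := hf a (by simp)
    cases i with
    | zero => rw [List.getD_append _ _ _ _ (by omega)]; simp
    | succ i =>
      rw [List.getD_append_right _ _ _ _ (by rw [ha, Nat.mul_succ]; omega), ha,
        show c * (i + 1) + r - c = c * i + r by rw [Nat.mul_succ]; omega,
        ih (fun x hx => hf x (by simp [hx]))]
      simp

theorem length_flatMap_const {α β : Type} (l : List α) (f : α → List β) (c : ℕ)
    (hf : ∀ a ∈ l, (f a).length = c) : (l.flatMap f).length = l.length * c := by
  induction l with
  | nil => simp
  | cons a l ih =>
    rw [List.flatMap_cons, List.length_append, hf a (by simp), ih fun x hx => hf x (by simp [hx]),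
      List.length_cons]
    ring

/-- The unit vector of length `N` with a one at position `u`. -/
def unitVector (N u : ℕ) : List Bool :=
  List.replicate u false ++ true :: List.replicate (N - (u + 1)) false

theorem length_unitVector {N u : ℕ} (hu : u < N) : (unitVector N u).length = N := by
  simp [unitVector]; omega

theorem getD_replicate_false (k i : ℕ) : (List.replicate k false).getD i false = false := by
  rw [List.getD_eq_getElem?_getD, List.getElem?_replicate]
  split_ifs <;> rfl

theorem getD_unitVector (N u i : ℕ) : (unitVector N u).getD i false = decide (i = u) := by
  unfold unitVector
  rcases lt_trichotomy i u with h | rfl | h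
  · rw [List.getD_append _ _ _ _ (by simpa using h), getD_replicate_false]
    simp [h.ne]
  · rw [List.getD_append_right _ _ _ _ (by simp)]
    simp
  · obtain ⟨k, rfl⟩ := Nat.exists_eq_add_of_lt h
    rw [List.getD_append_right _ _ _ _ (by simp; omega), List.length_replicate,
      show u + k + 1 - u = k + 1 by omega, List.getD_cons_succ, getD_replicate_false]
    simp; omega

/-- The concatenated unit vectors of the vertices of a hyperedge, after a leading one. -/
def slotBits (N : ℕ) (S : List ℕ) : List Bool := true :: S.flatMap (unitVector N)

/-- The prompt of a hyperedge, read from the end. -/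
def reversedPrompt (n N : ℕ) (S : List ℕ) : List Bool :=
  true :: List.replicate (9 * n - 1) false ++
    (slotBits N S).flatMap fun b => b :: List.replicate (5 * n - 1) false

/-- The prompt of a hyperedge. -/
def prompt (n N : ℕ) (S : List ℕ) : List Bool := (reversedPrompt n N S).reverse

/-- The uninformative prompt. -/
def blankPrompt (n : ℕ) : List Bool := true :: List.replicate (9 * n) false

theorem getD_slotBits_succ {N : ℕ} {S : List ℕ} (hS : ∀ u ∈ S, u < N) (m : ℕ) (hN : 0 < N) :
    (slotBits N S).getD (m + 1) false =
      (S.map fun u => decide (m % N = u)).getD (m / N) false := by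
  rw [slotBits, List.getD_cons_succ]
  conv_lhs => rw [← Nat.div_add_mod m N]
  rw [getD_flatMap_const S _ N false (fun u hu => length_unitVector (hS u hu)) _ _
    (Nat.mod_lt _ hN)]
  simp only [getD_unitVector]

theorem length_slotBits {N : ℕ} {S : List ℕ} (hS : ∀ u ∈ S, u < N) :
    (slotBits N S).length = S.length * N + 1 := by
  rw [slotBits, List.length_cons,
    length_flatMap_const S _ N fun u hu => length_unitVector (hS u hu)]

theorem length_prompt {n N : ℕ} (hn : 0 < n) {S : List ℕ} (hS : ∀ u ∈ S, u < N) :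
    (prompt n N S).length = 9 * n + 5 * n * (S.length * N + 1) := by
  rw [prompt, List.length_reverse, reversedPrompt, List.length_append,
    length_flatMap_const _ _ (5 * n) (fun b _ => by simp; omega), length_slotBits hS]
  simp
  rw [Nat.mul_comm (5 * n)]
  omega

theorem getD_reversedPrompt {n N : ℕ} (hn : 0 < n) {S : List ℕ} (p : ℕ) :
    (reversedPrompt n N S).getD p false = if p = 0 then true else if p < 9 * n then false else
      if (p - 9 * n) % (5 * n) = 0 then (slotBits N S).getD ((p - 9 * n) / (5 * n)) false
      else false := by
  unfold reversedPrompt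
  rw [List.cons_append]
  cases p with
  | zero => simp
  | succ p =>
    rw [List.getD_cons_succ, if_neg (by omega)]
    split_ifs with h1 h2
    · rw [List.getD_append _ _ _ _ (by simp; omega), getD_replicate_false]
    all_goals
      rw [List.getD_append_right _ _ _ _ (by simp; omega), List.length_replicate,
        show p - (9 * n - 1) = p + 1 - 9 * n by omega,
        ← Nat.div_add_mod (p + 1 - 9 * n) (5 * n),
        getD_flatMap_const _ _ (5 * n) false (fun b _ => by simp; omega) _ _
        (Nat.mod_lt _ (by omega))]
    · rw [h2]
      simp [Nat.mul_div_cancel_left _ (show 0 < 5 * n by omega)]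
    · obtain ⟨r, hr⟩ := Nat.exists_eq_succ_of_ne_zero h2
      rw [hr]
      simp only [Nat.succ_eq_add_one, List.getD_cons_succ, getD_replicate_false]
      rw [List.map_const', getD_replicate_false]

theorem getD_reversedPrompt_slot {n N : ℕ} (hn : 0 < n) {S : List ℕ} (m : ℕ) :
    (reversedPrompt n N S).getD (9 * n + 5 * n * m) false = (slotBits N S).getD m false := by
  rw [getD_reversedPrompt hn, if_neg (by omega), if_neg (by omega),
    show 9 * n + 5 * n * m - 9 * n = 5 * n * m by omega, Nat.mul_mod_right, if_pos rfl,
    Nat.mul_div_cancel_left _ (by omega)]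

theorem wellPlaced_prompt {n N d : ℕ} [NeZero n] {S : List ℕ} (hS : ∀ u ∈ S, u < N) :
    WellPlaced n (S.length * N + 1) d fun p => (reversedPrompt n N S).getD p false := by
  have hn := NeZero.pos n
  intro p _ hp
  simp only [getD_reversedPrompt hn] at hp
  split_ifs at hp with h1 h2 h3
  · exact .inl h1
  · refine .inr ⟨(p - 9 * n) / (5 * n), ?_, ?_⟩
    · rw [← length_slotBits hS]
      by_contra hc
      rw [List.getD_eq_default _ _ (by omega)] at hp
      exact absurd hp (by simp)
    · have := Nat.div_add_mod (p - 9 * n) (5 * n)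
      omega

theorem getD_blankPrompt (n p : ℕ) :
    (blankPrompt n).reverse.getD p false = decide (p = 9 * n) := by
  rw [blankPrompt, List.reverse_cons, List.reverse_replicate]
  simpa only [unitVector, Nat.zero_sub, List.replicate_zero] using getD_unitVector 0 (9 * n) p

/-! ### The thinkers that evaluate a local predicate -/

theorem sum_range_mul {M : Type} [AddCommMonoid M] (K N : ℕ) (f : ℕ → M) :
    ∑ m ∈ Finset.range (K * N), f m =
      ∑ j ∈ Finset.range K, ∑ u ∈ Finset.range N, f (N * j + u) := by
  induction K with
  | zero => simp
  | succ K ih =>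
    rw [Finset.sum_range_succ, ← ih, Nat.succ_mul, Finset.sum_range_add, Nat.mul_comm K N]

/-- Whether the term `a` asks for a value different from `x` at the slot `m`. -/
def mismatch {n : ℕ} (N : ℕ) (al : Fin n → ℕ → Bool) (x : ℕ → Bool) (a : Fin n) : ℕ → Bool
  | 0 => false
  | m + 1 => x (m % N) != al a (m / N)

/-- Besides the leading slot, each of the `S.length` blocks of `N` slots has exactly one lit slot,
given by the corresponding vertex. -/
theorem sum_slots {N : ℕ} {S : List ℕ} (hS : ∀ u ∈ S, u < N) (hN : 0 < N) (c : ℕ → ℤ) :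
    ∑ m ∈ Finset.range (S.length * N + 1), (if (slotBits N S).getD m false then c m else 0) =
      c 0 + ∑ j ∈ Finset.range S.length, c (N * j + S.getD j 0 + 1) := by
  rw [Finset.sum_range_succ', add_comm]
  congr 1
  rw [sum_range_mul]
  refine Finset.sum_congr rfl fun j hj => ?_
  have hj' := Finset.mem_range.1 hj
  have hSj : S.getD j 0 = S[j] := List.getD_eq_getElem _ _ hj'
  have hlt : S.getD j 0 < N := hSj ▸ hS _ (List.getElem_mem hj')
  rw [Finset.sum_eq_single_of_mem (S.getD j 0) (Finset.mem_range.2 hlt)]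
  · rw [getD_slotBits_succ hS _ hN, Nat.mul_add_mod, Nat.mod_eq_of_lt hlt,
      Nat.mul_add_div hN, Nat.div_eq_of_lt hlt, add_zero, List.getD_eq_getElem _ _ (by simpa)]
    rw [List.getElem_map, ← hSj]
    simp only [decide_true, if_true]
  · intro u hu hne
    have hu' := Finset.mem_range.1 hu
    rw [getD_slotBits_succ hS _ hN, Nat.mul_add_mod, Nat.mod_eq_of_lt hu',
      Nat.mul_add_div hN, Nat.div_eq_of_lt hu', add_zero, List.getD_eq_getElem _ _ (by simpa)]
    rw [List.getElem_map, ← hSj]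
    simp only [hne, decide_false, Bool.false_eq_true, if_false]

/-- There are exactly `S.length + 1` lit slots, so their base price cancels the marker and the sum
equals minus the number of mismatches. -/
theorem termValue_prompt {n N : ℕ} [NeZero n] {S : List ℕ} (hS : ∀ u ∈ S, u < N) (hN : 0 < N)
    (al : Fin n → ℕ → Bool) (x : ℕ → Bool) (a : Fin n) :
    termValue n (S.length * N + 1) (S.length + 1) (mismatch N al x)
      (fun p => (reversedPrompt n N S).getD p false) a =
      decide (∀ j < S.length, x (S.getD j 0) = al a j) := by
  have hn := NeZero.pos n
  rw [termValue, decide_eq_decide]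
  simp only [getD_reversedPrompt_slot hn]
  rw [sum_slots hS hN fun m => if mismatch N al x a m then
    -(((S.length + 1 : ℕ) : ℤ) + 2) else -(((S.length + 1 : ℕ) : ℤ) + 1)]
  have h1 : ∀ j ∈ Finset.range S.length,
      (if mismatch N al x a (N * j + S.getD j 0 + 1) then
        -(((S.length + 1 : ℕ) : ℤ) + 2) else -(((S.length + 1 : ℕ) : ℤ) + 1)) =
      -(((S.length + 1 : ℕ) : ℤ) + 1) - if x (S.getD j 0) = al a j then 0 else 1 := by
    intro j hj
    have hj' := Finset.mem_range.1 hj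
    have hSj : S.getD j 0 = S[j] := List.getD_eq_getElem _ _ hj'
    have hlt : S.getD j 0 < N := hSj ▸ hS _ (List.getElem_mem hj')
    simp only [mismatch, Nat.mul_add_mod, Nat.mod_eq_of_lt hlt,
      Nat.mul_add_div hN, Nat.div_eq_of_lt hlt, add_zero]
    by_cases h : x (S.getD j 0) = al a j
    · have hb : (x (S.getD j 0) != al a j) = false := by rw [h]; exact bne_self_eq_false _
      rw [hb, if_neg Bool.false_ne_true, if_pos h, sub_zero]
    · rw [if_pos (bne_iff_ne.2 h), if_neg h]
      ring
  rw [Finset.sum_congr rfl h1, Finset.sum_sub_distrib, Finset.sum_const, Finset.card_range,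
    getD_reversedPrompt hn]
  have h2 : (0 : ℤ) ≤ ∑ j ∈ Finset.range S.length, if x (S.getD j 0) = al a j then 0 else 1 :=
    Finset.sum_nonneg fun j _ => by split_ifs <;> simp
  simp only [if_true, mismatch, Bool.false_eq_true, if_false, nsmul_eq_mul]
  -- With `L = S.length + 1`, the marker contributes `L * (L + 1)`, and the leading slot and the
  -- vertices together contribute `-L * (L + 1)`.
  have h3 : (((S.length + 1 : ℕ) : ℤ) * (((S.length + 1 : ℕ) : ℤ) + 1) +
      (-(((S.length + 1 : ℕ) : ℤ) + 1) + ((S.length : ℤ) * -(((S.length + 1 : ℕ) : ℤ) + 1) -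
      ∑ j ∈ Finset.range S.length, if x (S.getD j 0) = al a j then 0 else 1))) =
      - ∑ j ∈ Finset.range S.length, if x (S.getD j 0) = al a j then 0 else 1 := by
    push_cast; ring
  rw [h3, neg_nonneg]
  constructor
  · intro h j hj
    have h4 := (Finset.sum_eq_zero_iff_of_nonneg fun j _ => by split_ifs <;> simp).1
      (le_antisymm h h2) j (Finset.mem_range.2 hj)
    by_contra hc
    rw [if_neg hc] at h4
    exact one_ne_zero h4
  · intro h
    refine le_of_eq (Finset.sum_eq_zero fun j hj => ?_)
    rw [if_pos (h j (Finset.mem_range.1 hj))]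

/-- Marker and lit slots cancel again, so the output is negative exactly if the unique satisfied
term `a₀` is a rejecting one. -/
theorem outputValue_prompt {n N : ℕ} [NeZero n] {S : List ℕ} (hS : ∀ u ∈ S, u < N) (hN : 0 < N)
    (al : Fin n → ℕ → Bool) (rej : Fin n → Bool) (x : ℕ → Bool) (a₀ : Fin n)
    (ha₀ : ∀ a, (∀ j < S.length, x (S.getD j 0) = al a j) ↔ a = a₀) :
    outputValue n (S.length * N + 1) (S.length + 1) (mismatch N al x) rej
      (fun p => (reversedPrompt n N S).getD p false) = !rej a₀ := by
  have hn := NeZero.pos n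
  rw [outputValue]
  simp only [getD_reversedPrompt_slot hn, termValue_prompt hS hN, ha₀]
  rw [sum_slots hS hN fun _ => -1, getD_reversedPrompt hn, Finset.sum_eq_single_of_mem a₀
    (Finset.mem_univ _) (fun a _ ha => by simp [ha])]
  simp only [if_true, Finset.sum_const, Finset.card_range, nsmul_eq_mul, decide_true,
    Bool.true_and]
  cases rej a₀
  · simp
  · simp

/-- The chain of thought that points to the location `k` and ends with `y`. -/
def pointingCot (n : ℕ) (k : Fin n) (y : Bool) : List Bool :=
  List.replicate (2 * n) false ++ (List.range n).map (fun i => decide (i = k.val)) ++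
    List.replicate n false ++ [y]

/-- The chain of thought on the uninformative prompt. -/
def blankCot (n : ℕ) : List Bool := List.replicate (4 * n + 1) false

theorem cot_eq_of_emit (f : Thinker) (n : ℕ) (x : List Bool) (g : ℕ → Bool) (y : Bool)
    (h₁ : ∀ t < 2 * n, emit f x t = false) (h₂ : ∀ k < n, emit f x (2 * n + k) = g k)
    (h₃ : ∀ t, 3 * n ≤ t → t < 4 * n → emit f x t = false) (h₄ : emit f x (4 * n) = y) :
    cot f (4 * n + 1) x = List.replicate (2 * n) false ++ (List.range n).map g ++
      List.replicate n false ++ [y] := by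
  have hc : cot f (4 * n + 1) x = (List.range (4 * n + 1)).map (emit f x) := by
    unfold cot
    simp only [e2e_succ]
  rw [hc, List.range_succ, List.map_append, List.map_singleton, h₄,
    show 4 * n = 2 * n + n + n by omega, List.range_add, List.range_add, List.map_append,
    List.map_append, List.map_map, List.map_map]
  congr 2
  · congr 1
    · rw [List.eq_replicate_iff]
      refine ⟨by simp, fun b hb => ?_⟩
      obtain ⟨t, ht, rfl⟩ := List.mem_map.1 hb
      exact h₁ t (List.mem_range.1 ht)
    · exact List.map_congr_left fun k hk => h₂ k (List.mem_range.1 hk)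
  · rw [List.eq_replicate_iff]
    refine ⟨by simp, fun b hb => ?_⟩
    obtain ⟨t, ht, rfl⟩ := List.mem_map.1 hb
    have := List.mem_range.1 ht
    exact h₃ (2 * n + n + t) (by omega) (by omega)

section thinkers

variable {n N d : ℕ} [NeZero n] {S : List ℕ} (hS : ∀ u ∈ S, u < N) (hN : 0 < N)
  (al : Fin n → ℕ → Bool) (rej : Fin n → Bool) (x : ℕ → Bool)
  (hd : 21 * n + 5 * n * (S.length * N + 1) ≤ d)

include hS hN hd

/-- The term `a₀` is evaluated in the step `k` with `k - v = a₀`, so the single one appears at `a₀ +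
v`. -/
theorem cot_prompt (a₀ : Fin n) (ha₀ : ∀ a, (∀ j < S.length, x (S.getD j 0) = al a j) ↔ a = a₀)
    (v : Fin n) :
    cot (linThinker (weightVector d (weight n (S.length * N + 1) (S.length + 1) d
      (mismatch N al x) rej v))) (4 * n + 1) (prompt n N S) =
      pointingCot n (a₀ + v) (!rej a₀) := by
  have hn := NeZero.pos n
  have h := autoregressive_linThinker d (weight n (S.length * N + 1) (S.length + 1) d
      (mismatch N al x) rej v) (prompt n N S)
  simp only [prompt, List.reverse_reverse] at h
  have hW := wellPlaced_prompt (n := n) (d := d) hS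
  have h0 : (fun p => (reversedPrompt n N S).getD p false) (9 * n + 5 * n * 0) = true := by
    simp only [getD_reversedPrompt_slot hn]; rfl
  have hB : 0 < S.length * N + 1 := Nat.succ_pos _
  have hL : 1 ≤ S.length + 1 := by omega
  refine cot_eq_of_emit _ n _ _ _ (hW.early h hd hL hB h0) (fun k hk => ?_)
    (fun t => hW.gap h hd hL hB h0) ?_
  · rw [prompt, hW.term h hd hL hB h0 hk, termValue_prompt hS hN, decide_eq_decide, ha₀, termAt,
      sub_eq_iff_eq_add, ← Fin.val_inj, Fin.val_ofNat, Nat.mod_eq_of_lt hk]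
  · rw [prompt, hW.output h hd hL hB h0, outputValue_prompt hS hN al rej x a₀ ha₀]

end thinkers

/-- Only the leading slot is lit. Without the marker nothing compensates its negative weight, so
every term and the output are false, for every `v`. -/
theorem cot_blankPrompt {n d B L : ℕ} [NeZero n] (mis : Fin n → ℕ → Bool) (rej : Fin n → Bool)
    (hd : 21 * n + 5 * n * B ≤ d) (hL : 1 ≤ L) (hB : 0 < B) (v : Fin n) :
    cot (linThinker (weightVector d (weight n B L d mis rej v))) (4 * n + 1) (blankPrompt n) =
      blankCot n := by
  have hn := NeZero.pos n
  have h := autoregressive_linThinker d (weight n B L d mis rej v) (blankPrompt n)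
  simp only [getD_blankPrompt] at h
  have hW : WellPlaced n B d fun p => decide (p = 9 * n) := by
    intro p _ hp
    exact .inr ⟨0, hB, by simpa using hp⟩
  have h0 : (fun p => decide (p = 9 * n)) (9 * n + 5 * n * 0) = true := by simp
  have hsum : ∀ c : ℕ → ℤ, (∑ m ∈ Finset.range B,
      if (decide (9 * n + 5 * n * m = 9 * n)) = true then c m else 0) = c 0 := by
    intro c
    rw [Finset.sum_eq_single_of_mem 0 (Finset.mem_range.2 hB)]
    · simp
    · intro m _ hm
      have : ¬ (9 * n + 5 * n * m = 9 * n) := by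
        have : 0 < 5 * n * m := Nat.mul_pos (by omega) (Nat.pos_of_ne_zero hm)
        omega
      simp only [this, decide_false, Bool.false_eq_true, if_false]
  have hz : decide (0 = 9 * n) = false := by simp; omega
  have hterm : ∀ a, termValue n B L mis (fun p => decide (p = 9 * n)) a = false := by
    intro a
    rw [termValue, decide_eq_false_iff_not, hsum fun m => if mis a m then -(L + 2 : ℤ) else -(L + 1)]
    simp only [hz, Bool.false_eq_true, if_false]
    split_ifs <;> omega
  have hcot := cot_eq_of_emit _ n _ (fun _ => false) false (hW.early h hd hL hB h0)
    (fun k hk => by rw [hW.term h hd hL hB h0 hk, hterm]) (fun t => hW.gap h hd hL hB h0) (by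
      rw [hW.output h hd hL hB h0, outputValue, decide_eq_false_iff_not, hsum fun _ => -1]
      simp only [hterm]
      simp [hn.ne'])
  rw [hcot, blankCot, show (List.range n).map (fun _ => false) = List.replicate n false by simp,
    ← List.replicate_add, ← List.replicate_add, ← List.replicate_succ', show 2 * n + n + n + 1 = 4 * n + 1 by omega]

/-! ### Expectations -/

section expectation

open scoped ENNReal

variable {α β γ : Type}

/-- Expectation of a function with values in `[0, ∞]`. -/
noncomputable def Ex (p : PMF α) (φ : α → ℝ≥0∞) : ℝ≥0∞ := ∑' a, p a * φ a

open Classical in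
/-- Indicator function of an event. -/
noncomputable def ind (E : α → Prop) (a : α) : ℝ≥0∞ := if E a then 1 else 0

theorem ind_le_one (E : α → Prop) (a : α) : ind E a ≤ 1 := by
  unfold ind; split_ifs <;> simp

theorem ind_le_ind {E : α → Prop} {F : β → Prop} {a : α} {b : β} (h : E a → F b) :
    ind E a ≤ ind F b := by
  unfold ind
  by_cases ha : E a
  · simp [ha, h ha]
  · simp [ha]

theorem ind_of_true {E : α → Prop} {a : α} (h : E a) : ind E a = 1 := if_pos h

theorem ind_of_false {E : α → Prop} {a : α} (h : ¬ E a) : ind E a = 0 := if_neg h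

theorem ind_add_not (E : α → Prop) (a : α) : ind E a + ind (fun a => ¬ E a) a = 1 := by
  by_cases h : E a <;> simp [ind, h]

theorem Ex_ind (p : PMF α) (E : α → Prop) : Ex p (ind E) = p.toOuterMeasure {a | E a} := by
  rw [PMF.toOuterMeasure_apply, Ex]
  refine tsum_congr fun a => ?_
  by_cases h : E a <;> simp [ind, h]

theorem Pr_eq (p : PMF α) (E : α → Prop) : Pr p E = (Ex p (ind E)).toReal := by
  rw [Ex_ind, Pr]

theorem Ex_pure (a : α) (φ : α → ℝ≥0∞) : Ex (PMF.pure a) φ = φ a := by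
  classical
  rw [Ex, tsum_eq_single a fun b hb => by simp [PMF.pure_apply, hb]]
  simp

theorem Ex_bind (p : PMF α) (f : α → PMF β) (φ : β → ℝ≥0∞) :
    Ex (p.bind f) φ = Ex p fun a => Ex (f a) φ := by
  simp only [Ex, PMF.bind_apply, ← ENNReal.tsum_mul_right, ← ENNReal.tsum_mul_left]
  rw [ENNReal.tsum_comm]
  simp only [mul_assoc]

theorem Ex_map (p : PMF α) (f : α → β) (φ : β → ℝ≥0∞) :
    Ex (p.map f) φ = Ex p fun a => φ (f a) := by
  rw [PMF.map, Ex_bind]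
  simp only [Function.comp_apply, Ex_pure]

theorem Ex_comm (p : PMF α) (q : PMF β) (φ : α → β → ℝ≥0∞) :
    (Ex p fun a => Ex q fun b => φ a b) = Ex q fun b => Ex p fun a => φ a b := by
  simp only [Ex, ← ENNReal.tsum_mul_left]
  rw [ENNReal.tsum_comm]
  exact tsum_congr fun b => tsum_congr fun a => mul_left_comm _ _ _

theorem Ex_mono_support {p : PMF α} {φ ψ : α → ℝ≥0∞} (h : ∀ a ∈ p.support, φ a ≤ ψ a) :
    Ex p φ ≤ Ex p ψ := by
  refine ENNReal.tsum_le_tsum fun a => ?_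
  by_cases ha : p a = 0
  · simp [ha]
  · exact mul_le_mul_right (h a ((PMF.mem_support_iff _ _).2 ha)) _

theorem Ex_mono {p : PMF α} {φ ψ : α → ℝ≥0∞} (h : ∀ a, φ a ≤ ψ a) : Ex p φ ≤ Ex p ψ :=
  Ex_mono_support fun a _ => h a

theorem Ex_congr_support {p : PMF α} {φ ψ : α → ℝ≥0∞} (h : ∀ a ∈ p.support, φ a = ψ a) :
    Ex p φ = Ex p ψ :=
  le_antisymm (Ex_mono_support fun a ha => (h a ha).le) (Ex_mono_support fun a ha => (h a ha).ge)

theorem Ex_add (p : PMF α) (φ ψ : α → ℝ≥0∞) : (Ex p fun a => φ a + ψ a) = Ex p φ + Ex p ψ := by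
  simp only [Ex, mul_add, ENNReal.tsum_add]

theorem Ex_mul_right (p : PMF α) (φ : α → ℝ≥0∞) (c : ℝ≥0∞) :
    (Ex p fun a => φ a * c) = Ex p φ * c := by
  simp only [Ex, ← mul_assoc, ENNReal.tsum_mul_right]

theorem Ex_const (p : PMF α) (c : ℝ≥0∞) : (Ex p fun _ => c) = c := by
  rw [Ex, ENNReal.tsum_mul_right, PMF.tsum_coe, one_mul]

theorem Ex_finsetSum {ι : Type} (p : PMF α) (s : Finset ι) (φ : ι → α → ℝ≥0∞) :
    (Ex p fun a => ∑ i ∈ s, φ i a) = ∑ i ∈ s, Ex p (φ i) := by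
  classical
  induction s using Finset.induction_on with
  | empty => simp [Ex]
  | insert i s hi ih => simp only [Finset.sum_insert hi, Ex_add, ih]

theorem Ex_le {p : PMF α} {φ : α → ℝ≥0∞} {c : ℝ≥0∞} (h : ∀ a ∈ p.support, φ a ≤ c) :
    Ex p φ ≤ c := (Ex_mono_support h).trans_eq (Ex_const p c)

theorem le_Ex {p : PMF α} {φ : α → ℝ≥0∞} {c : ℝ≥0∞} (h : ∀ a ∈ p.support, c ≤ φ a) :
    c ≤ Ex p φ := (Ex_const p c).symm.trans_le (Ex_mono_support h)

theorem Ex_ind_le_one (p : PMF α) (E : α → Prop) : Ex p (ind E) ≤ 1 :=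
  Ex_le fun a _ => ind_le_one E a

theorem Ex_ind_ne_top (p : PMF α) (E : α → Prop) : Ex p (ind E) ≠ ∞ :=
  ne_top_of_le_ne_top ENNReal.one_ne_top (Ex_ind_le_one p E)

theorem Ex_ind_add_not (p : PMF α) (E : α → Prop) :
    Ex p (ind E) + Ex p (ind fun a => ¬ E a) = 1 := by
  rw [← Ex_add]
  simp only [ind_add_not, Ex_const]

theorem Ex_ind_eq_one_sub (p : PMF α) (E : α → Prop) :
    Ex p (ind E) = 1 - Ex p (ind fun a => ¬ E a) :=
  ENNReal.eq_sub_of_add_eq (Ex_ind_ne_top _ _) (Ex_ind_add_not p E)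

theorem Ex_ind_not_eq_one_sub (p : PMF α) (E : α → Prop) :
    Ex p (ind fun a => ¬ E a) = 1 - Ex p (ind E) :=
  ENNReal.eq_sub_of_add_eq (Ex_ind_ne_top _ _) (by rw [add_comm, Ex_ind_add_not])

theorem Ex_uniform_equiv [Fintype α] [Nonempty α] [Fintype β] [Nonempty β] (e : α ≃ β)
    (φ : β → ℝ≥0∞) :
    (Ex (PMF.uniformOfFintype α) fun a => φ (e a)) = Ex (PMF.uniformOfFintype β) φ := by
  simp only [Ex, PMF.uniformOfFintype_apply, Fintype.card_congr e]
  exact e.tsum_eq fun b => ((Fintype.card β : ℝ≥0∞)⁻¹ * φ b)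

theorem PMF_ext_Ex {p q : PMF α} (h : ∀ φ, Ex p φ = Ex q φ) : p = q := by
  classical
  ext a
  have := h fun b => if b = a then 1 else 0
  simpa [Ex] using this

/-! ### Independent draws -/

theorem Ex_indep_cons (p : PMF α) (ps : List (PMF α)) (φ : List α → ℝ≥0∞) :
    Ex (indep (p :: ps)) φ = Ex p fun a => Ex (indep ps) fun l => φ (a :: l) := by
  rw [indep, Ex_bind]
  simp only [Ex_map]

theorem Ex_iid_zero (p : PMF α) (φ : List α → ℝ≥0∞) : Ex (iid p 0) φ = φ [] := by
  rw [iid, List.replicate_zero, indep, Ex_pure]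

theorem Ex_iid_succ (p : PMF α) (n : ℕ) (φ : List α → ℝ≥0∞) :
    Ex (iid p (n + 1)) φ = Ex p fun a => Ex (iid p n) fun l => φ (a :: l) := by
  rw [iid, List.replicate_succ, Ex_indep_cons, iid]

theorem Ex_iid_add (p : PMF α) (m n : ℕ) (φ : List α → ℝ≥0∞) :
    Ex (iid p (m + n)) φ = Ex (iid p m) fun u => Ex (iid p n) fun v => φ (u ++ v) := by
  induction m generalizing φ with
  | zero => simp [Ex_iid_zero]
  | succ m ih =>
    rw [Nat.succ_add, Ex_iid_succ, Ex_iid_succ]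
    simp only [ih, List.cons_append]

theorem Ex_iid_map (p : PMF α) (f : α → β) (n : ℕ) (φ : List β → ℝ≥0∞) :
    Ex (iid (p.map f) n) φ = Ex (iid p n) fun l => φ (l.map f) := by
  induction n generalizing φ with
  | zero => simp [Ex_iid_zero]
  | succ n ih => simp only [Ex_iid_succ, Ex_map, ih, List.map_cons]

theorem mem_support_indep {ps : List (PMF α)} {l : List α} (h : l ∈ (indep ps).support) :
    l.length = ps.length ∧ ∀ a ∈ l, ∃ p ∈ ps, a ∈ p.support := by
  induction ps generalizing l with
  | nil => rw [indep, PMF.support_pure] at h; simp [Set.mem_singleton_iff.1 h]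
  | cons p ps ih =>
    rw [indep, PMF.mem_support_bind_iff] at h
    obtain ⟨a, ha, h⟩ := h
    obtain ⟨m, hm, rfl⟩ := (PMF.mem_support_map_iff _ _ _).1 h
    obtain ⟨h1, h2⟩ := ih hm
    refine ⟨by simp [h1], fun b hb => ?_⟩
    rcases List.mem_cons.1 hb with rfl | hb
    · exact ⟨p, by simp, ha⟩
    · obtain ⟨p', hp', hb'⟩ := h2 b hb
      exact ⟨p', by simp [hp'], hb'⟩

theorem mem_support_iid {p : PMF α} {n : ℕ} {l : List α} (h : l ∈ (iid p n).support) :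
    l.length = n ∧ ∀ a ∈ l, a ∈ p.support := by
  obtain ⟨h1, h2⟩ := mem_support_indep h
  refine ⟨by simpa using h1, fun a ha => ?_⟩
  obtain ⟨p', hp', h⟩ := h2 a ha
  rwa [List.eq_of_mem_replicate hp'] at h

/-- Allows one long list of challenge items to serve as independent trials, and within a trial as
independent batches and examples. -/
theorem Ex_iid_chunks (p : PMF α) (c n : ℕ) (φ : List (List α) → ℝ≥0∞) :
    (Ex (iid p (n * c)) fun l => φ (chunks c n l)) = Ex (iid (iid p c) n) φ := by
  induction n generalizing φ with
  | zero => simp [Ex_iid_zero, chunks]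
  | succ n ih =>
    rw [show (n + 1) * c = c + n * c by ring, Ex_iid_add, Ex_iid_succ]
    refine Ex_congr_support fun u hu => ?_
    rw [← ih]
    refine Ex_congr_support fun v _ => ?_
    have hu' := (mem_support_iid hu).1
    rw [chunks, List.take_left' hu', List.drop_left' hu']

theorem Ex_iid_prod (p : PMF α) (φ : α → ℝ≥0∞) (n : ℕ) :
    (Ex (iid p n) fun l => (l.map φ).prod) = Ex p φ ^ n := by
  induction n with
  | zero => simp [Ex_iid_zero]
  | succ n ih =>
    simp only [Ex_iid_succ, List.map_cons, List.prod_cons, pow_succ']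
    rw [← ih, ← Ex_mul_right]
    congr 1
    funext a
    rw [mul_comm, ← Ex_mul_right]
    simp only [mul_comm]

theorem ind_forall_mem (E : α → Prop) (l : List α) :
    ind (fun l : List α => ∀ a ∈ l, E a) l = (l.map (ind E)).prod := by
  induction l with
  | nil => simp [ind]
  | cons a l ih =>
    rw [List.map_cons, List.prod_cons, ← ih]
    by_cases h : E a
    · rw [ind_of_true h, one_mul]
      exact le_antisymm (ind_le_ind fun h' b hb => h' b (List.mem_cons_of_mem _ hb))
        (ind_le_ind fun h' => List.forall_mem_cons.2 ⟨h, h'⟩)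
    · rw [ind_of_false h, zero_mul, ind_of_false fun h' => h (h' a List.mem_cons_self)]

theorem Ex_iid_forall (p : PMF α) (E : α → Prop) (n : ℕ) :
    Ex (iid p n) (ind fun l => ∀ a ∈ l, E a) = Ex p (ind E) ^ n := by
  rw [← Ex_iid_prod]
  exact Ex_congr_support fun l _ => ind_forall_mem E l

/-- Replacing the law of each of `n` independent draws by a law with at least nearly the same
expectations. -/
theorem Ex_iid_le_add {p p' : PMF α} {β : ℝ≥0∞}
    (h : ∀ φ : α → ℝ≥0∞, (∀ a, φ a ≤ 1) → Ex p φ ≤ Ex p' φ + β) (n : ℕ) (φ : List α → ℝ≥0∞)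
    (hφ : ∀ l, φ l ≤ 1) : Ex (iid p n) φ ≤ Ex (iid p' n) φ + n * β := by
  induction n generalizing φ with
  | zero => simp [Ex_iid_zero]
  | succ n ih =>
    rw [Ex_iid_succ, Ex_iid_succ]
    calc (Ex p fun a => Ex (iid p n) fun l => φ (a :: l))
        ≤ Ex p fun a => (Ex (iid p' n) fun l => φ (a :: l)) + n * β :=
          Ex_mono fun a => ih _ fun l => hφ _
      _ = (Ex p fun a => Ex (iid p' n) fun l => φ (a :: l)) + n * β := by
          rw [Ex_add, Ex_const]
      _ ≤ (Ex p' fun a => Ex (iid p' n) fun l => φ (a :: l)) + β + n * β :=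
          add_le_add_left (h _ fun a => Ex_le fun l _ => hφ _) _
      _ = _ := by push_cast; ring

/-- A lower bound that holds for every list of hidden parameters also holds on average. -/
theorem le_Ex_iid_bind {V : Type} (p : PMF V) (B : V → PMF α) (t : ℝ≥0∞) (n : ℕ)
    (φ : List α → ℝ≥0∞)
    (h : ∀ v : List V, v.length = n → t ≤ Ex (indep (v.map B)) φ) :
    t ≤ Ex (iid (p.bind B) n) φ := by
  induction n generalizing φ with
  | zero =>
    have := h [] rfl
    rw [List.map_nil, indep, Ex_pure] at this
    rwa [Ex_iid_zero]
  | succ n ih =>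
    rw [Ex_iid_succ, Ex_bind]
    refine le_Ex fun v _ => ?_
    rw [Ex_comm]
    refine ih _ fun vs hvs => ?_
    rw [← Ex_comm, ← Ex_indep_cons]
    exact h (v :: vs) (by simp [hvs])

end expectation

/-! ### The number of linear thresholds -/

section counting

/-- The window of a string, read from its end. -/
def window (d : ℕ) (z : List Bool) : Fin d → Bool := fun i => z.reverse.getD i false

/-- The thinker that accepts the strings whose window belongs to `G`. -/
def setThinker {d : ℕ} (G : Finset (Fin d → Bool)) : Thinker := fun z => decide (window d z ∈ G)

open Classical in
/-- The windows accepted by a linear threshold. -/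
noncomputable def halfspace {d : ℕ} (w : Fin d → ℝ) : Finset (Fin d → Bool) :=
  Finset.univ.filter fun b => 0 ≤ ∑ i : Fin d, if b i then w i.rev else 0

theorem setThinker_halfspace {d : ℕ} (w : Fin d → ℝ) : setThinker (halfspace w) = linThinker w := by
  funext z
  simp [setThinker, halfspace, linThinker, window]

open Classical in
/-- The homogeneous halfspaces of the discrete cube. -/
noncomputable def halfspaces (d : ℕ) : Finset (Finset (Fin d → Bool)) :=
  Finset.univ.filter fun G => ∃ w : Fin d → ℝ, halfspace w = G

theorem halfspace_mem (d : ℕ) (w : Fin d → ℝ) : halfspace w ∈ halfspaces d := by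
  simp [halfspaces]

/-- More than `d` points have a nontrivial linear dependence. A halfspace that accepts exactly the
points with nonnegative coefficient shows that no coefficient is negative; applied to the negated
dependence as well, this makes all of them vanish. -/
theorem vcDim_halfspaces (d : ℕ) : (halfspaces d).vcDim ≤ d := by
  classical
  refine Finset.sup_le fun s hs => ?_
  have hs := Finset.mem_shatterer.1 hs
  by_contra hcard
  let v : s → Fin d → ℝ := fun b i => if b.1 i then 1 else 0
  have hdep : ¬ LinearIndependent ℝ v := fun h => by
    have := h.fintype_card_le_finrank
    simp at this
    omega
  obtain ⟨c, hc, i₀, hi₀⟩ := Fintype.not_linearIndependent_iff.1 hdep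
  have key : ∀ c : s → ℝ, ∑ b, c b • v b = 0 → ∀ b, 0 ≤ c b := by
    intro c hc b₀
    by_contra hneg
    obtain ⟨G, hG, hGs⟩ := hs (t := s.filter fun b => ∃ h : b ∈ s, 0 ≤ c ⟨b, h⟩)
      (Finset.filter_subset _ _)
    obtain ⟨w, rfl⟩ := (Finset.mem_filter.1 hG).2
    have hw : ∀ b : s, 0 ≤ c b ↔ 0 ≤ ∑ i : Fin d, v b i * w i.rev := by
      intro b
      have h1 : b.1 ∈ s ∩ halfspace w ↔ 0 ≤ c b := by
        rw [hGs]; simp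
      rw [← h1]
      simp [halfspace, v]
    have hsum : ∑ b, c b * ∑ i : Fin d, v b i * w i.rev = 0 := by
      have : ∀ i, ∑ b, c b * v b i = 0 := fun i => by
        simpa using congrFun hc i
      simp only [Finset.mul_sum]
      rw [Finset.sum_comm]
      simp only [← mul_assoc, ← Finset.sum_mul, this, zero_mul, Finset.sum_const_zero]
    have hnn : ∀ b ∈ Finset.univ, 0 ≤ c b * ∑ i : Fin d, v b i * w i.rev := by
      intro b _
      by_cases hb : 0 ≤ c b
      · exact mul_nonneg hb ((hw b).1 hb)
      · exact mul_nonneg_of_nonpos_of_nonpos (le_of_not_ge hb)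
          (le_of_not_ge fun h => hb ((hw b).2 h))
    -- The nonnegative terms add up to zero, so the term of `b₀` is zero, although both of its
    -- factors are strictly negative.
    have h0 := (Finset.sum_eq_zero_iff_of_nonneg hnn).1 hsum b₀ (Finset.mem_univ _)
    have h1 : ¬ 0 ≤ ∑ i : Fin d, v b₀ i * w i.rev := fun h => hneg ((hw b₀).2 h)
    rcases mul_eq_zero.1 h0 with h | h
    · exact hneg h.ge
    · exact h1 h.ge
  have h1 := key c hc i₀
  have h2 := key (fun b => -c b)
    (by simp only [neg_smul, Finset.sum_neg_distrib, hc, neg_zero]) i₀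
  exact hi₀ (le_antisymm (by linarith) h1)

theorem sum_choose_le (m d : ℕ) : ∑ k ∈ Finset.Iic d, m.choose k ≤ (m + 1) ^ d := by
  rw [add_pow]
  have : Finset.Iic d = Finset.range (d + 1) := by ext; simp
  rw [this]
  refine Finset.sum_le_sum fun k hk => ?_
  rw [one_pow, mul_one]
  exact (Nat.choose_le_pow m k).trans
    (Nat.le_mul_of_pos_right _ (Nat.choose_pos (Nat.lt_succ_iff.1 (Finset.mem_range.1 hk))))

/-- The Sauer–Shelah lemma on the `2 ^ d` points of the cube. -/
theorem card_halfspaces_le (d : ℕ) : (halfspaces d).card ≤ (2 ^ d + 1) ^ d := by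
  classical
  have h1 := (halfspaces d).card_le_card_shatterer.trans
    (Finset.card_shatterer_le_sum_vcDim (𝒜 := halfspaces d))
  have h2 : Fintype.card (Fin d → Bool) = 2 ^ d := by simp
  rw [h2] at h1
  refine (h1.trans (Finset.sum_le_sum_of_subset ?_)).trans (sum_choose_le (2 ^ d) d)
  exact Finset.Iic_subset_Iic.2 (vcDim_halfspaces d)

end counting

/-! ### Learning from end-to-end labels -/

open scoped ENNReal

/-- A consistent hypothesis for a labelled sample. -/
noncomputable def consistentLearner (d T : ℕ) (S : List (List Bool × Bool)) : List Bool → Bool :=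
  open Classical in
  if h : ∃ w : Fin d → ℝ, ∀ z ∈ S, e2e (linThinker w) T z.1 = z.2 then
    e2e (linThinker h.choose) T
  else fun _ => false

theorem consistentLearner_eq (d T : ℕ) (w : Fin d → ℝ) (xs : List (List Bool)) :
    ∃ G ∈ halfspaces d,
      consistentLearner d T (xs.map fun x => (x, e2e (linThinker w) T x)) =
        e2e (setThinker G) T ∧
      ∀ x ∈ xs, e2e (setThinker G) T x = e2e (linThinker w) T x := by
  have h : ∃ w' : Fin d → ℝ, ∀ z ∈ xs.map fun x => (x, e2e (linThinker w) T x),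
      e2e (linThinker w') T z.1 = z.2 := ⟨w, by simp⟩
  refine ⟨halfspace h.choose, halfspace_mem d _, ?_, fun x hx => ?_⟩
  · rw [setThinker_halfspace, consistentLearner, dif_pos h]
  · rw [setThinker_halfspace]
    exact h.choose_spec (x, e2e (linThinker w) T x) (List.mem_map.2 ⟨x, hx, rfl⟩)

/-- Union bound over the halfspaces whose end-to-end map has error above `ε`: each survives `n`
examples with probability at most `(1 - ε) ^ n`. The thinking length does not affect the number of
candidates. -/
theorem Pr_consistentLearner (d T n : ℕ) (ε : ℝ) (hε : 0 < ε) (hε1 : ε < 1) (D : PMF (List Bool))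
    (w : Fin d → ℝ) :
    1 - ((2 ^ d + 1) ^ d : ℕ) * (1 - ε) ^ n ≤
      Pr ((iid D n).map fun xs => xs.map fun x => (x, e2e (linThinker w) T x))
        (fun S => Pr D (fun x => consistentLearner d T S x ≠ e2e (linThinker w) T x) ≤ ε) := by
  set h := e2e (linThinker w) T with hh
  set B : Finset (Finset (Fin d → Bool)) := open Classical in (halfspaces d).filter fun G =>
    ε < Pr D fun x => e2e (setThinker G) T x ≠ h x with hB
  have hterm : ∀ G ∈ B, Ex (iid D n) (ind fun xs => ∀ x ∈ xs, e2e (setThinker G) T x = h x) ≤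
      ENNReal.ofReal ((1 - ε) ^ n) := by
    intro G hG
    have h1 := (Finset.mem_filter.1 hG).2
    rw [Pr_eq] at h1
    rw [Ex_iid_forall, ENNReal.ofReal_pow (by linarith)]
    refine pow_le_pow_left' ?_ n
    rw [Ex_ind_eq_one_sub, ENNReal.ofReal_sub _ hε.le, ENNReal.ofReal_one]
    refine tsub_le_tsub_left ?_ _
    rw [ENNReal.ofReal_le_iff_le_toReal (Ex_ind_ne_top _ _)]
    exact h1.le
  have hbad : Ex (iid D n) (ind fun xs => ¬ Pr D (fun x => consistentLearner d T
      (xs.map fun x => (x, h x)) x ≠ h x) ≤ ε) ≤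
      ENNReal.ofReal (((2 ^ d + 1) ^ d : ℕ) * (1 - ε) ^ n) := by
    calc _ ≤ Ex (iid D n) fun xs => ∑ G ∈ B, ind (fun xs => ∀ x ∈ xs,
          e2e (setThinker G) T x = h x) xs := by
          refine Ex_mono fun xs => ?_
          obtain ⟨G, hG, hG1, hG2⟩ := consistentLearner_eq d T w xs
          unfold ind
          split_ifs with hc
          · rw [← hh] at hG1
            rw [hG1] at hc
            have hGB : G ∈ B := Finset.mem_filter.2 ⟨hG, not_le.1 hc⟩
            refine le_trans ?_ (Finset.single_le_sum (fun _ _ => zero_le) hGB)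
            rw [if_pos hG2]
          · exact zero_le
      _ = ∑ G ∈ B, Ex (iid D n) (ind fun xs => ∀ x ∈ xs, e2e (setThinker G) T x = h x) :=
          Ex_finsetSum _ _ _
      _ ≤ ∑ _G ∈ B, ENNReal.ofReal ((1 - ε) ^ n) := Finset.sum_le_sum hterm
      _ ≤ _ := by
          rw [Finset.sum_const, nsmul_eq_mul, ENNReal.ofReal_mul (by positivity),
            ENNReal.ofReal_natCast]
          gcongr
          exact (Finset.card_filter_le _ _).trans (card_halfspaces_le d)
  have hnn : 0 ≤ (((2 ^ d + 1) ^ d : ℕ) : ℝ) * (1 - ε) ^ n :=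
    mul_nonneg (Nat.cast_nonneg _) (pow_nonneg (by linarith) n)
  rw [Pr_eq, Ex_map]
  change _ ≤ (Ex (iid D n) (ind fun xs => Pr D (fun x => consistentLearner d T
      (xs.map fun x => (x, h x)) x ≠ h x) ≤ ε)).toReal
  rw [Ex_ind_eq_one_sub, ENNReal.toReal_sub_of_le (Ex_ind_le_one _ _) ENNReal.one_ne_top,
    ENNReal.toReal_one]
  have := ENNReal.toReal_mono ENNReal.ofReal_ne_top hbad
  rw [ENNReal.toReal_ofReal hnn] at this
  linarith

/-- The constant `2` comes from `(2 ^ d + 1) ^ d ≤ 2 ^ (2 d ^ 2) ≤ exp (2 d ^ 2)`, which is compared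
with `(1 - ε) ^ n ≤ exp (-ε n)`. -/
theorem learnableFromLabels (d T : ℕ) (hd : 1 ≤ d) :
    LearnableFromLabels d T fun ε η => 2 * ((d : ℝ) ^ 2 + Real.log (1 / η)) / ε := by
  refine ⟨consistentLearner d T, fun ε η hε hε1 hη hη1 n hn D w _ => le_trans ?_
    (Pr_consistentLearner d T n ε hε hε1 D w)⟩
  have hn' : 2 * ((d : ℝ) ^ 2 + Real.log (1 / η)) ≤ ε * n := by
    rwa [div_le_iff₀ hε, mul_comm (n : ℝ)] at hn
  have hlog : 0 ≤ Real.log (1 / η) := Real.log_nonneg (by rw [le_div_iff₀ hη]; linarith)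
  have hcard : (((2 ^ d + 1) ^ d : ℕ) : ℝ) ≤ Real.exp (2 * (d : ℝ) ^ 2) := by
    have h1 : (2 ^ d + 1) ^ d ≤ 2 ^ (2 * d ^ 2) := by
      calc (2 ^ d + 1) ^ d ≤ (2 ^ (2 * d)) ^ d := by
            refine Nat.pow_le_pow_left ?_ d
            have : 2 ^ d + 1 ≤ 2 ^ (d + 1) := by
              rw [pow_succ]; have := Nat.one_le_two_pow (n := d); omega
            exact this.trans (Nat.pow_le_pow_right (by norm_num) (by omega))
        _ = _ := by rw [← pow_mul]; congr 1; ring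
    calc (((2 ^ d + 1) ^ d : ℕ) : ℝ) ≤ ((2 ^ (2 * d ^ 2) : ℕ) : ℝ) := Nat.cast_le.2 h1
      _ = (2 : ℝ) ^ (2 * d ^ 2) := by push_cast; rfl
      _ ≤ (Real.exp 1) ^ (2 * d ^ 2) := by
          gcongr
          have := Real.add_one_le_exp (1 : ℝ)
          linarith
      _ = _ := by rw [← Real.exp_nat_mul]; push_cast; ring_nf
  have hpow : (1 - ε) ^ n ≤ Real.exp (-(ε * n)) := by
    calc (1 - ε) ^ n ≤ (Real.exp (-ε)) ^ n :=
          pow_le_pow_left₀ (by linarith) (Real.one_sub_le_exp_neg ε) n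
      _ = _ := by rw [← Real.exp_nat_mul]; ring_nf
  have : (((2 ^ d + 1) ^ d : ℕ) : ℝ) * (1 - ε) ^ n ≤ η := by
    calc _ ≤ Real.exp (2 * (d : ℝ) ^ 2) * Real.exp (-(ε * n)) :=
          mul_le_mul hcard hpow (pow_nonneg (by linarith) n) (Real.exp_pos _).le
      _ = Real.exp (2 * (d : ℝ) ^ 2 - ε * n) := by rw [← Real.exp_add]; ring_nf
      _ ≤ Real.exp (Real.log η) := by
          refine Real.exp_le_exp.2 ?_
          rw [one_div, Real.log_inv] at hn' hlog
          linarith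
      _ = η := Real.exp_log hη
  linarith

/-! ### The distinguisher -/

/-- A hyperedge with its label and a coin. -/
abbrev Item : Type := List ℕ × Bool × Bool

/-- Encoding of items. -/
def encItem : Item → Data := encPair (encList encNat) (encPair encBool encBool)

/-- Enumeration of the assignments to `K` bits. -/
noncomputable def assignmentEquiv (K : ℕ) : (Fin K → Bool) ≃ Fin (2 ^ K) :=
  Fintype.equivFinOfCardEq (by simp)

/-- The index of a list of `K` bits. -/
noncomputable def location (K : ℕ) (x : List Bool) : Fin (2 ^ K) :=
  assignmentEquiv K fun j => x.getD j false

/-- The output of a program, if it halts. -/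
noncomputable def result (p : Prog) (a : Data) : Data :=
  open Classical in if h : ∃ b, Outputs p a b then h.choose else .nil

theorem Outputs.result_eq {p : Prog} {a b : Data} (h : Outputs p a b) : result p a = b := by
  have h' : ∃ b, Outputs p a b := ⟨b, h⟩
  rw [result, dif_pos h']
  exact h'.choose_spec.unique h

/-- The parameters of the reduction: a learner, the number `K` of bits that a predicate reads, the
exponent of the accuracy `1 / (4 * N ^ (e + 1))`, and whether the number of thinkers is `2 ^ K`
(`uniform`) or the number of batches. -/
structure Reduction where
  L : Learner
  K : ℕ
  e : ℕ
  uniform : Bool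

namespace Reduction

variable (R : Reduction)

/-- Number of terms. -/
abbrev n : ℕ := 2 ^ R.K

/-- Thinking length. -/
def T : ℕ := 4 * R.n + 1

/-- Window size. -/
def d (N : ℕ) : ℕ := 21 * R.n + 5 * R.n * (R.K * N + 1) + N

/-- Inverse accuracy. -/
def k (N : ℕ) : ℕ := 4 * N ^ (R.e + 1)

/-- Number of thinkers for `q` batches. -/
def thinkers (q : ℕ) : ℕ := if R.uniform then R.n else q

/-- Number of coins of the learner. -/
def coinCount (N : ℕ) : ℕ := R.L.coinBound.eval (R.d N + R.k N)

/-- Items used for a batch of `M` examples with `b` control coins. -/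
def batchCost (M b : ℕ) : ℕ := R.K + M * (b + 1)

/-- Items used for a trial. -/
def trialCost (N q M b : ℕ) : ℕ := R.coinCount N + q * R.batchCost M b + N

/-- The example made from an item. -/
def slotExample (N : ℕ) (i : Fin R.n) (x : Bool × Item) : Example :=
  if x.1 then (prompt R.n N x.2.1, pointingCot R.n i x.2.2.1)
  else (blankPrompt R.n, blankCot R.n)

/-- A slot: its control coins all show one, and its first item. -/
def slot (l : List Item) : Bool × Item :=
  (l.tail.all fun x => x.2.2, l.headD ([], false, false))

/-- The simulated batch. -/
noncomputable def simulatedBatch (N M b : ℕ) (l : List Item) : List Example :=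
  (chunks (b + 1) M (l.drop R.K)).map fun m =>
    R.slotExample N (location R.K ((l.take R.K).map fun x => x.2.2)) (slot m)

/-- The simulated sample. -/
noncomputable def simulatedSample (N q M b : ℕ) (l : List Item) : BatchedSample :=
  (chunks (R.batchCost M b) q l).map (R.simulatedBatch N M b)

/-- The hypothesis returned by the learner. -/
noncomputable def hypothesis (N q : ℕ) (S : BatchedSample) (r : List Bool) : Data :=
  result R.L.train (encTrainInput (R.d N) (R.k N) R.T (R.thinkers q) S r)

/-- The prediction of a hypothesis. -/
noncomputable def prediction (hyp : Data) (x : List Bool) : Bool :=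
  open Classical in decide (result R.L.predict (encPredictInput hyp x) = encBool true)

/-- Whether all test items are predicted correctly. -/
noncomputable def test (N : ℕ) (hyp : Data) (l : List Item) : Bool :=
  l.all fun x => R.prediction hyp (prompt R.n N x.1) == x.2.1

/-- A trial of the learner on simulated data. -/
noncomputable def trial (N q M b : ℕ) (l : List Item) : Bool :=
  R.test N (R.hypothesis N q
    (R.simulatedSample N q M b (l.drop (R.coinCount N)))
    ((l.take (R.coinCount N)).map fun x => x.2.2))
    (l.drop (R.coinCount N + q * R.batchCost M b))

/-- The distinguisher: some trial with some parameters succeeds. -/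
noncomputable def accept (N₀ s N : ℕ) (l : List Item) : Bool :=
  !decide (0 < N₀ - N) &&
    (List.range (N ^ s + 1)).any fun q => (List.range (N ^ s)).any fun M =>
      (List.range N).any fun b =>
        !decide (0 < N * R.trialCost N q (M + 1) b - N ^ s) &&
          (chunks (R.trialCost N q (M + 1) b) N l).any (R.trial N q (M + 1) b)

end Reduction

/-! ### Polynomial-time computability of the distinguisher -/

section polyFun

variable {α β γ : Type} {D : ℕ → α → Prop} {eA : α → Data} {eB : β → Data} {eC : γ → Data}

theorem PolyFun.flatMap {l : α → List γ} {f : α → γ → List β}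
    (hl : PolyFun D eA (encList eC) l) (hlen : PolyBdd D fun a => (l a).length)
    (hf : PolyFun (fun N x => D N x.1 ∧ x.2 ∈ l x.1) (encPair eA eC) (encList eB)
      (fun x : α × γ => f x.1 x.2))
    (hflen : PolyBdd (fun N (x : α × γ) => D N x.1 ∧ x.2 ∈ l x.1) fun x => (f x.1 x.2).length) :
    PolyFun D eA (encList eB) fun a => (l a).flatMap (f a) := by
  refine (PolyFun.foldl_simple (b₀ := fun _ => []) (l := fun a => (l a).reverse)
    (step := fun a m c => f a c ++ m) (PolyFun.const []) (hl.reverse hlen) (by simpa using hlen)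
    (PolyFun.append (hf.comp (f := fun x : α × List β × γ => (x.1, x.2.2))
      (PolyFun.left.pair PolyFun.right.snd)
      fun N x hx => ⟨hx.1, by simpa using hx.2⟩) PolyFun.right.fst
      (hflen.comp (fun x : α × List β × γ => (x.1, x.2.2))
      fun N x hx => ⟨hx.1, by simpa using hx.2⟩))).congr fun N a _ => ?_
  rw [List.foldl_reverse]
  induction l a with
  | nil => rfl
  | cons c l ih => rw [List.foldr_cons, ih, List.flatMap_cons]

/-- Lets the distinguisher call the programs of the learner as subroutines: `result` is a total
function, computable in polynomial time wherever the program halts in time. -/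
theorem PolyFun.result {p : Prog} {f : α → Data} (hf : PolyFun D eA (fun x => x) f) {t : α → ℕ}
    (ht : PolyBdd D t) (h : ∀ N a, D N a → ∃ y, HaltsWithin p (f a) y (t a)) :
    PolyFun D eA (fun x => x) fun a => CoTGap.result p (f a) := by
  obtain ⟨σ, hσ⟩ := ht
  refine PolyFun.comp (D' := fun N x => ∃ y, HaltsWithin p x y (σ.eval N)) ⟨p, σ, ?_⟩ hf
    fun N a ha => ?_
  · rintro N x ⟨y, hy⟩
    rwa [Outputs.result_eq hy.outputs]
  · obtain ⟨y, hy⟩ := h N a ha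
    exact ⟨y, hy.mono (hσ N a ha)⟩

theorem PolyFun.unitVector {N u : α → ℕ} (hN : PolyFun D eA encNat N) (hu : PolyFun D eA encNat u)
    (hNb : PolyBdd D N) (hub : PolyBdd D u) :
    PolyFun D eA encStr fun a => unitVector (N a) (u a) :=
  PolyFun.append (hu.replicate hub (PolyFun.const false))
    (PolyFun.cons (PolyFun.const true) (PolyFun.replicate (hN.sub hu.succ (hub.add (.const 1)))
      (hNb.mono fun _ _ _ => Nat.sub_le _ _) (PolyFun.const false))) (by simpa using hub)

theorem PolyFun.prompt (n : ℕ) {N : α → ℕ} {S : α → List ℕ} (hN : PolyFun D eA encNat N)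
    (hS : PolyFun D eA (encList encNat) S) (hNb : PolyBdd D N)
    (hSb : PolyBdd D fun a => (S a).length) (hlt : ∀ m a, D m a → ∀ u ∈ S a, u < N a) :
    PolyFun D eA encStr fun a => prompt n (N a) (S a) := by
  have hNb' : PolyBdd (fun m (x : α × ℕ) => D m x.1 ∧ x.2 ∈ S x.1) fun x => N x.1 :=
    hNb.comp _ fun _ _ h => h.1
  have hslot : PolyFun D eA encStr fun a => slotBits (N a) (S a) :=
    PolyFun.cons (PolyFun.const true) (PolyFun.flatMap hS hSb
      (PolyFun.unitVector (hN.lift fun _ _ h => h.1) PolyFun.right hNb'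
        (hNb'.mono fun m x h => (hlt m x.1 h.1 x.2 h.2).le))
      (hNb'.mono fun m x h => (length_unitVector (hlt m x.1 h.1 x.2 h.2)).le))
  have hslotb : PolyBdd D fun a => (slotBits (N a) (S a)).length :=
    ((hSb.mul hNb).add (.const 1)).mono fun m a h => (length_slotBits (hlt m a h)).le
  refine PolyFun.reverse (PolyFun.append (PolyFun.const _) (PolyFun.flatMap hslot hslotb
    (PolyFun.cons PolyFun.right (PolyFun.const _))
    ((PolyBdd.const (5 * n + 1)).mono fun m x h => ?_)) (PolyBdd.const _)) ?_
  · simp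
  · refine ((PolyBdd.const (9 * n + 1)).add (hslotb.mul (.const (5 * n + 1)))).mono fun m a _ => ?_
    rw [reversedPrompt, List.length_append]
    refine add_le_add (by simp) ?_
    rw [List.length_flatMap]
    refine (List.sum_le_card_nsmul _ (5 * n + 1) ?_).trans (by simp)
    intro x hx
    obtain ⟨b, _, rfl⟩ := List.mem_map.1 hx
    simp

end polyFun

/-! ### Chunks -/

theorem mem_chunks {β : Type} {c n : ℕ} {l m : List β} (h : m ∈ chunks c n l)
    (hl : n * c ≤ l.length) : m.length = c ∧ ∀ x ∈ m, x ∈ l := by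
  induction n generalizing l with
  | zero => simp [chunks] at h
  | succ n ih =>
    rw [Nat.succ_mul] at hl
    rcases List.mem_cons.1 h with rfl | h
    · exact ⟨by rw [List.length_take]; omega, fun x hx => List.mem_of_mem_take hx⟩
    · obtain ⟨h1, h2⟩ := ih h (by rw [List.length_drop]; omega)
      exact ⟨h1, fun x hx => List.mem_of_mem_drop (h2 x hx)⟩

namespace Reduction

variable (R : Reduction)

/-! ### Shape of the simulated sample -/

/-- Items whose first component is a list of `K` vertices below `N`. -/
def Valid (N : ℕ) (l : List Item) : Prop :=
  ∀ x ∈ l, x.1.length = R.K ∧ ∀ u ∈ x.1, u < N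

variable {R} in
theorem Valid.mono {N : ℕ} {l m : List Item} (hl : R.Valid N l) (h : ∀ x ∈ m, x ∈ l) :
    R.Valid N m := fun x hx => hl x (h x hx)

theorem n_pos : 0 < R.n := Nat.two_pow_pos _

theorem length_prompt_le {N : ℕ} {S : List ℕ} (h1 : S.length = R.K) (h2 : ∀ u ∈ S, u < N) :
    (prompt R.n N S).length ≤ R.d N := by
  rw [length_prompt R.n_pos h2, h1, Reduction.d]
  omega

theorem length_blankPrompt_le (N : ℕ) : (blankPrompt R.n).length ≤ R.d N := by
  have := R.n_pos
  rw [blankPrompt, List.length_cons, List.length_replicate, Reduction.d]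
  omega

theorem length_pointingCot {n : ℕ} (i : Fin n) (y : Bool) :
    (pointingCot n i y).length = 4 * n + 1 := by
  simp [pointingCot]; omega

theorem slotExample_bounds {N : ℕ} (i : Fin R.n) {x : Bool × Item} (h1 : x.2.1.length = R.K)
    (h2 : ∀ u ∈ x.2.1, u < N) :
    (R.slotExample N i x).1.length ≤ R.d N ∧ (R.slotExample N i x).2.length = R.T := by
  unfold slotExample
  split_ifs
  · exact ⟨R.length_prompt_le h1 h2, length_pointingCot _ _⟩
  · exact ⟨R.length_blankPrompt_le N, by simp [blankCot, T]⟩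

theorem slot_valid {N b : ℕ} {m : List Item} (hm : m.length = b + 1) (hv : R.Valid N m) :
    (slot m).2.1.length = R.K ∧ ∀ u ∈ (slot m).2.1, u < N := by
  cases m with
  | nil => simp at hm
  | cons x m => exact hv x (by simp)

theorem simulatedSample_bounds {N q M b : ℕ} {l : List Item} (hM : 1 ≤ M)
    (hl : q * R.batchCost M b ≤ l.length) (hv : R.Valid N l) :
    ∀ B ∈ R.simulatedSample N q M b l, B ≠ [] ∧
      ∀ e ∈ B, e.1.length ≤ R.d N ∧ e.2.length = R.T := by
  intro B hB
  obtain ⟨m, hm, rfl⟩ := List.mem_map.1 hB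
  obtain ⟨h1, h2⟩ := mem_chunks hm hl
  refine ⟨fun h => ?_, fun e he => ?_⟩
  · have := congrArg List.length h
    rw [simulatedBatch, List.length_map, length_chunks] at this
    simp at this
    omega
  · obtain ⟨u, hu, rfl⟩ := List.mem_map.1 he
    obtain ⟨h3, h4⟩ := mem_chunks hu (by rw [List.length_drop, h1, batchCost]; omega)
    have := R.slot_valid h3 (hv.mono fun x hx => h2 x (List.mem_of_mem_drop (h4 x hx)))
    exact R.slotExample_bounds _ this.1 this.2

theorem length_simulatedSample (N q M b : ℕ) (l : List Item) :
    (R.simulatedSample N q M b l).length = q := by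
  rw [simulatedSample, List.length_map, length_chunks]

theorem length_flatten_simulatedSample (N q M b : ℕ) (l : List Item) :
    (R.simulatedSample N q M b l).flatten.length = q * M := by
  rw [List.length_flatten, List.eq_replicate_of_mem (a := M) (l := List.map _ _)]
  · simp [length_simulatedSample]
  · intro x hx
    obtain ⟨B, hB, rfl⟩ := List.mem_map.1 hx
    obtain ⟨m, _, rfl⟩ := List.mem_map.1 hB
    rw [simulatedBatch, List.length_map, length_chunks]

/-- The learner halts in time on samples of the right format. -/
def Halts (N₀ : ℕ) : Prop :=
  ∀ (N q : ℕ) (S : BatchedSample) (r : List Bool), N₀ ≤ N → S.length = q →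
    (∀ B ∈ S, B ≠ [] ∧ ∀ e ∈ B, e.1.length ≤ R.d N ∧ e.2.length = R.T) →
    r.length = R.coinCount N →
    ∃ hyp : Data,
      HaltsWithin R.L.train (encTrainInput (R.d N) (R.k N) R.T (R.thinkers q) S r) hyp
        (R.L.timeBound.eval (R.d N + R.k N + S.flatten.length)) ∧
      ∀ x : List Bool, x.length ≤ R.d N → ∃ b : Bool,
        HaltsWithin R.L.predict (encPredictInput hyp x) (encBool b)
          (R.L.timeBound.eval (R.d N + R.k N + S.flatten.length))

variable {R} in
-- With uniform labels the simulated sample need not come from any thinker. This is where the time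
-- bound on every sample of the right format is needed.
theorem Halts.hypothesis {N₀ N q M b : ℕ} {l : List Item} (hR : R.Halts N₀) (hN : N₀ ≤ N)
    (hM : 1 ≤ M) (hl : l.length = R.trialCost N q M b) (hv : R.Valid N l) {hyp : Data}
    (hhyp : hyp = R.hypothesis N q (R.simulatedSample N q M b (l.drop (R.coinCount N)))
        ((l.take (R.coinCount N)).map fun x => x.2.2)) :
    HaltsWithin R.L.train (encTrainInput (R.d N) (R.k N) R.T (R.thinkers q)
        (R.simulatedSample N q M b (l.drop (R.coinCount N)))
        ((l.take (R.coinCount N)).map fun x => x.2.2)) hyp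
        (R.L.timeBound.eval (R.d N + R.k N + q * M)) ∧
      ∀ x : List Bool, x.length ≤ R.d N →
        HaltsWithin R.L.predict (encPredictInput hyp x) (encBool (R.prediction hyp x))
          (R.L.timeBound.eval (R.d N + R.k N + q * M)) := by
  have hc : R.coinCount N + q * R.batchCost M b + N = l.length := by rw [hl, trialCost]
  obtain ⟨hyp', h1, h2⟩ := hR N q (R.simulatedSample N q M b (l.drop (R.coinCount N)))
    ((l.take (R.coinCount N)).map fun x => x.2.2) hN (R.length_simulatedSample _ _ _ _ _)
    (R.simulatedSample_bounds hM (by rw [List.length_drop]; omega)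
      (hv.mono fun x hx => List.mem_of_mem_drop hx))
    (by rw [List.length_map, List.length_take]; omega)
  rw [R.length_flatten_simulatedSample] at h1 h2
  obtain rfl : hyp' = hyp := by rw [hhyp, Reduction.hypothesis, Outputs.result_eq h1.outputs]
  refine ⟨h1, fun x hx => ?_⟩
  obtain ⟨y, hy⟩ := h2 x hx
  have : R.prediction hyp' x = y := by
    rw [prediction, Outputs.result_eq hy.outputs]
    cases y <;> simp [encBool]
  rwa [this]

/-! ### Polynomial-time computability of the distinguisher -/

section polyFun

variable {α : Type} {D : ℕ → α → Prop} {eA : α → Data} {N q M b : α → ℕ}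

/-- The window size, as a polynomial. -/
noncomputable def dPoly : Polynomial ℕ :=
  Polynomial.C (21 * R.n) + Polynomial.C (5 * R.n) * (Polynomial.C R.K * Polynomial.X + 1) +
    Polynomial.X

theorem eval_dPoly (N : ℕ) : R.dPoly.eval N = R.d N := by
  simp [dPoly, d]

/-- The inverse accuracy, as a polynomial. -/
noncomputable def kPoly : Polynomial ℕ := Polynomial.C 4 * Polynomial.X ^ (R.e + 1)

theorem eval_kPoly (N : ℕ) : R.kPoly.eval N = R.k N := by
  simp [kPoly, k]

theorem eval_coinBound (N : ℕ) :
    (R.L.coinBound.comp (R.dPoly + R.kPoly)).eval N = R.coinCount N := by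
  rw [Polynomial.eval_comp, Polynomial.eval_add, eval_dPoly, eval_kPoly, coinCount]

theorem polyFun_d (hN : PolyFun D eA encNat N) (hNb : PolyBdd D N) :
    PolyFun D eA encNat fun a => R.d (N a) :=
  (hN.eval hNb R.dPoly).congr fun _ _ _ => R.eval_dPoly _

theorem polyBdd_d (hNb : PolyBdd D N) : PolyBdd D fun a => R.d (N a) :=
  (hNb.eval R.dPoly).mono fun _ _ _ => (R.eval_dPoly _).ge

theorem polyFun_k (hN : PolyFun D eA encNat N) (hNb : PolyBdd D N) :
    PolyFun D eA encNat fun a => R.k (N a) :=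
  (hN.eval hNb R.kPoly).congr fun _ _ _ => R.eval_kPoly _

theorem polyBdd_k (hNb : PolyBdd D N) : PolyBdd D fun a => R.k (N a) :=
  (hNb.eval R.kPoly).mono fun _ _ _ => (R.eval_kPoly _).ge

theorem polyFun_coinCount (hN : PolyFun D eA encNat N) (hNb : PolyBdd D N) :
    PolyFun D eA encNat fun a => R.coinCount (N a) :=
  (hN.eval hNb _).congr fun _ _ _ => R.eval_coinBound _

theorem polyBdd_coinCount (hNb : PolyBdd D N) : PolyBdd D fun a => R.coinCount (N a) :=
  (hNb.eval _).mono fun _ _ _ => (R.eval_coinBound _).ge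

theorem polyFun_thinkers (hq : PolyFun D eA encNat q) :
    PolyFun D eA encNat fun a => R.thinkers (q a) := by
  unfold thinkers
  split_ifs
  · exact PolyFun.const _
  · exact hq

theorem polyFun_batchCost (hM : PolyFun D eA encNat M) (hMb : PolyBdd D M)
    (hb : PolyFun D eA encNat b) (hbb : PolyBdd D b) :
    PolyFun D eA encNat fun a => R.batchCost (M a) (b a) :=
  (PolyFun.const R.K).add (hM.mul hb.succ hMb (hbb.add (.const 1))) (hMb.mul (hbb.add (.const 1)))

theorem polyBdd_batchCost (hMb : PolyBdd D M) (hbb : PolyBdd D b) :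
    PolyBdd D fun a => R.batchCost (M a) (b a) :=
  (PolyBdd.const R.K).add (hMb.mul (hbb.add (.const 1)))

theorem polyFun_trialCost (hN : PolyFun D eA encNat N) (hNb : PolyBdd D N)
    (hq : PolyFun D eA encNat q) (hqb : PolyBdd D q) (hM : PolyFun D eA encNat M)
    (hMb : PolyBdd D M) (hb : PolyFun D eA encNat b) (hbb : PolyBdd D b) :
    PolyFun D eA encNat fun a => R.trialCost (N a) (q a) (M a) (b a) :=
  ((R.polyFun_coinCount hN hNb).add (hq.mul (R.polyFun_batchCost hM hMb hb hbb) hqb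
    (R.polyBdd_batchCost hMb hbb)) (hqb.mul (R.polyBdd_batchCost hMb hbb))).add hN hNb

theorem polyBdd_trialCost (hNb : PolyBdd D N) (hqb : PolyBdd D q) (hMb : PolyBdd D M)
    (hbb : PolyBdd D b) : PolyBdd D fun a => R.trialCost (N a) (q a) (M a) (b a) :=
  ((R.polyBdd_coinCount hNb).add (hqb.mul (R.polyBdd_batchCost hMb hbb))).add hNb

/-- The enumeration behind `location` is arbitrary, but its input has constant length, so the part
of the chain of thought that depends on it can be tabulated. -/
theorem polyFun_slotExample (hN : PolyFun D eA encNat N) (hNb : PolyBdd D N)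
    {bits : α → List Bool} (hbits : PolyFun D eA encStr bits)
    (hlen : ∀ m a, D m a → (bits a).length = R.K) {x : α → Bool × Item}
    (hx : PolyFun D eA (encPair encBool encItem) x)
    (hv : ∀ m a, D m a → (x a).2.1.length = R.K ∧ ∀ u ∈ (x a).2.1, u < N a) :
    PolyFun D eA (encPair encStr encStr) fun a =>
      R.slotExample (N a) (location R.K (bits a)) (x a) := by
  refine PolyFun.ite hx.fst (PolyFun.mono (D' := D) (PolyFun.pair
    (PolyFun.prompt R.n hN hx.snd.fst hNb ((PolyBdd.const R.K).mono fun m a h => (hv m a h).1.le)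
      fun m a h => (hv m a h).2)
    (PolyFun.append (PolyFun.table R.K (fun l => List.replicate (2 * R.n) false ++
      (List.range R.n).map (fun i => decide (i = (location R.K l).val)) ++
      List.replicate R.n false) hbits hlen)
      (PolyFun.cons (eB := encBool) hx.snd.snd.fst (PolyFun.const []))
      ((PolyBdd.const (4 * R.n)).mono fun m a _ => ?_))) fun _ _ h => h.1)
    (PolyFun.const _)
  simp; omega

theorem polyFun_and_of {c d : α → Bool} (hc : PolyFun D eA encBool c)
    (hd : PolyFun (fun N a => D N a ∧ c a = true) eA encBool d) :
    PolyFun D eA encBool fun a => c a && d a :=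
  (PolyFun.ite hc hd (PolyFun.const false)).congr fun N a _ => by cases c a <;> simp

theorem polyFun_slot {l : α → List Item} (hl : PolyFun D eA (encList encItem) l)
    (hlb : PolyBdd D fun a => (l a).length) (hne : ∀ m a, D m a → l a ≠ []) :
    PolyFun D eA (encPair encBool encItem) fun a => slot (l a) := by
  refine PolyFun.pair (PolyFun.all hl.tail (hlb.mono fun _ _ _ => by simp)
    (PolyFun.right (eB := encItem)).snd.snd)
    (hl.headD fun m a h h' => absurd h' (hne m a h))

section trial

variable (hN : PolyFun D eA encNat N) (hNb : PolyBdd D N) (hM : PolyFun D eA encNat M)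
  (hMb : PolyBdd D M) (hb : PolyFun D eA encNat b) (hbb : PolyBdd D b) {l : α → List Item}
  (hl : PolyFun D eA (encList encItem) l) (hv : ∀ m a, D m a → R.Valid (N a) (l a))

include hN hNb hM hMb hb hbb hl hv

theorem polyFun_simulatedBatch
    (hlen : ∀ m a, D m a → (l a).length = R.batchCost (M a) (b a)) :
    PolyFun D eA (encList (encPair encStr encStr)) fun a =>
      R.simulatedBatch (N a) (M a) (b a) (l a) := by
  have hch : ∀ m (x : α × List Item),
      D m x.1 ∧ x.2 ∈ chunks (b x.1 + 1) (M x.1) ((l x.1).drop R.K) →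
      x.2.length = b x.1 + 1 ∧ R.Valid (N x.1) x.2 := by
    rintro m x ⟨h1, h2⟩
    obtain ⟨h3, h4⟩ := mem_chunks h2 (by rw [List.length_drop, hlen m _ h1, batchCost]; omega)
    exact ⟨h3, (hv m _ h1).mono fun y hy => List.mem_of_mem_drop (h4 y hy)⟩
  have hbits : PolyFun D eA encStr fun a => ((l a).take R.K).map fun y => y.2.2 :=
    PolyFun.map (f := fun _ (y : Item) => y.2.2) ((PolyFun.const R.K).take (.const _) hl)
      ((PolyBdd.const R.K).mono fun _ _ _ => List.length_take_le _ _)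
      (PolyFun.right (eB := encItem)).snd.snd
  have hdrop : PolyFun D eA (encList encItem) fun a => (l a).drop R.K :=
    (PolyFun.const R.K).drop (.const _) hl
  have hex : PolyFun (fun m (x : α × List Item) => D m x.1 ∧
      x.2 ∈ chunks (b x.1 + 1) (M x.1) ((l x.1).drop R.K)) (encPair eA (encList encItem))
      (encPair encStr encStr) fun x => R.slotExample (N x.1)
        (location R.K (((l x.1).take R.K).map fun y => y.2.2)) (slot x.2) := by
    refine R.polyFun_slotExample (hN.lift fun _ _ h => h.1) (hNb.comp _ fun _ _ h => h.1)
      (hbits.lift fun _ _ h => h.1) (fun m x h => ?_) (x := fun x => slot x.2)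
      (polyFun_slot PolyFun.right ?_ fun m x h h' => ?_)
      fun m x h => R.slot_valid (hch m x h).1 (hch m x h).2
    · rw [List.length_map, List.length_take, hlen m _ h.1, batchCost]
      omega
    · exact ((hbb.add (.const 1)).comp Prod.fst fun _ _ h => h.1).mono
        fun m x h => (hch m x h).1.le
    · have := (hch m x h).1
      rw [h'] at this
      simp at this
  exact PolyFun.map (PolyFun.chunks hb.succ (hbb.add (.const 1)) hM hMb hdrop)
    (hMb.mono fun _ _ _ => by rw [length_chunks]) hex

theorem polyFun_simulatedSample (hq : PolyFun D eA encNat q) (hqb : PolyBdd D q)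
    (hlen : ∀ m a, D m a → q a * R.batchCost (M a) (b a) ≤ (l a).length) :
    PolyFun D eA (encList (encList (encPair encStr encStr))) fun a =>
      R.simulatedSample (N a) (q a) (M a) (b a) (l a) := by
  refine PolyFun.map (PolyFun.chunks (R.polyFun_batchCost hM hMb hb hbb)
    (R.polyBdd_batchCost hMb hbb) hq hqb hl) (hqb.mono fun _ _ _ => by rw [length_chunks]) ?_
  exact R.polyFun_simulatedBatch (hN.lift fun _ _ h => h.1) (hNb.comp _ fun _ _ h => h.1)
    (hM.lift fun _ _ h => h.1) (hMb.comp _ fun _ _ h => h.1)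
    (hb.lift fun _ _ h => h.1) (hbb.comp _ fun _ _ h => h.1) PolyFun.right
    (fun m x h => (hv m _ h.1).mono (mem_chunks h.2 (hlen m _ h.1)).2)
    fun m x h => (mem_chunks h.2 (hlen m _ h.1)).1

theorem polyFun_trial {N₀ : ℕ} (hR : R.Halts N₀) (hq : PolyFun D eA encNat q)
    (hqb : PolyBdd D q) (hM1 : ∀ m a, D m a → 1 ≤ M a) (hN₀ : ∀ m a, D m a → N₀ ≤ N a)
    (hlen : ∀ m a, D m a → (l a).length = R.trialCost (N a) (q a) (M a) (b a)) :
    PolyFun D eA encBool fun a => R.trial (N a) (q a) (M a) (b a) (l a) := by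
  have hlb : PolyBdd D fun a => (l a).length :=
    (R.polyBdd_trialCost hNb hqb hMb hbb).mono fun m a h => (hlen m a h).le
  have hcost : ∀ m a, D m a → R.coinCount (N a) + q a * R.batchCost (M a) (b a) + N a =
      (l a).length := fun m a h => by rw [hlen m a h, trialCost]
  have hcc := R.polyFun_coinCount hN hNb
  have hccb := R.polyBdd_coinCount hNb
  have htime : PolyBdd D fun a => R.L.timeBound.eval (R.d (N a) + R.k (N a) + q a * M a) :=
    (((R.polyBdd_d hNb).add (R.polyBdd_k hNb)).add (hqb.mul hMb)).eval _
  have hsample : PolyFun D eA (encList (encList (encPair encStr encStr))) fun a =>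
      R.simulatedSample (N a) (q a) (M a) (b a) ((l a).drop (R.coinCount (N a))) :=
    R.polyFun_simulatedSample hN hNb hM hMb hb hbb (hcc.drop hccb hl)
      (fun m a h => (hv m a h).mono fun x hx => List.mem_of_mem_drop hx) hq hqb
      fun m a h => by rw [List.length_drop, ← hcost m a h]; omega
  have hcoins : PolyFun D eA encStr fun a =>
      ((l a).take (R.coinCount (N a))).map fun x => x.2.2 :=
    PolyFun.map (hcc.take hccb hl) (hccb.mono fun _ _ _ => List.length_take_le _ _)
      (PolyFun.right (eB := encItem)).snd.snd
  have hhyp : PolyFun D eA (fun x => x) fun a => R.hypothesis (N a) (q a)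
      (R.simulatedSample (N a) (q a) (M a) (b a) ((l a).drop (R.coinCount (N a))))
      (((l a).take (R.coinCount (N a))).map fun x => x.2.2) := by
    refine PolyFun.result (p := R.L.train) ?_ htime fun m a h =>
      ⟨_, (hR.hypothesis (hN₀ m a h) (hM1 m a h) (hlen m a h) (hv m a h) rfl).1⟩
    exact ((R.polyFun_d hN hNb).pair ((R.polyFun_k hN hNb).pair ((PolyFun.const R.T).pair
      ((R.polyFun_thinkers hq).pair (hsample.pair hcoins))))).recode (eB := encPair encNat
      (encPair encNat (encPair encNat (encPair encNat (encPair
      (encList (encList (encPair encStr encStr))) encStr))))) fun _ _ _ => rfl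
  have hin : ∀ m (x : α × Item), D m x.1 ∧ x.2 ∈ (l x.1).drop
      (R.coinCount (N x.1) + q x.1 * R.batchCost (M x.1) (b x.1)) →
      x.2.1.length = R.K ∧ ∀ u ∈ x.2.1, u < N x.1 :=
    fun m x h => hv m x.1 h.1 x.2 (List.mem_of_mem_drop h.2)
  refine PolyFun.all ((hcc.add (hq.mul (R.polyFun_batchCost hM hMb hb hbb) hqb
    (R.polyBdd_batchCost hMb hbb)) (hqb.mul (R.polyBdd_batchCost hMb hbb))).drop
    (hccb.add (hqb.mul (R.polyBdd_batchCost hMb hbb))) hl)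
    (hlb.mono fun _ _ _ => by rw [List.length_drop]; omega) (PolyFun.beq ?_
    (PolyFun.right (eB := encItem)).snd.fst)
  refine (PolyFun.result (p := R.L.predict) (f := fun x : α × Item => encPredictInput
    (R.hypothesis (N x.1) (q x.1)
      (R.simulatedSample (N x.1) (q x.1) (M x.1) (b x.1) ((l x.1).drop (R.coinCount (N x.1))))
      (((l x.1).take (R.coinCount (N x.1))).map fun x => x.2.2)) (prompt R.n (N x.1) x.2.1))
    (((hhyp.lift fun _ _ h => h.1).pair (PolyFun.prompt R.n (hN.lift fun _ _ h => h.1)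
      (PolyFun.right (eB := encItem)).fst (hNb.comp _ fun _ _ h => h.1)
      ((PolyBdd.const R.K).mono fun m x h => (hin m x h).1.le)
      fun m x h => (hin m x h).2)).recode fun _ _ _ => rfl)
    (htime.comp Prod.fst fun _ _ h => h.1) fun m x h => ?_).recode fun m x h => ?_
  all_goals
    have hp := (hR.hypothesis (hN₀ m _ h.1) (hM1 m _ h.1) (hlen m _ h.1) (hv m _ h.1) rfl).2
      _ (R.length_prompt_le (hin m x h).1 (hin m x h).2)
  · exact ⟨_, hp⟩
  · exact Outputs.result_eq hp.outputs

theorem polyFun_any_trial {N₀ s : ℕ} (hR : R.Halts N₀) (hq : PolyFun D eA encNat q)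
    (hqb : PolyBdd D q) (hM1 : ∀ m a, D m a → 1 ≤ M a) (hN₀ : ∀ m a, D m a → N₀ ≤ N a)
    (hlen : ∀ m a, D m a → (l a).length = N a ^ s) :
    PolyFun D eA encBool fun a =>
      !decide (0 < N a * R.trialCost (N a) (q a) (M a) (b a) - N a ^ s) &&
        (chunks (R.trialCost (N a) (q a) (M a) (b a)) (N a) (l a)).any
          (R.trial (N a) (q a) (M a) (b a)) := by
  have hcost := R.polyFun_trialCost hN hNb hq hqb hM hMb hb hbb
  have hcostb := R.polyBdd_trialCost hNb hqb hMb hbb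
  refine polyFun_and_of (((hN.mul hcost hNb hcostb).sub (hN.pow hNb s) (hNb.pow s)).pos.not) ?_
  have hch : ∀ m (x : α × List Item), (D m x.1 ∧
      (!decide (0 < N x.1 * R.trialCost (N x.1) (q x.1) (M x.1) (b x.1) - N x.1 ^ s)) = true) ∧
      x.2 ∈ chunks (R.trialCost (N x.1) (q x.1) (M x.1) (b x.1)) (N x.1) (l x.1) →
      x.2.length = R.trialCost (N x.1) (q x.1) (M x.1) (b x.1) ∧ R.Valid (N x.1) x.2 := by
    rintro m x ⟨⟨h1, h2⟩, h3⟩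
    obtain ⟨h4, h5⟩ := mem_chunks h3 (by
      rw [hlen m _ h1]
      simp only [Bool.not_eq_true', decide_eq_false_iff_not] at h2
      omega)
    exact ⟨h4, (hv m _ h1).mono h5⟩
  refine PolyFun.any ((PolyFun.chunks hcost hcostb hN hNb hl).mono fun _ _ h => h.1)
    ((hNb.imp fun _ _ h => h.1).mono fun _ _ _ => by rw [length_chunks]) ?_
  exact R.polyFun_trial (hN.lift fun _ _ h => h.1.1) (hNb.comp _ fun _ _ h => h.1.1)
    (hM.lift fun _ _ h => h.1.1) (hMb.comp _ fun _ _ h => h.1.1)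
    (hb.lift fun _ _ h => h.1.1) (hbb.comp _ fun _ _ h => h.1.1) PolyFun.right
    (fun m x h => (hch m x h).2) hR (hq.lift fun _ _ h => h.1.1)
    (hqb.comp _ fun _ _ h => h.1.1) (fun m x h => hM1 m _ h.1.1) (fun m x h => hN₀ m _ h.1.1)
    fun m x h => (hch m x h).1

end trial

/-- The searches range over polynomially many parameters. The guards ensure that `N₀ ≤ N` and that
the `N` trials fit into the available items; only then are the chunks of full length and the learner
known to halt. -/
theorem polyFun_accept {N₀ : ℕ} (hR : R.Halts N₀) (s : ℕ) :
    PolyFun (fun m (a : ℕ × List Item) => a.1 = m ∧ a.2.length = a.1 ^ s ∧ R.Valid a.1 a.2)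
      (encPair encNat (encList encItem)) encBool fun a => R.accept N₀ s a.1 a.2 := by
  let D₀ : ℕ → ℕ × List Item → Prop := fun m a =>
    a.1 = m ∧ a.2.length = a.1 ^ s ∧ R.Valid a.1 a.2
  let D₁ : ℕ → ℕ × List Item → Prop := fun m a => D₀ m a ∧ (!decide (0 < N₀ - a.1)) = true
  have hb₀ : PolyBdd D₀ fun a => a.1 := ⟨Polynomial.X, fun m a h => by simp [h.1]⟩
  refine polyFun_and_of ((PolyFun.const N₀).sub PolyFun.left hb₀).pos.not ?_
  have hN : PolyFun D₁ (encPair encNat (encList encItem)) encNat fun a => a.1 := PolyFun.left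
  have hNb : PolyBdd D₁ fun a => a.1 := hb₀.imp fun _ _ h => h.1
  have hs := hN.pow hNb s
  have hsb := hNb.pow s
  refine PolyFun.any (hs.succ.range (hsb.add (.const 1)))
    ((hsb.add (.const 1)).mono fun _ _ _ => by rw [List.length_range]) ?_
  have hNb₂ := hNb.comp (Prod.fst (β := ℕ))
    (D := fun m x => D₁ m x.1 ∧ x.2 ∈ List.range (x.1.1 ^ s + 1)) fun _ _ h => h.1
  refine PolyFun.any ((hs.range hsb).lift fun _ _ h => h.1)
    ((hNb₂.pow s).mono fun _ _ _ => by rw [List.length_range]) ?_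
  have hNb₃ := hNb₂.comp (Prod.fst (β := ℕ))
    (D := fun m x => (D₁ m x.1.1 ∧ x.1.2 ∈ List.range (x.1.1.1 ^ s + 1)) ∧
      x.2 ∈ List.range (x.1.1.1 ^ s)) fun _ _ h => h.1
  refine PolyFun.any ((hN.range hNb).comp PolyFun.left.fst fun _ _ h => h.1.1)
    (hNb₃.mono fun _ _ _ => by rw [List.length_range]) ?_
  have hNb₄ := hNb₃.comp (Prod.fst (β := ℕ))
    (D := fun m x => ((D₁ m x.1.1.1 ∧ x.1.1.2 ∈ List.range (x.1.1.1.1 ^ s + 1)) ∧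
      x.1.2 ∈ List.range (x.1.1.1.1 ^ s)) ∧ x.2 ∈ List.range x.1.1.1.1) fun _ _ h => h.1
  refine R.polyFun_any_trial (N := fun x => x.1.1.1.1) (q := fun x => x.1.1.2)
    (M := fun x => x.1.2 + 1) (b := fun x => x.2) (l := fun x => x.1.1.1.2)
    PolyFun.left.fst.fst.fst hNb₄ PolyFun.left.snd.succ
    ((hNb₄.pow s).mono fun m x h => List.mem_range.1 h.1.2) PolyFun.right
    (hNb₄.mono fun m x h => (List.mem_range.1 h.2).le) PolyFun.left.fst.fst.snd
    (fun m x h => h.1.1.1.1.2.2) hR PolyFun.left.fst.snd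
    ((hNb₄.pow s).mono fun m x h => Nat.lt_succ_iff.1 (List.mem_range.1 h.1.1.2))
    (fun m x h => Nat.le_add_left _ _) (fun m x h => ?_) fun m x h => h.1.1.1.1.2.1
  have h' := h.1.1.1.2
  simp only [Bool.not_eq_true', decide_eq_false_iff_not] at h'
  omega

end polyFun

end Reduction

/-! ### The distinguisher as a program -/

theorem encList_map {α β : Type} (enc : β → Data) (f : α → β) (l : List α) :
    encList enc (l.map f) = encList (fun a => enc (f a)) l := by
  induction l with
  | nil => rfl
  | cons a l ih => rw [List.map_cons, encList, encList, ih]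

/-- The vertices of a hyperedge. -/
def edgeList {K N : ℕ} (S : Hyperedge K N) : List ℕ := List.ofFn fun i => (S i).val

theorem length_edgeList {K N : ℕ} (S : Hyperedge K N) : (edgeList S).length = K :=
  List.length_ofFn

theorem edgeList_lt {K N : ℕ} (S : Hyperedge K N) : ∀ u ∈ edgeList S, u < N := by
  intro u hu
  obtain ⟨i, rfl⟩ := (List.mem_ofFn' _ _).1 hu
  exact (S i).isLt

/-- The items of a challenge. -/
def items {K N : ℕ} (G : List (Hyperedge K N)) (y r : List Bool) : List Item :=
  (G.map edgeList).zip (y.zip r)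

theorem encChallenge_eq {K N : ℕ} (G : List (Hyperedge K N)) (y r : List Bool) :
    encChallenge G y r = encPair encNat (encPair (encList (encList encNat)) (encPair encStr encStr))
      (N, G.map edgeList, y, r) := by
  simp only [encChallenge, encPair, encList_map]
  congr 3
  funext S
  rw [← encList_map encNat (fun v : Fin N => v.val), edgeList, List.map_ofFn]
  rfl

/-- One coin per hyperedge is enough, since every coin of a trial is taken from an item. This
explains `Polynomial.X ^ s`. -/
theorem Reduction.exists_distinguisher (R : Reduction) {N₀ : ℕ} (hR : R.Halts N₀) (s : ℕ) :
    ∃ (A : Prog) (τ : Polynomial ℕ), IsPPTDistinguisher R.K s A (Polynomial.X ^ s) τ ∧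
      ∀ (N : ℕ) (G : List (Hyperedge R.K N)) (y r : List Bool),
        G.length = N ^ s → y.length = N ^ s → r.length = N ^ s →
        (Outputs A (encChallenge G y r) (encBool true) ↔
          R.accept N₀ s N (items G y r) = true) := by
  have h : PolyFun (fun m (a : ℕ × List (List ℕ) × List Bool × List Bool) => a.1 = m ∧
      a.2.1.length = a.1 ^ s ∧ a.2.2.1.length = a.1 ^ s ∧ a.2.2.2.length = a.1 ^ s ∧
      ∀ S ∈ a.2.1, S.length = R.K ∧ ∀ u ∈ S, u < a.1)
      (encPair encNat (encPair (encList (encList encNat)) (encPair encStr encStr))) encBool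
      fun a => R.accept N₀ s a.1 (a.2.1.zip (a.2.2.1.zip a.2.2.2)) := by
    have hb : PolyBdd (fun m (a : ℕ × List (List ℕ) × List Bool × List Bool) => a.1 = m ∧
        a.2.1.length = a.1 ^ s ∧ a.2.2.1.length = a.1 ^ s ∧ a.2.2.2.length = a.1 ^ s ∧
        ∀ S ∈ a.2.1, S.length = R.K ∧ ∀ u ∈ S, u < a.1) fun a => a.1 ^ s :=
      PolyBdd.pow ⟨Polynomial.X, fun m a h => by simp [h.1]⟩ s
    refine (R.polyFun_accept hR s).comp (f := fun a : ℕ × List (List ℕ) × List Bool × List Bool =>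
      (a.1, a.2.1.zip (a.2.2.1.zip a.2.2.2))) (PolyFun.pair PolyFun.left
      (PolyFun.zip PolyFun.right.fst (PolyFun.zip (eB := encBool) (eC := encBool)
        PolyFun.right.snd.fst PolyFun.right.snd.snd
        (hb.mono fun m a h => h.2.2.1.le)) (hb.mono fun m a h => h.2.1.le))) ?_
    rintro m a ⟨h1, h2, h3, h4, h5⟩
    refine ⟨h1, by simp [h2, h3, h4], fun x hx => h5 _ (List.of_mem_zip hx).1⟩
  obtain ⟨A, τ, hA⟩ := h
  have hA' : ∀ (N : ℕ) (G : List (Hyperedge R.K N)) (y r : List Bool),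
      G.length = N ^ s → y.length = N ^ s → r.length = N ^ s →
      HaltsWithin A (encChallenge G y r) (encBool (R.accept N₀ s N (items G y r)))
        (τ.eval N) := by
    intro N G y r hG hy hr
    rw [encChallenge_eq]
    refine hA N (N, G.map edgeList, y, r) ⟨rfl, by simpa using hG, hy, hr, fun S hS => ?_⟩
    obtain ⟨S, _, rfl⟩ := List.mem_map.1 hS
    exact ⟨length_edgeList S, edgeList_lt S⟩
  refine ⟨A, τ, fun N G y r hG hy hr => ⟨_, hA' N G y r hG hy (by simpa using hr)⟩,
    fun N G y r hG hy hr => ⟨fun h => ?_, fun h => ?_⟩⟩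
  · have := h.unique (hA' N G y r hG hy hr).outputs
    cases hc : R.accept N₀ s N (items G y r)
    · rw [hc] at this
      exact absurd this (by simp [encBool])
    · rfl
  · have := (hA' N G y r hG hy hr).outputs
    rwa [h] at this

/-! ### The laws of the items -/

section laws

variable {K N : ℕ} [Nonempty (Hyperedge K N)]

/-- The law of an item labelled by the generator with seed `x`. -/
noncomputable def pseudoItem (P : (Fin K → Bool) → Bool) (x : Fin N → Bool) : PMF Item :=
  (PMF.uniformOfFintype (Hyperedge K N)).bind fun S =>
    (PMF.uniformOfFintype Bool).map fun c => (edgeList S, P fun i => x (S i), c)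

variable (K N) in
/-- The law of an item with a uniform label. -/
noncomputable def uniformItem : PMF Item :=
  (PMF.uniformOfFintype (Hyperedge K N)).bind fun S =>
    (PMF.uniformOfFintype Bool).bind fun y =>
      (PMF.uniformOfFintype Bool).map fun c => (edgeList S, y, c)

theorem Ex_pseudoItem (P : (Fin K → Bool) → Bool) (x : Fin N → Bool) (φ : Item → ℝ≥0∞) :
    Ex (pseudoItem P x) φ = Ex (PMF.uniformOfFintype (Hyperedge K N)) fun S =>
      Ex (PMF.uniformOfFintype Bool) fun c => φ (edgeList S, P fun i => x (S i), c) := by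
  rw [pseudoItem, Ex_bind]
  simp only [Ex_map]

theorem Ex_uniformItem (φ : Item → ℝ≥0∞) :
    Ex (uniformItem K N) φ = Ex (PMF.uniformOfFintype (Hyperedge K N)) fun S =>
      Ex (PMF.uniformOfFintype Bool) fun y => Ex (PMF.uniformOfFintype Bool) fun c =>
        φ (edgeList S, y, c) := by
  rw [uniformItem, Ex_bind]
  simp only [Ex_bind, Ex_map]

/-- Given the seed, the triples of hyperedge, label and coin are independent and identically
distributed. -/
theorem Ex_pseudoLaw (P : (Fin K → Bool) → Bool) (m : ℕ) (φ : List Item → ℝ≥0∞) :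
    (Ex (pseudoLaw (N := N) P m m) fun c => φ (items c.1 c.2.1 c.2.2)) =
      Ex (PMF.uniformOfFintype (Fin N → Bool)) fun x => Ex (iid (pseudoItem P x) m) φ := by
  simp only [pseudoLaw, Ex_bind, Ex_map]
  rw [Ex_comm]
  refine Ex_congr_support fun x _ => ?_
  rw [coins]
  induction m generalizing φ with
  | zero => simp [Ex_iid_zero, items]
  | succ m ih =>
    simp only [Ex_iid_succ, Ex_pseudoItem, ← ih]
    refine Ex_congr_support fun S _ => ?_
    rw [Ex_comm]
    rfl

theorem Ex_uniformLaw (m : ℕ) (φ : List Item → ℝ≥0∞) :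
    (Ex (uniformLaw K N m m) fun c => φ (items c.1 c.2.1 c.2.2)) =
      Ex (iid (uniformItem K N) m) φ := by
  simp only [uniformLaw, Ex_bind, Ex_map, coins]
  induction m generalizing φ with
  | zero => simp [Ex_iid_zero, items]
  | succ m ih =>
    simp only [Ex_iid_succ, Ex_uniformItem, ← ih]
    refine Ex_congr_support fun S _ => ?_
    rw [Ex_comm]
    refine Ex_congr_support fun y _ => ?_
    simp only [Ex_comm (iid (PMF.uniformOfFintype Bool) m) (PMF.uniformOfFintype Bool)]
    rw [Ex_comm]
    rfl

end laws

/-! ### Elementary estimates -/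

section estimates

variable {α V : Type}

theorem Ex_exists_range_le (p : PMF α) (n : ℕ) (E : ℕ → α → Prop) (t : ℝ≥0∞)
    (h : ∀ i < n, Ex p (ind (E i)) ≤ t) :
    Ex p (ind fun a => ∃ i < n, E i a) ≤ n * t := by
  calc _ ≤ Ex p fun a => ∑ i ∈ Finset.range n, ind (E i) a := by
        refine Ex_mono fun a => ?_
        by_cases hc : ∃ i < n, E i a
        · obtain ⟨i, hi, hE⟩ := hc
          refine (ind_le_one _ _).trans ?_
          rw [← ind_of_true hE]
          exact Finset.single_le_sum (f := fun i => ind (E i) a) (fun _ _ => zero_le)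
            (Finset.mem_range.2 hi)
        · rw [ind_of_false (E := fun a => ∃ i < n, E i a) hc]
          exact zero_le
    _ = ∑ i ∈ Finset.range n, Ex p (ind (E i)) := Ex_finsetSum _ _ _
    _ ≤ ∑ _i ∈ Finset.range n, t := Finset.sum_le_sum fun i hi => h i (Finset.mem_range.1 hi)
    _ = _ := by rw [Finset.sum_const, Finset.card_range, nsmul_eq_mul]

theorem ind_or_le (E F : α → Prop) (a : α) : ind (fun a => E a ∨ F a) a ≤ ind E a + ind F a := by
  by_cases h : E a
  · rw [ind_of_true h]
    exact (ind_le_one _ _).trans (le_add_of_nonneg_right zero_le)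
  · by_cases h' : F a
    · rw [ind_of_true h']
      exact (ind_le_one _ _).trans (le_add_of_nonneg_left zero_le)
    · rw [ind_of_false (by simp [h, h'])]
      exact zero_le

theorem Ex_iid_exists_le (p : PMF α) (E : α → Prop) (n : ℕ) :
    Ex (iid p n) (ind fun l => ∃ a ∈ l, E a) ≤ n * Ex p (ind E) := by
  induction n with
  | zero => simp [Ex_iid_zero, ind]
  | succ n ih =>
    rw [Ex_iid_succ]
    calc _ ≤ Ex p fun a => Ex (iid p n) fun l => ind E a + ind (fun l => ∃ a ∈ l, E a) l := by
          refine Ex_mono fun a => Ex_mono fun l => ?_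
          refine le_trans (ind_le_ind (F := fun l => E a ∨ ∃ a ∈ l, E a) (b := l)
            (by simp)) (ind_or_le (fun _ => E a) _ l) |>.trans ?_
          exact le_of_eq rfl
      _ = Ex p (ind E) + Ex (iid p n) (ind fun l => ∃ a ∈ l, E a) := by
          simp only [Ex_add, Ex_const]
      _ ≤ _ := by push_cast; rw [add_mul, one_mul, add_comm]; gcongr

/-- Among `n` independent draws, two that satisfy `E` are unlikely. -/
theorem Ex_iid_not_agree_le (p : PMF α) (E : α → Prop) (A : α → V) [Nonempty V] (n : ℕ) :
    Ex (iid p n) (ind fun l => ¬ ∃ a₀, ∀ a ∈ l, E a → A a = a₀) ≤ (n * Ex p (ind E)) ^ 2 := by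
  induction n with
  | zero =>
    rw [Ex_iid_zero, ind_of_false (by simp)]
    exact zero_le
  | succ n ih =>
    rw [Ex_iid_succ]
    -- If the other draws agree on some `a₀`, the new draw can spoil this only if it satisfies `E`
    -- and so does another one.
    calc _ ≤ Ex p fun a => Ex (iid p n) fun l => ind E a * ind (fun l => ∃ a ∈ l, E a) l +
          ind (fun l => ¬ ∃ a₀, ∀ a ∈ l, E a → A a = a₀) l := by
          refine Ex_mono fun a => Ex_mono fun l => ?_
          by_cases h1 : ∃ a₀, ∀ a ∈ l, E a → A a = a₀
          · by_cases h2 : E a ∧ ∃ a ∈ l, E a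
            · rw [ind_of_true h2.1, ind_of_true (E := fun l => ∃ a ∈ l, E a) h2.2, one_mul]
              exact (ind_le_one _ _).trans (le_add_of_nonneg_right zero_le)
            · rw [ind_of_false]
              · exact zero_le
              · rw [not_not]
                obtain ⟨a₀, ha₀⟩ := h1
                by_cases h3 : E a
                · refine ⟨A a, fun b hb hE => ?_⟩
                  rcases List.mem_cons.1 hb with rfl | hb
                  · rfl
                  · exact absurd ⟨h3, b, hb, hE⟩ h2
                · refine ⟨a₀, fun b hb hE => ?_⟩
                  rcases List.mem_cons.1 hb with rfl | hb
                  · exact absurd hE h3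
                  · exact ha₀ b hb hE
          · rw [ind_of_true (E := fun l => ¬ ∃ a₀, ∀ a ∈ l, E a → A a = a₀) h1]
            exact (ind_le_one _ _).trans (le_add_of_nonneg_left zero_le)
      _ = Ex p (ind E) * Ex (iid p n) (ind fun l => ∃ a ∈ l, E a) +
          Ex (iid p n) (ind fun l => ¬ ∃ a₀, ∀ a ∈ l, E a → A a = a₀) := by
          simp only [Ex_add, Ex_const, mul_comm (ind E _), Ex_mul_right]
          simp only [mul_comm (Ex (iid p n) _), Ex_mul_right]
      _ ≤ Ex p (ind E) * (n * Ex p (ind E)) + (n * Ex p (ind E)) ^ 2 := by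
          gcongr
          exact Ex_iid_exists_le p E n
      -- The added terms complete the square `((n + 1) * Ex p (ind E)) ^ 2`.
      _ ≤ Ex p (ind E) * (n * Ex p (ind E)) + (n * Ex p (ind E)) ^ 2 +
          (Ex p (ind E) * (n * Ex p (ind E)) + Ex p (ind E) ^ 2) := le_self_add
      _ = _ := by push_cast; ring

theorem Ex_uniform_prod {β : Type} [Fintype α] [Nonempty α] [Fintype β] [Nonempty β]
    (φ : α × β → ℝ≥0∞) :
    Ex (PMF.uniformOfFintype (α × β)) φ = Ex (PMF.uniformOfFintype α) fun a =>
      Ex (PMF.uniformOfFintype β) fun b => φ (a, b) := by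
  simp only [Ex, PMF.uniformOfFintype_apply, Fintype.card_prod, Nat.cast_mul]
  rw [ENNReal.tsum_prod']
  refine tsum_congr fun a => ?_
  rw [← ENNReal.tsum_mul_left]
  refine tsum_congr fun b => ?_
  rw [ENNReal.mul_inv (Or.inr (ENNReal.natCast_ne_top _)) (Or.inl (ENNReal.natCast_ne_top _)),
    mul_assoc]

theorem Ex_coins (K : ℕ) (φ : List Bool → ℝ≥0∞) :
    Ex (coins K) φ = Ex (PMF.uniformOfFintype (Fin K → Bool)) fun b => φ (List.ofFn b) := by
  rw [coins]
  induction K generalizing φ with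
  | zero =>
    rw [Ex_iid_zero]
    simp only [List.ofFn_zero, Ex_const]
  | succ K ih =>
    rw [Ex_iid_succ, ← Ex_uniform_equiv (Fin.consEquiv fun _ : Fin (K + 1) => Bool),
      Ex_uniform_prod]
    simp only [ih, Fin.consEquiv_apply, List.ofFn_succ, Fin.cons_zero, Fin.cons_succ]

theorem Ex_location (K : ℕ) (φ : Fin (2 ^ K) → ℝ≥0∞) :
    (Ex (coins K) fun r => φ (location K r)) = Ex (PMF.uniformOfFintype (Fin (2 ^ K))) φ := by
  rw [Ex_coins, ← Ex_uniform_equiv (assignmentEquiv K)]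
  refine Ex_congr_support fun b _ => ?_
  rw [location]
  congr 2
  funext j
  simp

theorem Ex_bool (E : Bool → Prop) (b : Bool) (h : ∀ c, E c ↔ c = b) :
    Ex (PMF.uniformOfFintype Bool) (ind E) = 2⁻¹ := by
  rw [Ex, tsum_bool]
  cases b <;> simp [ind, h]

theorem Ex_coins_all (b : ℕ) : Ex (coins b) (ind fun r => ∀ c ∈ r, c = true) = 2⁻¹ ^ b := by
  rw [coins, Ex_iid_forall, Ex_bool _ true fun c => Iff.rfl]

end estimates

theorem chunks_append {β : Type} (c n : ℕ) (u v : List β) (h : n * c ≤ u.length) :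
    chunks c n (u ++ v) = chunks c n u := by
  induction n generalizing u with
  | zero => rfl
  | succ n ih =>
    rw [Nat.succ_mul] at h
    rw [chunks, chunks, List.take_append_of_le_length (by omega),
      List.drop_append_of_le_length (by omega), ih _ (by rw [List.length_drop]; omega)]

theorem ind_congr {α β : Type} {E : α → Prop} {F : β → Prop} {a : α} {b : β} (h : E a ↔ F b) :
    ind E a = ind F b := le_antisymm (ind_le_ind h.1) (ind_le_ind h.2)

namespace Reduction

variable (R : Reduction)

/-! ### The probability that a trial succeeds -/

theorem trial_append {N q M b : ℕ} {r u v : List Item} (hr : r.length = R.coinCount N)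
    (hu : u.length = q * R.batchCost M b) :
    R.trial N q M b (r ++ (u ++ v)) =
      R.test N (R.hypothesis N q (R.simulatedSample N q M b u) (r.map fun x => x.2.2)) v := by
  rw [trial, List.take_left' hr, List.drop_left' hr, ← List.drop_drop, List.drop_left' hr,
    List.drop_left' hu, simulatedSample, chunks_append _ _ _ _ hu.ge, simulatedSample]

theorem Ex_trial (μ : PMF Item) (N q M b : ℕ) :
    Ex (iid μ (R.trialCost N q M b)) (ind fun l => R.trial N q M b l = true) =
      Ex (iid μ (R.coinCount N)) fun r => Ex (iid μ (q * R.batchCost M b)) fun u =>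
        Ex (iid μ N) (ind fun v => R.test N (R.hypothesis N q (R.simulatedSample N q M b u)
          (r.map fun x => x.2.2)) v = true) := by
  rw [trialCost, Nat.add_assoc, Ex_iid_add]
  refine Ex_congr_support fun r hr => ?_
  rw [Ex_iid_add]
  refine Ex_congr_support fun u hu => Ex_congr_support fun v _ => ?_
  rw [ind, ind, R.trial_append (mem_support_iid hr).1 (mem_support_iid hu).1]

theorem ind_test (N : ℕ) (hyp : Data) (l : List Item) :
    ind (fun v => R.test N hyp v = true) l =
      ind (fun v => ∀ x ∈ v, R.prediction hyp (prompt R.n N x.1) = x.2.1) l := by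
  exact ind_congr (by simp only [test, List.all_eq_true, beq_iff_eq])

section uniform

variable {N : ℕ} [Nonempty (Hyperedge R.K N)]

/-- The test items are fresh, so their labels are fair coins independent of the hypothesis and of
the prompts: each prediction is right with probability `1 / 2`. -/
theorem Ex_trial_uniformItem_le (q M b : ℕ) :
    Ex (iid (uniformItem R.K N) (R.trialCost N q M b)) (ind fun l => R.trial N q M b l = true) ≤
      2⁻¹ ^ N := by
  rw [Ex_trial]
  refine Ex_le fun r _ => Ex_le fun u _ => ?_
  simp only [funext (R.ind_test N _)]
  rw [Ex_iid_forall]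
  refine pow_le_pow_left' ?_ N
  rw [Ex_uniformItem]
  refine Ex_le fun S _ => ?_
  calc _ = Ex (PMF.uniformOfFintype Bool) (ind fun y => R.prediction (R.hypothesis N q
        (R.simulatedSample N q M b u) (r.map fun x => x.2.2)) (prompt R.n N (edgeList S)) = y) :=
        Ex_congr_support fun y _ => Ex_const _ _
    _ ≤ _ := (Ex_bool _ _ fun c => eq_comm).le

/-- Union bound over the `N ^ s + 1` values of `q`, the `N ^ s` values of `M`, the `N` values of `b`
and the `N` trials. Trials with wrong parameters are as unlikely to succeed as the others, so
searching for the parameters of the learner, which need not be computable, costs only this factor.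
-/
theorem Ex_accept_uniformItem_le (N₀ s : ℕ) :
    Ex (iid (uniformItem R.K N) (N ^ s)) (ind fun l => R.accept N₀ s N l = true) ≤
      ((N ^ s + 1) * (N ^ s * (N * (N * 2⁻¹ ^ N)))) := by
  calc _ ≤ Ex (iid (uniformItem R.K N) (N ^ s)) (ind fun l => ∃ q < N ^ s + 1, ∃ M < N ^ s,
        ∃ b < N, N * R.trialCost N q (M + 1) b ≤ N ^ s ∧
          ∃ m ∈ chunks (R.trialCost N q (M + 1) b) N l, R.trial N q (M + 1) b m = true) := by
        refine Ex_mono fun l => ind_le_ind fun h => ?_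
        simp only [accept, Bool.and_eq_true, List.any_eq_true, List.mem_range,
          Bool.not_eq_true', decide_eq_false_iff_not, not_lt, Nat.le_zero,
          Nat.sub_eq_zero_iff_le] at h
        exact h.2
    _ ≤ ((N ^ s + 1 : ℕ) : ℝ≥0∞) * (((N ^ s : ℕ) : ℝ≥0∞) * ((N : ℝ≥0∞) * (N * 2⁻¹ ^ N))) := by
        refine Ex_exists_range_le _ _ _ _ fun q _ => Ex_exists_range_le _ _ _ _ fun M _ =>
          Ex_exists_range_le _ _ _ _ fun b _ => ?_
        by_cases hc : N * R.trialCost N q (M + 1) b ≤ N ^ s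
        · obtain ⟨k, hk⟩ := Nat.exists_eq_add_of_le hc
          rw [hk, Ex_iid_add]
          calc _ ≤ Ex (iid (uniformItem R.K N) (N * R.trialCost N q (M + 1) b)) fun u =>
                ind (fun L => ∃ m ∈ L, R.trial N q (M + 1) b m = true)
                  (chunks (R.trialCost N q (M + 1) b) N u) := by
                refine Ex_mono_support fun u hu => Ex_le fun v _ => ind_le_ind fun h => ?_
                rw [chunks_append _ _ _ _ (mem_support_iid hu).1.ge] at h
                exact h.2
            _ ≤ N * Ex (iid (uniformItem R.K N) (R.trialCost N q (M + 1) b))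
                  (ind fun l => R.trial N q (M + 1) b l = true) := by
                rw [Ex_iid_chunks]
                exact Ex_iid_exists_le _ _ _
            _ ≤ _ := by
                gcongr
                exact R.Ex_trial_uniformItem_le q (M + 1) b
        · refine (Ex_le (c := 0) fun l _ => ?_).trans zero_le
          rw [ind_of_false (by simp [hc])]
    _ = _ := by push_cast; rfl

end uniform

/-- For the correct parameters alone, the `N` trials use disjoint items and are independent;
rejection requires all of them to fail. -/
theorem Ex_not_accept_le (μ : PMF Item) {N₀ s N q M b : ℕ} (hN : N₀ ≤ N) (hq : q ≤ N ^ s)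
    (hM : 1 ≤ M) (hM' : M ≤ N ^ s) (hb : b < N) (hcost : N * R.trialCost N q M b ≤ N ^ s) :
    Ex (iid μ (N ^ s)) (ind fun l => ¬ R.accept N₀ s N l = true) ≤
      (1 - Ex (iid μ (R.trialCost N q M b)) (ind fun l => R.trial N q M b l = true)) ^ N := by
  rw [← Ex_ind_not_eq_one_sub, ← Ex_iid_forall, ← Ex_iid_chunks]
  obtain ⟨k, hk⟩ := Nat.exists_eq_add_of_le hcost
  have : iid μ (N ^ s) = iid μ (N * R.trialCost N q M b + k) := by rw [hk]
  rw [this, Ex_iid_add]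
  refine Ex_mono_support fun u hu => Ex_le fun v _ => ind_le_ind fun h m hm ht => h ?_
  simp only [accept, Bool.and_eq_true, List.any_eq_true, List.mem_range,
    Bool.not_eq_true', decide_eq_false_iff_not, not_lt, Nat.le_zero,
    Nat.sub_eq_zero_iff_le]
  refine ⟨hN, q, by omega, M - 1, by omega, b, hb, ?_⟩
  rw [Nat.sub_add_cancel hM]
  exact ⟨hcost, m, by rwa [chunks_append _ _ _ _ (mem_support_iid hu).1.ge], ht⟩

end Reduction

theorem e2e_eq_of_cot {f : Thinker} {T : ℕ} {x l : List Bool} {y : Bool}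
    (h : cot f (T + 1) x = l ++ [y]) : e2e f (T + 1) x = y := by
  rw [cot, List.range_succ, List.map_append, List.map_singleton] at h
  exact List.singleton_inj.1 (List.append_inj_right' h rfl)

/-! ### The prompt distribution, the simulation of batches and the success of a trial -/

namespace Reduction

variable (R : Reduction)

/-- The prompt of a slot. -/
def slotPrompt (N : ℕ) (z : Bool × Item) : List Bool :=
  if z.1 then prompt R.n N z.2.1 else blankPrompt R.n

/-- The law of a slot whose items have law `μ`. -/
noncomputable def slotLaw (μ : PMF Item) (b : ℕ) : PMF (Bool × Item) := (iid μ (b + 1)).map slot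

theorem Ex_simulatedSample (μ : PMF Item) (N q M b : ℕ) (φ : BatchedSample → ℝ≥0∞) :
    (Ex (iid μ (q * R.batchCost M b)) fun u => φ (R.simulatedSample N q M b u)) =
      Ex (iid ((iid μ (R.batchCost M b)).map (R.simulatedBatch N M b)) q) φ := by
  simp only [simulatedSample]
  rw [Ex_iid_chunks μ _ _ fun L => φ (L.map (R.simulatedBatch N M b)), Ex_iid_map]

section seed

variable {N : ℕ} [Nonempty (Hyperedge R.K N)] (P : (Fin R.K → Bool) → Bool) (x : Fin N → Bool)

theorem mem_support_pseudoItem {z : Item} (hz : z ∈ (pseudoItem P x).support) :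
    ∃ (S : Hyperedge R.K N) (c : Bool), z = (edgeList S, P fun i => x (S i), c) := by
  rw [pseudoItem, PMF.mem_support_bind_iff] at hz
  obtain ⟨S, _, hz⟩ := hz
  obtain ⟨c, _, rfl⟩ := (PMF.mem_support_map_iff _ _ _).1 hz
  exact ⟨S, c, rfl⟩

theorem mem_support_slotLaw {b : ℕ} {z : Bool × Item}
    (hz : z ∈ (slotLaw (pseudoItem P x) b).support) :
    ∃ (S : Hyperedge R.K N) (c : Bool), z.2 = (edgeList S, P fun i => x (S i), c) := by
  obtain ⟨l, hl, rfl⟩ := (PMF.mem_support_map_iff _ _ _).1 hz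
  obtain ⟨h1, h2⟩ := mem_support_iid hl
  cases l with
  | nil => simp at h1
  | cons y l => exact R.mem_support_pseudoItem P x (h2 y (by simp))

theorem Ex_iid_coin (m : ℕ) (φ : List Bool → ℝ≥0∞) :
    (Ex (iid (pseudoItem P x) m) fun l => φ (l.map fun z => z.2.2)) = Ex (coins m) φ := by
  rw [← Ex_iid_map, coins]
  congr 2
  refine PMF_ext_Ex fun ψ => ?_
  rw [Ex_map, Ex_pseudoItem]
  exact Ex_const (PMF.uniformOfFintype (Hyperedge R.K N)) (Ex (PMF.uniformOfFintype Bool) ψ)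

theorem Ex_slotLaw (b : ℕ) (φ : Bool × Item → ℝ≥0∞) :
    Ex (slotLaw (pseudoItem P x) b) φ =
      Ex (pseudoItem P x) fun z => Ex (coins b) fun r => φ (r.all fun c => c, z) := by
  rw [slotLaw, Ex_map, Ex_iid_succ]
  refine Ex_congr_support fun z _ => ?_
  rw [← R.Ex_iid_coin P x]
  simp only [slot, List.tail_cons, List.headD_cons, List.all_map]
  rfl

/-- The control coins come from other items than the content, so showing a hyperedge is independent
of which item is shown. -/
theorem Ex_slotLaw_ind (b : ℕ) (E : Item → Prop) :
    Ex (slotLaw (pseudoItem P x) b) (ind fun z => z.1 = true ∧ E z.2) =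
      2⁻¹ ^ b * Ex (pseudoItem P x) (ind E) := by
  rw [R.Ex_slotLaw, mul_comm, ← Ex_mul_right]
  refine Ex_congr_support fun z _ => ?_
  rw [← Ex_coins_all]
  by_cases h : E z
  · rw [ind_of_true h, one_mul]
    exact Ex_congr_support fun r _ => ind_congr (by simp [h])
  · rw [ind_of_false h, zero_mul]
    exact le_antisymm (Ex_le fun r _ => (ind_of_false (by simp [h])).le) zero_le

theorem Ex_simulatedBatch (M b : ℕ) (φ : List Example → ℝ≥0∞) :
    Ex ((iid (pseudoItem P x) (R.batchCost M b)).map (R.simulatedBatch N M b)) φ =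
      Ex (PMF.uniformOfFintype (Fin R.n)) fun i =>
        Ex (iid (slotLaw (pseudoItem P x) b) M) fun l => φ (l.map (R.slotExample N i)) := by
  rw [Ex_map, batchCost, Ex_iid_add, ← Ex_location, ← R.Ex_iid_coin P x]
  refine Ex_congr_support fun u hu => ?_
  have hu' := (mem_support_iid hu).1
  simp only [simulatedBatch, List.take_left' hu', List.drop_left' hu']
  rw [Ex_iid_chunks _ (b + 1) M fun L => φ (L.map fun m => R.slotExample N
    (location R.K (u.map fun z => z.2.2)) (slot m)), slotLaw, Ex_iid_map]
  simp only [List.map_map, Function.comp_def]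

/-- The assignment that a hyperedge reads from the seed. -/
noncomputable def reading (S : List ℕ) : Fin R.n :=
  assignmentEquiv R.K fun i => if h : S.getD i 0 < N then x ⟨S.getD i 0, h⟩ else false

omit [Nonempty (Hyperedge R.K N)] in
theorem reading_edgeList (S : Hyperedge R.K N) :
    R.reading x (edgeList S) = assignmentEquiv R.K fun i => x (S i) := by
  rw [reading]
  congr 1
  funext i
  have : (edgeList S).getD i 0 = S i := by
    rw [edgeList, List.getD_eq_getElem _ _ (by simp)]
    simp
  simp only [this, Fin.is_lt, dite_true, Fin.eta]

section thinkers

variable {P x} {f : Fin R.n → Thinker} {h : List Bool → Bool}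
  (hcot : ∀ v (S : Hyperedge R.K N), cot (f v) R.T (prompt R.n N (edgeList S)) =
    pointingCot R.n (R.reading x (edgeList S) + v) (P fun i => x (S i)))
  (hblank : ∀ v, cot (f v) R.T (blankPrompt R.n) = blankCot R.n)
  (hh : ∀ v, e2e (f v) R.T = h)

include hcot hblank in
-- If all informative examples of the batch read the same assignment `a₀`, all of them point to `a₀
-- + v`, which is uniform like the simulated location. Only disagreeing readings cause a loss, and
-- these need two informative examples.
theorem Ex_batchLaw_le (M b : ℕ) (φ : List Example → ℝ≥0∞) (hφ : ∀ B, φ B ≤ 1) :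
    Ex ((PMF.uniformOfFintype (Fin R.n)).bind fun v =>
        batchLaw ((slotLaw (pseudoItem P x) b).map (R.slotPrompt N)) (f v) R.T M) φ ≤
      Ex ((iid (pseudoItem P x) (R.batchCost M b)).map (R.simulatedBatch N M b)) φ +
        (M * 2⁻¹ ^ b) ^ 2 := by
  have hE : Ex (slotLaw (pseudoItem P x) b) (ind fun z => z.1 = true) = 2⁻¹ ^ b := by
    have := R.Ex_slotLaw_ind P x b fun _ => True
    simp only [and_true] at this
    rw [this]
    have h1 : ind (fun _ : Item => True) = fun _ => 1 := funext fun z => ind_of_true trivial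
    rw [h1, Ex_const, mul_one]
  have hbad := Ex_iid_not_agree_le (slotLaw (pseudoItem P x) b) (fun z => z.1 = true)
    (fun z => R.reading x z.2.1) M
  rw [hE] at hbad
  rw [R.Ex_simulatedBatch, Ex_bind]
  refine le_trans ?_ (add_le_add_right hbad _)
  simp only [batchLaw, Ex_iid_map, Ex_comm (PMF.uniformOfFintype (Fin R.n))]
  rw [← Ex_add]
  refine Ex_mono_support fun l hl => ?_
  by_cases hc : ∃ a₀, ∀ z ∈ l, z.1 = true → R.reading x z.2.1 = a₀
  · obtain ⟨a₀, ha₀⟩ := hc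
    refine le_trans (le_of_eq ?_) le_self_add
    -- The shift by the unknown `a₀` is absorbed into the uniform rotation; this is what hides the
    -- seed.
    refine Eq.trans ?_ (Ex_uniform_equiv (Equiv.addLeft a₀) _)
    refine Ex_congr_support fun v _ => ?_
    rw [List.map_map]
    congr 1
    refine List.map_congr_left fun z hz => ?_
    obtain ⟨S, c, hS⟩ := R.mem_support_slotLaw P x ((mem_support_iid hl).2 z hz)
    by_cases hz1 : z.1 = true
    · have := ha₀ z hz hz1
      simp only [Function.comp_apply, slotPrompt, slotExample, hz1, if_true]
      rw [hS] at this ⊢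
      simp only at this
      simp only [hcot, this, Equiv.coe_addLeft]
    · simp only [Function.comp_apply, slotPrompt, slotExample, hz1]
      simp [hblank]
  · rw [ind_of_true (E := fun l : List (Bool × Item) => ¬ ∃ a₀, ∀ z ∈ l, z.1 = true →
      R.reading x z.2.1 = a₀) hc]
    exact (Ex_le fun v _ => hφ _).trans le_add_self

omit [Nonempty (Hyperedge R.K N)] in
include hcot hh in
theorem eval_prompt (S : Hyperedge R.K N) :
    h (prompt R.n N (edgeList S)) = P fun i => x (S i) := by
  have hn : 0 < R.n := R.n_pos
  rw [← hh ⟨0, hn⟩]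
  exact e2e_eq_of_cot (hcot ⟨0, hn⟩ S)

/-- The hypothesis has error at most `1 / k` on the prompts of slots. -/
def Good (P : (Fin R.K → Bool) → Bool) (x : Fin N → Bool) (h : List Bool → Bool) (b : ℕ)
    (hyp : Data) : Prop :=
  Pr ((slotLaw (pseudoItem P x) b).map (R.slotPrompt N)) (fun z =>
    ¬ Outputs R.L.predict (encPredictInput hyp z) (encBool (h z))) ≤ 1 / (R.k N : ℝ)

include hcot hh in
-- Hyperedge prompts have total weight `2 ^ (-b)`, so the error on them is at most `2 ^ b / k ≤ 1 /
-- (2 N)`, and a union bound over `N` test items leaves probability `1 / 2`.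
theorem Good.le_Ex_test {b : ℕ} (hk : 2 * (N * 2 ^ b) ≤ R.k N) (hk0 : 0 < R.k N) {hyp : Data}
    (hg : R.Good P x h b hyp) :
    2⁻¹ ≤ Ex (iid (pseudoItem P x) N) (ind fun v => R.test N hyp v = true) := by
  set w := Ex (pseudoItem P x) (ind fun z => ¬ R.prediction hyp (prompt R.n N z.1) = z.2.1) with hw
  have h1 : 2⁻¹ ^ b * w ≤ (R.k N : ℝ≥0∞)⁻¹ := by
    rw [Good, Pr_eq] at hg
    have h2 := (ENNReal.le_ofReal_iff_toReal_le (Ex_ind_ne_top _ _) (by positivity)).2 hg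
    rw [ENNReal.ofReal_div_of_pos (by exact_mod_cast hk0), ENNReal.ofReal_one,
      ENNReal.ofReal_natCast, one_div] at h2
    refine le_trans ?_ h2
    rw [hw, ← R.Ex_slotLaw_ind, Ex_map]
    refine Ex_mono_support fun z hz => ind_le_ind fun ⟨h3, h4⟩ h5 => h4 ?_
    obtain ⟨S, c, hS⟩ := R.mem_support_slotLaw P x hz
    rw [slotPrompt, if_pos h3, hS] at h5
    rw [hS]
    simp only [R.eval_prompt hcot hh] at h5 ⊢
    rw [prediction, Outputs.result_eq h5]
    cases P fun i => x (S i) <;> simp [encBool]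
  have h2 : (2 : ℝ≥0∞) * (N * 2 ^ b) ≤ R.k N := by exact_mod_cast hk
  have h3 : (N : ℝ≥0∞) * w ≤ 2⁻¹ := by
    have e1 : (2 : ℝ≥0∞) ^ b * 2⁻¹ ^ b = 1 := by
      rw [← mul_pow, ENNReal.mul_inv_cancel (by norm_num) (by norm_num), one_pow]
    calc (N : ℝ≥0∞) * w = N * 2 ^ b * (2⁻¹ ^ b * w) := by
          rw [← mul_assoc, mul_assoc _ (2 ^ b) (2⁻¹ ^ b), e1, mul_one]
      _ ≤ N * 2 ^ b * (R.k N : ℝ≥0∞)⁻¹ := by gcongr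
      _ = 2⁻¹ * (2 * (N * 2 ^ b)) * (R.k N : ℝ≥0∞)⁻¹ := by
          rw [← mul_assoc 2⁻¹, ENNReal.inv_mul_cancel (by norm_num) (by norm_num), one_mul]
      _ ≤ 2⁻¹ * (R.k N : ℝ≥0∞) * (R.k N : ℝ≥0∞)⁻¹ := by gcongr
      _ = 2⁻¹ := by
          rw [mul_assoc, ENNReal.mul_inv_cancel (by exact_mod_cast hk0.ne')
            (ENNReal.natCast_ne_top _), mul_one]
  have h4 := (Ex_iid_exists_le (pseudoItem P x)
    (fun z => ¬ R.prediction hyp (prompt R.n N z.1) = z.2.1) N).trans h3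
  rw [funext (R.ind_test N hyp), Ex_ind_eq_one_sub]
  have h5 : (2⁻¹ : ℝ≥0∞) = 1 - 2⁻¹ := (ENNReal.one_sub_inv_two).symm
  rw [h5]
  refine tsub_le_tsub_left ?_ _
  refine le_trans (Ex_mono fun v => ind_le_ind fun hv => ?_) h4
  push Not at hv
  exact hv

include hcot hblank hh in
-- Of the success probability `t`, at most half is lost by replacing the batches one by one with
-- simulated ones, and a good hypothesis passes the test with probability at least `1 / 2`.
theorem le_Ex_trial {q M b : ℕ} (hk : 2 * (N * 2 ^ b) ≤ R.k N) (hk0 : 0 < R.k N) {t : ℝ≥0∞}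
    (ht : t ≤ Ex (iid ((PMF.uniformOfFintype (Fin R.n)).bind fun v =>
      batchLaw ((slotLaw (pseudoItem P x) b).map (R.slotPrompt N)) (f v) R.T M) q) fun S =>
        Ex (coins (R.coinCount N)) (ind fun r => R.Good P x h b (R.hypothesis N q S r)))
    (hq : q * (M * 2⁻¹ ^ b) ^ 2 ≤ t / 2) :
    t / 4 ≤ Ex (iid (pseudoItem P x) (R.trialCost N q M b))
      (ind fun l => R.trial N q M b l = true) := by
  have ht1 : t ≤ 1 := ht.trans (Ex_le fun S _ => Ex_ind_le_one _ _)
  have ht2 : t / 2 ≠ ∞ := ne_top_of_le_ne_top ENNReal.one_ne_top (ENNReal.half_le_self.trans ht1)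
  have h1 : t / 2 ≤ Ex (iid ((iid (pseudoItem P x) (R.batchCost M b)).map
      (R.simulatedBatch N M b)) q) fun S =>
        Ex (coins (R.coinCount N)) (ind fun r => R.Good P x h b (R.hypothesis N q S r)) := by
    have h2 := Ex_iid_le_add (R.Ex_batchLaw_le hcot hblank M b) q
      (fun S => Ex (coins (R.coinCount N)) (ind fun r => R.Good P x h b (R.hypothesis N q S r)))
      fun S => Ex_ind_le_one _ _
    have h3 := (ht.trans h2).trans (add_le_add_right hq _)
    rw [← ENNReal.add_halves t] at h3
    rw [ENNReal.add_halves t] at h3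
    nth_rewrite 1 [← ENNReal.add_halves t] at h3
    exact (ENNReal.add_le_add_iff_right ht2).1 h3
  rw [Ex_trial, Ex_comm]
  rw [← Ex_simulatedSample] at h1
  calc t / 4 = t / 2 * 2⁻¹ := by
        rw [div_eq_mul_inv, div_eq_mul_inv, mul_assoc, ← ENNReal.mul_inv (by simp) (by simp)]
        norm_num
    _ ≤ _ := mul_le_mul_left h1 _
    _ ≤ _ := by
        rw [← Ex_mul_right]
        refine Ex_mono fun u => ?_
        rw [← R.Ex_iid_coin P x, ← Ex_mul_right]
        refine Ex_mono fun r => ?_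
        by_cases hg : R.Good P x h b (R.hypothesis N q (R.simulatedSample N q M b u)
          (r.map fun z => z.2.2))
        · refine le_trans ?_ (Good.le_Ex_test R hcot hh hk hk0 hg)
          exact (mul_le_mul_left (ind_le_one _ _) _).trans_eq (one_mul _)
        · rw [ind_of_false (E := fun r => R.Good P x h b (R.hypothesis N q
            (R.simulatedSample N q M b u) r)) hg, zero_mul]
          exact zero_le

end thinkers

end seed

end Reduction

/-! ### Existence of the thinkers for a given seed -/

namespace Reduction

variable (R : Reduction)

/-- Thinkers that share their end-to-end map, evaluate the predicate on the prompts of hyperedges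
and reveal the assignment that they read only up to a shift. -/
theorem exists_thinkers {N : ℕ} (hN : 0 < N) (P : (Fin R.K → Bool) → Bool) (x : Fin N → Bool) :
    ∃ (w : Fin R.n → Fin (R.d N) → ℝ) (h : List Bool → Bool),
      (∀ v (S : Hyperedge R.K N), cot (linThinker (w v)) R.T (prompt R.n N (edgeList S)) =
        pointingCot R.n (R.reading x (edgeList S) + v) (P fun i => x (S i))) ∧
      (∀ v, cot (linThinker (w v)) R.T (blankPrompt R.n) = blankCot R.n) ∧
      ∀ v, e2e (linThinker (w v)) R.T = h := by
  let al : Fin R.n → ℕ → Bool := fun a j =>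
    if hj : j < R.K then (assignmentEquiv R.K).symm a ⟨j, hj⟩ else false
  -- Terms are the assignments of the `K` bits, and the rejecting ones are those where `P` is false.
  -- The values of `al` and `y` outside their ranges are never read on prompts of hyperedges.
  let rej : Fin R.n → Bool := fun a => !P ((assignmentEquiv R.K).symm a)
  let y : ℕ → Bool := fun u => if hu : u < N then x ⟨u, hu⟩ else false
  have hd : 21 * R.n + 5 * R.n * (R.K * N + 1) ≤ R.d N := Nat.le_add_right _ _
  have hfin : ∀ z : List Bool, ∃ b, ∀ v, e2e (linThinker (weightVector (R.d N)
      (weight R.n (R.K * N + 1) (R.K + 1) (R.d N) (mismatch N al y) rej v))) R.T z = b := by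
    intro z
    obtain ⟨b, hb⟩ := final_independent (mis := mismatch N al y) (rej := rej) hd
      (Nat.le_add_left 1 R.K) fun p => z.reverse.getD p false
    exact ⟨b, fun v => by
      rw [T, e2e_succ]
      exact hb v _ (autoregressive_linThinker _ _ _)⟩
  choose h hh using hfin
  refine ⟨fun v => weightVector (R.d N) (weight R.n (R.K * N + 1) (R.K + 1) (R.d N)
    (mismatch N al y) rej v), h, fun v S => ?_, fun v => cot_blankPrompt _ _ hd
    (Nat.le_add_left 1 R.K) (Nat.succ_pos _) v, fun v => funext fun z => hh z v⟩
  have hget : ∀ j (hj : j < R.K), (edgeList S).getD j 0 = S ⟨j, hj⟩ := fun j hj => by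
    rw [edgeList, List.getD_eq_getElem _ _ (by simpa)]
    simp
  have key := cot_prompt (n := R.n) (d := R.d N) (edgeList_lt S) hN al rej y
    (by rw [length_edgeList]; exact hd) (R.reading x (edgeList S)) (fun a => ?_) v
  · rw [length_edgeList] at key
    rw [T, key]
    congr 1
    simp only [rej, reading_edgeList, Equiv.symm_apply_apply, Bool.not_not]
  · rw [reading_edgeList, ← Equiv.symm_apply_eq, length_edgeList]
    constructor
    · intro ha
      funext i
      have := ha i i.isLt
      rw [hget i i.isLt] at this
      simpa [al, y] using this.symm
    · rintro ha j hj
      rw [hget j hj]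
      simp [al, y, hj, ha]

end Reduction

/-! ### The advantage of the distinguisher -/

theorem tendsto_union_bound (s : ℕ) :
    Tendsto (fun N : ℕ => ((N ^ s + 1) * (N ^ s * (N * (N * 2⁻¹ ^ N))) : ℝ≥0∞)) atTop
      (nhds 0) := by
  have h1 := (tendsto_pow_const_mul_const_pow_of_abs_lt_one (2 * s + 2)
    (r := (2 : ℝ)⁻¹) (by rw [abs_of_pos] <;> norm_num)).const_mul 2
  rw [mul_zero] at h1
  have h2 := ENNReal.tendsto_ofReal h1
  rw [ENNReal.ofReal_zero] at h2
  refine tendsto_of_tendsto_of_tendsto_of_le_of_le' tendsto_const_nhds h2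
    (Eventually.of_forall fun _ => zero_le) ?_
  filter_upwards [eventually_ge_atTop 1] with N hN
  have h3 : ENNReal.ofReal (2 * ((N : ℝ) ^ (2 * s + 2) * 2⁻¹ ^ N)) =
      2 * ((N : ℝ≥0∞) ^ (2 * s + 2) * 2⁻¹ ^ N) := by
    rw [ENNReal.ofReal_mul (by norm_num), ENNReal.ofReal_mul (by positivity),
      ENNReal.ofReal_pow (by positivity), ENNReal.ofReal_pow (by positivity),
      ENNReal.ofReal_natCast, ENNReal.ofReal_inv_of_pos (by norm_num)]
    simp
  rw [h3]
  have h4 : (1 : ℝ≥0∞) ≤ (N : ℝ≥0∞) ^ s := by exact_mod_cast Nat.one_le_pow _ _ hN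
  calc ((N : ℝ≥0∞) ^ s + 1) * (N ^ s * (N * (N * 2⁻¹ ^ N)))
      ≤ ((N : ℝ≥0∞) ^ s + N ^ s) * (N ^ s * (N * (N * 2⁻¹ ^ N))) := by gcongr
    _ = _ := by ring

theorem mem_support_pseudoLaw {K N : ℕ} [Nonempty (Hyperedge K N)] {P : (Fin K → Bool) → Bool}
    {M R : ℕ} {c : List (Hyperedge K N) × List Bool × List Bool}
    (h : c ∈ (pseudoLaw (N := N) P M R).support) :
    c.1.length = M ∧ c.2.1.length = M ∧ c.2.2.length = R := by
  rw [pseudoLaw, PMF.mem_support_bind_iff] at h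
  obtain ⟨G, hG, h⟩ := h
  obtain ⟨x, _, h⟩ := (PMF.mem_support_bind_iff _ _ _).1 h
  obtain ⟨r, hr, rfl⟩ := (PMF.mem_support_map_iff _ _ _).1 h
  have := (mem_support_iid hG).1
  exact ⟨this, by simpa [goldreich] using this, (mem_support_iid hr).1⟩

theorem mem_support_uniformLaw {K N : ℕ} [Nonempty (Hyperedge K N)]
    {M R : ℕ} {c : List (Hyperedge K N) × List Bool × List Bool}
    (h : c ∈ (uniformLaw K N M R).support) :
    c.1.length = M ∧ c.2.1.length = M ∧ c.2.2.length = R := by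
  rw [uniformLaw, PMF.mem_support_bind_iff] at h
  obtain ⟨G, hG, h⟩ := h
  obtain ⟨y, hy, h⟩ := (PMF.mem_support_bind_iff _ _ _).1 h
  obtain ⟨r, hr, rfl⟩ := (PMF.mem_support_map_iff _ _ _).1 h
  exact ⟨(mem_support_iid hG).1, (mem_support_iid hy).1, (mem_support_iid hr).1⟩

/-- Success with constant probability `τ` in each trial makes rejection of pseudorandom labels as
unlikely as `(1 - τ) ^ N`, while acceptance of uniform labels tends to zero. With both below `1 / 4`
the advantage is at least `1 / 2`. -/
theorem Reduction.not_isPRG (R : Reduction) {s N₀ : ℕ} (P : (Fin R.K → Bool) → Bool)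
    (hR : R.Halts N₀) {τ : ℝ≥0∞} (hτ : 0 < τ)
    (hmain : ∀ N, N₀ ≤ N → ∀ _ : Nonempty (Hyperedge R.K N), ∃ q M b, q ≤ N ^ s ∧ 1 ≤ M ∧
      M ≤ N ^ s ∧ b < N ∧ N * R.trialCost N q M b ≤ N ^ s ∧ ∀ x : Fin N → Bool,
        τ ≤ Ex (iid (pseudoItem P x) (R.trialCost N q M b))
          (ind fun l => R.trial N q M b l = true)) :
    ¬ IsPRG P s (1 / 3) := by
  intro hP
  obtain ⟨A, σ, hA, hout⟩ := R.exists_distinguisher hR s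
  have hev := hP A _ σ hA
  simp only [Polynomial.eval_pow, Polynomial.eval_X] at hev
  have hquarter : (0 : ℝ≥0∞) < 4⁻¹ := by simp
  have h1 : ∀ᶠ N : ℕ in atTop, (1 - τ) ^ N < 4⁻¹ :=
    (ENNReal.tendsto_pow_atTop_nhds_zero_of_lt_one
      (ENNReal.sub_lt_self ENNReal.one_ne_top one_ne_zero hτ.ne')).eventually_lt_const hquarter
  have h2 := (tendsto_union_bound s).eventually_lt_const hquarter
  obtain ⟨N, hev, h1, h2, hN₀, hK⟩ := (hev.and (h1.and (h2.and
    ((eventually_ge_atTop N₀).and (eventually_ge_atTop R.K))))).exists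
  have hne : Nonempty (Hyperedge R.K N) := ⟨Fin.castLEEmb hK⟩
  have hev := hev hne
  obtain ⟨q, M, b, hq, hM, hM', hb, hcost, htrial⟩ := hmain N hN₀ hne
  have hpseudo : Ex (pseudoLaw (N := N) P (N ^ s) (N ^ s)) (ind fun c =>
      ¬ Outputs A (encChallenge c.1 c.2.1 c.2.2) (encBool true)) ≤ 4⁻¹ := by
    calc _ = Ex (pseudoLaw (N := N) P (N ^ s) (N ^ s)) fun c =>
          ind (fun l => ¬ R.accept N₀ s N l = true) (items c.1 c.2.1 c.2.2) := by
          refine Ex_congr_support fun c hc => ind_congr ?_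
          obtain ⟨e1, e2, e3⟩ := mem_support_pseudoLaw hc
          rw [hout N _ _ _ e1 e2 e3]
      _ ≤ 4⁻¹ := by
          rw [Ex_pseudoLaw]
          refine Ex_le fun x _ => ?_
          refine (R.Ex_not_accept_le (pseudoItem P x) hN₀ hq hM hM' hb hcost).trans ?_
          exact (pow_le_pow_left' (tsub_le_tsub_left (htrial x) 1) N).trans h1.le
  have huniform : Ex (uniformLaw R.K N (N ^ s) (N ^ s)) (ind fun c =>
      Outputs A (encChallenge c.1 c.2.1 c.2.2) (encBool true)) ≤ 4⁻¹ := by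
    calc _ = Ex (uniformLaw R.K N (N ^ s) (N ^ s)) fun c =>
          ind (fun l => R.accept N₀ s N l = true) (items c.1 c.2.1 c.2.2) := by
          refine Ex_congr_support fun c hc => ind_congr ?_
          obtain ⟨e1, e2, e3⟩ := mem_support_uniformLaw hc
          rw [hout N _ _ _ e1 e2 e3]
      _ ≤ 4⁻¹ := by
          rw [Ex_uniformLaw]
          exact (R.Ex_accept_uniformItem_le N₀ s).trans h2.le
  have hreal : ((4⁻¹ : ℝ≥0∞)).toReal = 1 / 4 := by simp
  rw [Pr_eq, Pr_eq, Ex_ind_eq_one_sub, ENNReal.toReal_sub_of_le (Ex_ind_le_one _ _)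
    ENNReal.one_ne_top, ENNReal.toReal_one] at hev
  have e1 := ENNReal.toReal_mono (by simp) hpseudo
  have e2 := ENNReal.toReal_mono (by simp) huniform
  rw [hreal] at e1 e2
  have e3 := (abs_le.1 hev).2
  linarith

/-! ### Polynomial growth with explicit exponents -/

/-- `f N = O(N ^ j)` for `N ≥ 1`. -/
def Growth (j : ℕ) (f : ℕ → ℕ) : Prop := ∃ C, ∀ N, 1 ≤ N → f N ≤ C * N ^ j

theorem Growth.mono {i j : ℕ} {f : ℕ → ℕ} (h : Growth i f) (hij : i ≤ j) : Growth j f := by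
  obtain ⟨C, hC⟩ := h
  exact ⟨C, fun N hN => (hC N hN).trans (Nat.mul_le_mul_left _ (Nat.pow_le_pow_right hN hij))⟩

theorem Growth.mul {i j : ℕ} {f g : ℕ → ℕ} (hf : Growth i f) (hg : Growth j g) :
    Growth (i + j) fun N => f N * g N := by
  obtain ⟨C, hC⟩ := hf
  obtain ⟨C', hC'⟩ := hg
  refine ⟨C * C', fun N hN => (Nat.mul_le_mul (hC N hN) (hC' N hN)).trans_eq ?_⟩
  ring

/-- The exponent `i + j` is wasteful, but only its being explicit matters. -/
theorem Growth.add {i j : ℕ} {f g : ℕ → ℕ} (hf : Growth i f) (hg : Growth j g) :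
    Growth (i + j) fun N => f N + g N := by
  obtain ⟨C, hC⟩ := hf.mono (Nat.le_add_right i j)
  obtain ⟨C', hC'⟩ := hg.mono (Nat.le_add_left j i)
  refine ⟨C + C', fun N hN => (Nat.add_le_add (hC N hN) (hC' N hN)).trans_eq ?_⟩
  ring

theorem Growth.const (c : ℕ) : Growth 0 fun _ => c := ⟨c, fun N _ => by simp⟩

theorem Growth.id : Growth 1 fun N => N := ⟨1, fun N _ => by simp⟩

theorem eval_le_eval_one_mul_pow (p : Polynomial ℕ) {m : ℕ} (hm : 1 ≤ m) :
    p.eval m ≤ p.eval 1 * m ^ p.natDegree := by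
  rw [Polynomial.eval_eq_sum_range, Polynomial.eval_eq_sum_range, Finset.sum_mul]
  refine Finset.sum_le_sum fun i hi => ?_
  rw [one_pow, mul_one]
  exact Nat.mul_le_mul_left _ (Nat.pow_le_pow_right hm (Nat.lt_succ_iff.1 (Finset.mem_range.1 hi)))

theorem eval_monotone (p : Polynomial ℕ) : Monotone fun m => p.eval m := by
  intro a b hab
  simp only [Polynomial.eval_eq_sum_range]
  exact Finset.sum_le_sum fun i _ => Nat.mul_le_mul_left _ (Nat.pow_le_pow_left hab i)

theorem Growth.eval {j : ℕ} {f : ℕ → ℕ} (hf : Growth j f) (p : Polynomial ℕ) :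
    Growth (j * p.natDegree) fun N => p.eval (f N) := by
  obtain ⟨C, hC⟩ := hf
  refine ⟨p.eval 1 * (C + 1) ^ p.natDegree, fun N hN => ?_⟩
  have h1 : f N ≤ (C + 1) * N ^ j := (hC N hN).trans (Nat.mul_le_mul_right _ (Nat.le_succ C))
  calc p.eval (f N) ≤ p.eval ((C + 1) * N ^ j) := eval_monotone p h1
    _ ≤ p.eval 1 * ((C + 1) * N ^ j) ^ p.natDegree :=
        eval_le_eval_one_mul_pow p (Nat.mul_pos (Nat.succ_pos C) (Nat.pow_pos hN))
    _ = _ := by rw [mul_pow, pow_mul, mul_assoc]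

theorem Growth.eventually_le {j : ℕ} {f : ℕ → ℕ} (hf : Growth j f) :
    ∀ᶠ N in atTop, f N ≤ N ^ (j + 1) := by
  obtain ⟨C, hC⟩ := hf
  filter_upwards [eventually_ge_atTop 1, eventually_ge_atTop C] with N h1 h2
  exact (hC N h1).trans ((Nat.mul_le_mul_right _ h2).trans_eq (by ring))

namespace Reduction

variable (R : Reduction)

theorem growth_d : Growth 1 R.d := by
  refine ⟨21 * R.n + 5 * R.n * (R.K + 1) + 1, fun N hN => ?_⟩
  have h1 : 21 * R.n ≤ 21 * R.n * N := Nat.le_mul_of_pos_right _ hN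
  have h2 : 5 * R.n * (R.K * N + 1) ≤ 5 * R.n * ((R.K + 1) * N) :=
    Nat.mul_le_mul_left _ (by rw [Nat.succ_mul]; omega)
  rw [d, pow_one, Nat.add_mul, Nat.add_mul, one_mul, Nat.mul_assoc (5 * R.n)]
  omega

theorem growth_k : Growth (R.e + 1) R.k := ⟨4, fun _ _ => le_rfl⟩

theorem le_d (N : ℕ) : N ≤ R.d N := Nat.le_add_left _ _

/-- The number of control coins. -/
def control (N : ℕ) : ℕ := Nat.clog 2 (N ^ R.e)

theorem pow_le_two_pow_control (N : ℕ) : N ^ R.e ≤ 2 ^ R.control N :=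
  Nat.le_pow_clog (by norm_num) _

/-- Rounding to a power of two loses a factor of at most `2`; the factor `4` in `Reduction.k` leaves
room for it and for the `1 / 2` in the test. -/
theorem two_pow_control_le {N : ℕ} (hN : 1 ≤ N) : 2 ^ R.control N ≤ 2 * N ^ R.e := by
  have h1 : 1 ≤ N ^ R.e := Nat.one_le_pow _ _ hN
  rcases Nat.eq_zero_or_pos (R.control N) with h | h
  · rw [h]; omega
  · have h2 : 1 < N ^ R.e := by
      by_contra hc
      rw [control, show N ^ R.e = 1 by omega, Nat.clog_one_right] at h
      omega
    have h3 := Nat.pow_pred_clog_lt_self (b := 2) (by norm_num) h2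
    obtain ⟨b, hb⟩ := Nat.exists_eq_succ_of_ne_zero h.ne'
    rw [show Nat.clog 2 (N ^ R.e) = b + 1 from hb] at h3
    rw [hb, pow_succ]
    simp at h3
    omega

theorem eventually_control_lt : ∀ᶠ N in atTop, R.control N < N := by
  have h1 := tendsto_pow_const_mul_const_pow_of_abs_lt_one R.e
    (r := (2 : ℝ)⁻¹) (by rw [abs_of_pos] <;> norm_num)
  filter_upwards [h1.eventually_lt_const (show (0 : ℝ) < 1 / 2 by norm_num),
    eventually_ge_atTop 1] with N h2 hN
  have h3 : (2 : ℝ) * N ^ R.e < 2 ^ N := by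
    rw [inv_pow, ← div_eq_mul_inv, div_lt_iff₀ (by positivity)] at h2
    linarith
  have h4 : 2 * N ^ R.e < 2 ^ N := by exact_mod_cast h3
  exact (Nat.pow_lt_pow_iff_right (by norm_num : 1 < 2)).1 ((R.two_pow_control_le hN).trans_lt h4)

/-- Up to constants, `q` is at most `N ^ (deg p + 2 (e + 1))` divided by `N ^ (deg p + 2 deg pM +
3)`, and the squared factor is `N ^ (2 deg pM - 2 e)`. The exponents add up to `-1`. -/
theorem collision_bound {p pM : Polynomial ℕ} {c : ℝ} {A B N q M : ℕ} (hN : 1 ≤ N)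
    (hA : p.eval (R.d N) ≤ A * N ^ p.natDegree) (hB : pM.eval (R.d N) ≤ B * N ^ pM.natDegree)
    (hc : 0 ≤ c) (he : ((p.natDegree + 2 * pM.natDegree + 3 : ℕ) : ℝ) ≤ (R.e + 1 : ℕ) * c)
    (hq : (q : ℝ) ≤ ((p.eval (R.d N) : ℕ) : ℝ) * (R.k N : ℝ) ^ (2 - c))
    (hM : M ≤ pM.eval (R.d N)) :
    (q : ℝ) * (M * 2⁻¹ ^ R.control N) ^ 2 ≤ 16 * A * B ^ 2 / N := by
  have hX : (1 : ℝ) ≤ N := by exact_mod_cast hN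
  have hX0 : (0 : ℝ) < N := by linarith
  have hk : (R.k N : ℝ) = 4 * (N : ℝ) ^ (R.e + 1) := by simp [k]
  have hk0 : (0 : ℝ) < R.k N := by rw [hk]; positivity
  have h1 : (R.k N : ℝ) ^ (2 - c) ≤
      16 * (N : ℝ) ^ (2 * (R.e + 1)) * ((N : ℝ) ^ (p.natDegree + 2 * pM.natDegree + 3))⁻¹ := by
    rw [Real.rpow_sub hk0, div_eq_mul_inv]
    have e1 : (R.k N : ℝ) ^ (2 : ℝ) = 16 * (N : ℝ) ^ (2 * (R.e + 1)) := by
      rw [Real.rpow_two, hk]; ring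
    rw [e1]
    refine mul_le_mul_of_nonneg_left (inv_anti₀ (by positivity) ?_) (by positivity)
    calc (N : ℝ) ^ (p.natDegree + 2 * pM.natDegree + 3)
        = (N : ℝ) ^ ((p.natDegree + 2 * pM.natDegree + 3 : ℕ) : ℝ) := (Real.rpow_natCast _ _).symm
      _ ≤ (N : ℝ) ^ ((R.e + 1 : ℕ) * c) := Real.rpow_le_rpow_of_exponent_le hX he
      _ = ((N : ℝ) ^ (R.e + 1)) ^ c := by rw [Real.rpow_mul hX0.le, Real.rpow_natCast]
      _ ≤ (R.k N : ℝ) ^ c := by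
          refine Real.rpow_le_rpow (by positivity) ?_ hc
          rw [hk]
          have : (0 : ℝ) < (N : ℝ) ^ (R.e + 1) := by positivity
          linarith
  have h2 : ((2 : ℝ)⁻¹) ^ R.control N ≤ ((N : ℝ) ^ R.e)⁻¹ := by
    rw [inv_pow]
    refine inv_anti₀ (by positivity) ?_
    exact_mod_cast R.pow_le_two_pow_control N
  have h3 : (M : ℝ) ≤ B * (N : ℝ) ^ pM.natDegree := by exact_mod_cast hM.trans hB
  have h4 : ((p.eval (R.d N) : ℕ) : ℝ) ≤ A * (N : ℝ) ^ p.natDegree := by exact_mod_cast hA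
  calc (q : ℝ) * (M * 2⁻¹ ^ R.control N) ^ 2
      ≤ (A * (N : ℝ) ^ p.natDegree * (16 * (N : ℝ) ^ (2 * (R.e + 1)) *
          ((N : ℝ) ^ (p.natDegree + 2 * pM.natDegree + 3))⁻¹)) *
          (B * (N : ℝ) ^ pM.natDegree * ((N : ℝ) ^ R.e)⁻¹) ^ 2 := by
        refine mul_le_mul (hq.trans (mul_le_mul h4 h1 (by positivity) (by positivity)))
          (pow_le_pow_left₀ (by positivity) (mul_le_mul h3 h2 (by positivity) (by positivity)) 2)
          (by positivity) (by positivity)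
    _ = _ := by
        field_simp
        ring

/-- `K` enters only the implied constant. The exponent is thus known before the predicate is chosen.
-/
theorem growth_trialCost (p pM : Polynomial ℕ) :
    Growth ((R.e + 1) * R.L.coinBound.natDegree +
      (p.natDegree + (R.e + 1) * 2 + (pM.natDegree + 1)) + 1) fun N =>
      R.coinCount N + p.eval (R.d N) * R.k N ^ 2 * (R.K + pM.eval (R.d N) * N) + N := by
  have h1 : Growth (R.e + 1) fun N => R.d N + R.k N := by
    obtain ⟨C, hC⟩ := R.growth_d.mono (Nat.le_add_left 1 R.e)
    obtain ⟨C', hC'⟩ := R.growth_k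
    exact ⟨C + C', fun N hN => (Nat.add_le_add (hC N hN) (hC' N hN)).trans_eq (by ring)⟩
  have h2 : Growth ((R.e + 1) * 2) fun N => R.k N ^ 2 := by
    simpa [pow_two, mul_two] using R.growth_k.mul R.growth_k
  have h3 := R.growth_d.eval p
  have h4 := R.growth_d.eval pM
  rw [one_mul] at h3 h4
  have h5 := (Growth.const R.K).add (h4.mul Growth.id)
  rw [zero_add] at h5
  exact ((h1.eval R.L.coinBound).add ((h3.mul h2).mul h5)).add Growth.id

theorem trialCost_le {N q M b Q Mm : ℕ} (hq : q ≤ Q) (hM : M ≤ Mm) (hb : b < N) :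
    R.trialCost N q M b ≤ R.coinCount N + Q * (R.K + Mm * N) + N := by
  rw [trialCost, batchCost]
  gcongr
  exact hb

end Reduction

/-! ### Choice of the parameters and refutation of the learners -/

theorem Reduction.Halts.mono {R : Reduction} {N₀ N₁ : ℕ} (h : R.Halts N₀) (hN : N₀ ≤ N₁) :
    R.Halts N₁ := fun N q S r h1 => h N q S r (hN.trans h1)

theorem Reduction.supportedOn (R : Reduction) {N : ℕ} [Nonempty (Hyperedge R.K N)]
    (P : (Fin R.K → Bool) → Bool) (x : Fin N → Bool) (b : ℕ) :
    SupportedOn (R.d N) ((slotLaw (pseudoItem P x) b).map (R.slotPrompt N)) := by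
  intro y hy
  obtain ⟨z, hz, rfl⟩ := (PMF.mem_support_map_iff _ _ _).1 hy
  obtain ⟨S, c, hS⟩ := R.mem_support_slotLaw P x hz
  unfold slotPrompt
  split_ifs
  · rw [hS]
    exact R.length_prompt_le (length_edgeList S) (edgeList_lt S)
  · exact R.length_blankPrompt_le N

/-- A learner that succeeds, on average over its batches, when each batch comes from a random
thinker refutes the existence of local pseudorandom generators. -/
theorem no_learner_of_localPRGExists (hPRG : LocalPRGExists) {c : ℝ} (hc : 0 < c) {δ : ℝ}
    (hδ : δ < 1) {M : ℕ → ℕ} {pM : Polynomial ℕ}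
    (hM : ∀ d, 1 ≤ d → 1 ≤ M d ∧ M d ≤ pM.eval d) (p : Polynomial ℕ) (L : Learner) (u : Bool)
    (hhalts : ∀ R : Reduction, R.L = L → R.uniform = u → ∃ N₀, R.Halts N₀)
    (hlearn : ∀ R : Reduction, R.L = L → R.uniform = u → ∃ N₀, ∀ N, N₀ ≤ N → ∃ q : ℕ,
      (q : ℝ) ≤ ((p.eval (R.d N) : ℕ) : ℝ) * (R.k N : ℝ) ^ (2 - c) ∧
      ∀ (D : PMF (List Bool)) (h : List Bool → Bool) (w : Fin R.n → Fin (R.d N) → ℝ),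
        SupportedOn (R.d N) D → (∀ v, e2e (linThinker (w v)) R.T = h) →
        ENNReal.ofReal (1 - δ) ≤ Ex (iid ((PMF.uniformOfFintype (Fin R.n)).bind fun v =>
          batchLaw D (linThinker (w v)) R.T (M (R.d N))) q) fun S =>
            Ex (coins (R.coinCount N)) (ind fun r => Pr D (fun z => ¬ Outputs R.L.predict
              (encPredictInput (R.hypothesis N q S r) z) (encBool (h z))) ≤ 1 / (R.k N : ℝ))) :
    False := by
  -- The order of the choices matters: first `e` from `c` and the degrees, then the exponent `j` of
  -- the trial cost, then the stretch `j + 2`, and only then `K` and `P`. Of the two extra powers of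
  -- `N`, one absorbs constants and the other pays for the `N` trials.
  obtain ⟨e, he⟩ := exists_nat_ge (((p.natDegree + 2 * pM.natDegree + 3 : ℕ) : ℝ) / c)
  have he' : ((p.natDegree + 2 * pM.natDegree + 3 : ℕ) : ℝ) ≤ (e + 1 : ℕ) * c := by
    rw [div_le_iff₀ hc] at he
    refine he.trans (mul_le_mul_of_nonneg_right ?_ hc.le)
    push_cast
    linarith
  obtain ⟨j, hj⟩ : ∃ j, j = (e + 1) * L.coinBound.natDegree +
      (p.natDegree + (e + 1) * 2 + (pM.natDegree + 1)) + 1 := ⟨_, rfl⟩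
  obtain ⟨K, P, hP⟩ := hPRG (j + 2) (by omega)
  let R : Reduction := ⟨L, K, e, u⟩
  obtain ⟨N₁, hN₁⟩ := hhalts R rfl rfl
  obtain ⟨N₂, hN₂⟩ := hlearn R rfl rfl
  obtain ⟨A, hA⟩ := R.growth_d.eval p
  obtain ⟨B, hB⟩ := R.growth_d.eval pM
  simp only [one_mul] at hA hB
  have hcost := (R.growth_trialCost p pM).eventually_le
  have hsmall : ∀ᶠ N : ℕ in atTop, (16 * A * B ^ 2 : ℝ) / N < (1 - δ) / 2 :=
    (tendsto_const_div_atTop_nhds_zero_nat _).eventually_lt_const (by linarith)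
  obtain ⟨N₃, hN₃⟩ := eventually_atTop.1
    (hcost.and (hsmall.and (R.eventually_control_lt.and (R.growth_d.eval pM).eventually_le)))
  set t := ENNReal.ofReal (1 - δ) with ht
  have ht0 : 0 < t := ENNReal.ofReal_pos.2 (by linarith)
  refine R.not_isPRG (s := j + 2) P (hN₁.mono (le_max_left N₁ (max N₂ (max N₃ 1))))
    (τ := t / 4) (ENNReal.div_pos ht0.ne' (by simp)) ?_ hP
  intro N hN hne
  simp only [max_le_iff] at hN
  obtain ⟨hNN₁, hNN₂, hNN₃, hN1⟩ := hN
  obtain ⟨q, hq, hsucc⟩ := hN₂ N hNN₂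
  obtain ⟨hcostN, hsmallN, hcontrol, hMN⟩ := hN₃ N hNN₃
  have hd1 : 1 ≤ R.d N := hN1.trans (R.le_d N)
  obtain ⟨hM1, hM2⟩ := hM (R.d N) hd1
  have hk4 : 4 ≤ R.k N := Nat.le_mul_of_pos_right _ (Nat.pow_pos hN1)
  have hq2 : q ≤ p.eval (R.d N) * R.k N ^ 2 := by
    have h1 : (R.k N : ℝ) ^ (2 - c) ≤ (R.k N : ℝ) ^ 2 := by
      rw [← Real.rpow_two]
      refine Real.rpow_le_rpow_of_exponent_le ?_ (by linarith)
      exact_mod_cast (show 1 ≤ R.k N by omega)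
    have h2 := hq.trans (mul_le_mul_of_nonneg_left h1 (Nat.cast_nonneg _))
    exact_mod_cast h2
  have hcostN' : R.trialCost N q (M (R.d N)) (R.control N) ≤ N ^ (j + 1) := by
    rw [hj]
    exact (R.trialCost_le hq2 hM2 hcontrol).trans hcostN
  have hpow : N ^ (j + 1) ≤ N ^ (j + 2) := Nat.pow_le_pow_right hN1 (by omega)
  have hbatch : 1 ≤ R.batchCost (M (R.d N)) (R.control N) :=
    le_trans (Nat.mul_pos hM1 (Nat.succ_pos _)) (Nat.le_add_left _ _)
  refine ⟨q, M (R.d N), R.control N, ?_, hM1, ?_, hcontrol, ?_, fun x => ?_⟩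
  · refine le_trans ?_ (hcostN'.trans hpow)
    rw [Reduction.trialCost]
    have := Nat.le_mul_of_pos_right q hbatch
    omega
  · exact hM2.trans (hMN.trans (Nat.pow_le_pow_right hN1 (by omega)))
  · rw [pow_succ']
    exact Nat.mul_le_mul_left _ hcostN'
  -- The thinkers depend on the seed, but the distinguisher never uses them; they only certify the
  -- success of the learner on a sample that is close to the simulated one.
  · obtain ⟨w, h, hcot, hblank, hh⟩ := R.exists_thinkers hN1 P x
    refine R.le_Ex_trial hcot hblank hh (h := h) ?_ (by omega)
      (hsucc _ h w (R.supportedOn P x (R.control N)) hh) ?_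
    · have := Nat.mul_le_mul_left N (R.two_pow_control_le hN1)
      rw [Reduction.k, pow_succ]
      calc 2 * (N * 2 ^ R.control N) ≤ 2 * (N * (2 * N ^ R.e)) := Nat.mul_le_mul_left _ this
        _ = _ := by ring
    · have h1 := (R.collision_bound hN1 (hA N hN1) (hB N hN1) hc.le he' hq hM2).trans hsmallN.le
      have h2 := ENNReal.ofReal_le_ofReal h1
      rw [ENNReal.ofReal_div_of_pos (by norm_num), ← ht, ENNReal.ofReal_mul (Nat.cast_nonneg _),
        ENNReal.ofReal_pow (by positivity), ENNReal.ofReal_mul (Nat.cast_nonneg _),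
        ENNReal.ofReal_pow (by norm_num), ENNReal.ofReal_inv_of_pos (by norm_num)] at h2
      simpa using h2

theorem Learner.SucceedsOn.le_Ex {R : Reduction} {N q κ : ℕ} {δ : ℝ} {D : PMF (List Bool)}
    {h : List Bool → Bool} {law : PMF BatchedSample} (hκ : R.thinkers q = κ)
    (hS : R.L.SucceedsOn (R.d N) (R.k N) R.T κ δ D h law) :
    ENNReal.ofReal (1 - δ) ≤ Ex law fun S => Ex (coins (R.coinCount N)) (ind fun r =>
      Pr D (fun z => ¬ Outputs R.L.predict (encPredictInput (R.hypothesis N q S r) z)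
        (encBool (h z))) ≤ 1 / (R.k N : ℝ)) := by
  subst hκ
  rw [Learner.SucceedsOn, Pr_eq, ← ENNReal.ofReal_le_iff_le_toReal (Ex_ind_ne_top _ _)] at hS
  refine hS.trans ?_
  simp only [Ex_bind, Ex_map]
  refine Ex_mono fun S => Ex_mono fun r => ind_le_ind ?_
  rintro ⟨hyp, h1, h2⟩
  rw [Reduction.hypothesis, Outputs.result_eq h1]
  exact h2

theorem Reduction.le_k (R : Reduction) {N : ℕ} (hN : 1 ≤ N) : 3 ≤ R.k N :=
  le_trans (by norm_num) (Nat.le_mul_of_pos_right 4 (Nat.pow_pos hN))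

theorem Reduction.eventually_le_growth (R : Reduction) {g : ℕ → ℝ} (hg : Tendsto g atTop atTop) :
    ∃ N₀, ∀ N, N₀ ≤ N → 1 ≤ N ∧ (R.T : ℝ) ≤ g (R.d N) := by
  have h1 : Tendsto R.d atTop atTop := tendsto_atTop_mono R.le_d tendsto_id
  obtain ⟨N₀, h⟩ := eventually_atTop.1
    ((eventually_ge_atTop 1).and ((hg.comp h1).eventually_ge_atTop (R.T : ℝ)))
  exact ⟨N₀, h⟩

/-- The `n` rotations are the thinkers of the adversary. Both `n` and `T` are constant in `N`, hence
eventually at most `g d`, and the batch size is at least one, so the bound on the number of examples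
bounds the number of batches. -/
theorem not_learnsFromRandomThinkers (hPRG : LocalPRGExists) {c : ℝ} (hc : 0 < c) {δ : ℝ}
    (hδ : δ < 1) {g : ℕ → ℝ} (hg : Tendsto g atTop atTop) {M : ℕ → ℕ} {pM : Polynomial ℕ}
    (hM : ∀ d, 1 ≤ d → 1 ≤ M d ∧ M d ≤ pM.eval d) (p : Polynomial ℕ)
    (q : ℕ → ℕ → ℕ → ℕ → ℕ) (L : Learner)
    (hq : ∀ d k T κ : ℕ, 1 ≤ d → 3 ≤ k → 1 ≤ T → (T : ℝ) ≤ g d → 1 ≤ κ → (κ : ℝ) ≤ g d →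
      ((q d k T κ * M d : ℕ) : ℝ) ≤ ((p.eval d : ℕ) : ℝ) * (k : ℝ) ^ (2 - c)) :
    ¬ L.LearnsFromRandomThinkers g M δ q := by
  rintro ⟨hrun, hlearn⟩
  have hadm : ∀ (R : Reduction) (N : ℕ), (R.T : ℝ) ≤ g (R.d N) →
      1 ≤ R.T ∧ (R.T : ℝ) ≤ g (R.d N) ∧ 1 ≤ R.n ∧ (R.n : ℝ) ≤ g (R.d N) := fun R N h =>
    ⟨Nat.le_add_left _ _, h, R.n_pos, le_trans (by
      exact_mod_cast (show R.n ≤ R.T by rw [Reduction.T]; omega)) h⟩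
  refine no_learner_of_localPRGExists hPRG hc hδ hM p L true ?_ ?_
  · rintro R rfl hu
    obtain ⟨N₀, hN₀⟩ := R.eventually_le_growth hg
    refine ⟨N₀, fun N m S r hN _ hB hr => ?_⟩
    have hκ : R.thinkers m = R.n := by rw [Reduction.thinkers, if_pos hu]
    rw [hκ]
    exact hrun (R.d N) (R.k N) R.T R.n S r ((hN₀ N hN).1.trans (R.le_d N)) (R.le_k (hN₀ N hN).1)
      (hadm R N (hN₀ N hN).2) hB hr
  · rintro R rfl hu
    obtain ⟨N₀, hN₀⟩ := R.eventually_le_growth hg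
    refine ⟨N₀, fun N hN => ?_⟩
    have hd : 1 ≤ R.d N := (hN₀ N hN).1.trans (R.le_d N)
    have hk := R.le_k (hN₀ N hN).1
    obtain ⟨h1, h2, h3, h4⟩ := hadm R N (hN₀ N hN).2
    refine ⟨q (R.d N) (R.k N) R.T R.n, le_trans ?_ (hq _ _ _ _ hd hk h1 h2 h3 h4),
      fun D h w hD hw => ?_⟩
    · exact_mod_cast Nat.le_mul_of_pos_right _ (hM _ hd).1
    · exact Learner.SucceedsOn.le_Ex (by rw [Reduction.thinkers, if_pos hu])
        (hlearn (R.d N) (R.k N) R.T R.n hd hk h1 h2 h4 D h w hD hw)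

theorem not_learnsFromDistinctThinkers (hPRG : LocalPRGExists) {c : ℝ} (hc : 0 < c) {δ : ℝ}
    (hδ : δ < 1) {g : ℕ → ℝ} (hg : Tendsto g atTop atTop) {M : ℕ → ℕ} {pM : Polynomial ℕ}
    (hM : ∀ d, 1 ≤ d → 1 ≤ M d ∧ M d ≤ pM.eval d) (p : Polynomial ℕ)
    (κ : ℕ → ℕ → ℕ → ℕ) (L : Learner)
    (hκ : ∀ d k T : ℕ, 1 ≤ d → 3 ≤ k → 1 ≤ T → (T : ℝ) ≤ g d →
      (κ d k T : ℝ) ≤ ((p.eval d : ℕ) : ℝ) * (k : ℝ) ^ (2 - c)) :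
    ¬ L.LearnsFromDistinctThinkers g M δ κ := by
  rintro ⟨hrun, hlearn⟩
  refine no_learner_of_localPRGExists hPRG hc hδ hM p L false ?_ ?_
  · rintro R rfl hu
    obtain ⟨N₀, hN₀⟩ := R.eventually_le_growth hg
    refine ⟨N₀, fun N m S r hN hm hB hr => ?_⟩
    have hth : R.thinkers m = m := by rw [Reduction.thinkers, hu]; rfl
    rw [hth]
    exact hrun (R.d N) (R.k N) R.T m S r ((hN₀ N hN).1.trans (R.le_d N)) (R.le_k (hN₀ N hN).1)
      ⟨Nat.le_add_left _ _, (hN₀ N hN).2, hm.symm⟩ hB hr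
  · rintro R rfl hu
    obtain ⟨N₀, hN₀⟩ := R.eventually_le_growth hg
    refine ⟨N₀, fun N hN => ?_⟩
    have hd : 1 ≤ R.d N := (hN₀ N hN).1.trans (R.le_d N)
    have hk := R.le_k (hN₀ N hN).1
    have hT : 1 ≤ R.T := Nat.le_add_left _ _
    refine ⟨κ (R.d N) (R.k N) R.T, hκ _ _ _ hd hk hT (hN₀ N hN).2, fun D h w hD hw => ?_⟩
    -- Success for every fixed list `v` of rotations implies success on average over independent
    -- uniform rotations.
    refine le_Ex_iid_bind _ _ _ _ _ fun v hv => ?_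
    -- The first rotation certifies that `h` belongs to the class, which is not implied by the list
    -- `v` if there are no batches.
    have hS := hlearn (R.d N) (R.k N) R.T hd hk hT (hN₀ N hN).2 D h (w ⟨0, R.n_pos⟩)
      (fun j => w (v.get (j.cast hv.symm))) hD (hw _) fun j => hw _
    have hlaw : v.map (fun i => batchLaw D (linThinker (w i)) R.T (M (R.d N))) =
        List.ofFn fun j : Fin (κ (R.d N) (R.k N) R.T) =>
          batchLaw D (linThinker (w (v.get (j.cast hv.symm)))) R.T (M (R.d N)) :=
      List.ext_getElem (by simp [hv]) fun i h1 h2 => by simp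
    rw [hlaw]
    exact Learner.SucceedsOn.le_Ex (by rw [Reduction.thinkers, hu]; rfl) hS

end CoTGap

theorem mainTheorem6 (hPRG : CoTGap.LocalPRGExists)
    (c : ℝ) (hc : 0 < c) (δ : ℝ) (hδ : δ < 1)
    (g : ℕ → ℝ) (hg : Tendsto g atTop atTop)
    (M : ℕ → ℕ) (pM : Polynomial ℕ) (hM : ∀ d, 1 ≤ d → 1 ≤ M d ∧ M d ≤ pM.eval d) :
    (¬ ∃ (p : Polynomial ℕ) (q : ℕ → ℕ → ℕ → ℕ → ℕ) (L : CoTGap.Learner),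
      (∀ d k T κ : ℕ, 1 ≤ d → 3 ≤ k → 1 ≤ T → (T : ℝ) ≤ g d → 1 ≤ κ → (κ : ℝ) ≤ g d →
        ((q d k T κ * M d : ℕ) : ℝ) ≤ ((p.eval d : ℕ) : ℝ) * (k : ℝ) ^ (2 - c)) ∧
      L.LearnsFromRandomThinkers g M δ q) ∧
    (¬ ∃ (p : Polynomial ℕ) (κ : ℕ → ℕ → ℕ → ℕ) (L : CoTGap.Learner),
      (∀ d k T : ℕ, 1 ≤ d → 3 ≤ k → 1 ≤ T → (T : ℝ) ≤ g d →
        (κ d k T : ℝ) ≤ ((p.eval d : ℕ) : ℝ) * (k : ℝ) ^ (2 - c)) ∧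
      L.LearnsFromDistinctThinkers g M δ κ) ∧
    (∃ C : ℝ, ∀ d T : ℕ, 1 ≤ d → 1 ≤ T →
      CoTGap.LearnableFromLabels d T fun ε η => C * ((d : ℝ) ^ 2 + Real.log (1 / η)) / ε) := by
  refine ⟨?_, ?_, 2, fun d T hd _ => CoTGap.learnableFromLabels d T hd⟩
  · rintro ⟨p, q, L, hq, hL⟩
    exact CoTGap.not_learnsFromRandomThinkers hPRG hc hδ hg hM p q L hq hL
  · rintro ⟨p, κ, L, hκ, hL⟩
    exact CoTGap.not_learnsFromDistinctThinkers hPRG hc hδ hg hM p κ L hκ hL
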